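/- Let $M=(\mathcal S,\mathcal A,P,c,\gamma)$ be a finite Markov decision process with $\gamma\in(0,1)$ and $n=|\mathcal A|\ge 2$. For every state $s$ let $p\mapsto h^p(s)$ be a convex differentiable function on the simplex $\Delta_n$ whose gradient is Lipschitz with constant $L>0$ (from $\|\cdot\|_1$ to $\|\cdot\|_\infty$). For a policy $\pi$ and $\tau\ge 0$ let $$Q^\pi_\tau(s,a)=\mathbb E\Big[\sum_{t\ge0}\gamma^t\big(c(s_t,a_t)+h^\pi(s_t)+\tau D^{\pi}_{\pi_0}(s_t)\big)\,\Big|\,s_0=s,a_0=a\Big],\qquad V^\pi(s)=\sum_a\pi(a|s)Q_0^\pi(s,a),$$ where $\pi_0$ is the uniform policy and $D^{p}_{p'}=\sum_a p(a)\log\frac{p(a)}{p'(a)}$. Let $\pi^*$ be a policy that minimizes $V^\pi(s)$ for all $s$ simultaneously, $\nu^*$ a stationary distribution of the state chain under $\pi^*$, and $f(\pi)=\sum_s\nu^*(s)V^\pi(s)$. Put $l=\lceil\log_\gamma(1/4)\rceil$, $\tau_k=\frac{1}{\sqrt{\gamma\log n}}2^{-(\lfloor k/l\rfloor+1)}$,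 $\eta_k=\frac{1-\gamma}{\gamma\tau_k}$, $\mu_k=1+\eta_k\tau_k=1/\gamma$, $L_k=\eta_kL+\mu_k$. The inexact SAPMD method starts from $v_0=\pi_0$ uniform. In step $k$ it receives a random estimate $\mathcal Q_k$ of $Q^{\pi_k}_{\tau_k}$ and runs, for all states $s$ in parallel, $T_k\ge 1$ iterations of accelerated gradient descent (AGD) from $x_0=y_0=\pi_0(\cdot|s)$ on $$\min_{p\in\Delta_n}\ \phi(p)+\chi(p),\qquad \phi(p)=\eta_k[\langle\mathcal Q_k(s,\cdot),p\rangle+h^p(s)],\quad \chi(p)=\eta_k\tau_kD^p_{\pi_0}(s)+D^p_{v_k}(s),$$ that is, $\underline x_t=(1-q_t)y_{t-1}+q_tx_{t-1}$, $x_t=\arg\min_{x\in\Delta_n}\{r_t[\langle\nabla\phi(\underline x_t),x\rangle+\chi(x)]+D^x_{x_{t-1}}\}$, $y_t=(1-\rho_t)y_{t-1}+\rho_tx_t$; here, with $t_0=\lfloor2\sqrt{L_k/\mu_k}-1\rfloor$ and $\kappa=\mu_k/L_k$, one takes $\rho_t=q_t=\frac2{t+1}$, $r_t=\frac t{2L_k}$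 for $t\le t_0$, and $\rho_t=\sqrt\kappa$, $q_t=\frac{\sqrt\kappa-\kappa}{1-\kappa}$, $r_t=\frac1{\sqrt{L_k\mu_k}-\mu_k}$ for $t>t_0$. Then $(\pi_{k+1},v_{k+1})=(y_{T_k},x_{T_k})$. The numbers $T_k$ are such that $\varepsilon_k(T_k)\le\frac{(1-\gamma)^2}{2\gamma^2(1+\gamma)}$, where $\varepsilon_k(t)=2L_k\min\{(1-\sqrt{\kappa})^{t-1},\frac2{t(t+1)}\}$. Let $(\mathcal F_k)$ be a filtration such that $\mathcal Q_k$ is $\mathcal F_{k+1}$-measurable and square integrable, and suppose that, almost surely, $\|\mathbb E[\mathcal Q_k|\mathcal F_k]-Q^{\pi_k}_{\tau_k}\|_\infty\le 2^{-(\lfloor k/l\rfloor+2)}$ and $\mathbb E[\|\mathcal Q_k-Q^{\pi_k}_{\tau_k}\|_\infty^2\,|\,\mathcal F_k]\le4^{-(\lfloor k/l\rfloor+2)}$ for every $k$. (1) For every $k\ge0$, $f(\pi_k)-f(\pi^*)$ is integrable and $\mathbb E[f(\pi_k)-f(\pi^*)]\le2^{-\lfloor k/l\rfloor}B$, where $$B=f(\pi_0)-f(\pi^*)+\frac1{1-\gamma}\Big(\frac{3\sqrt{\log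 n}}{\sqrt\gamma}+\frac{5(2-\gamma)}2+\max\Big\{1,\frac{1-\gamma}\gamma\Big\}\frac{5\sqrt{\log n}}{4\sqrt\gamma}\Big).$$ (2) If moreover each $T_k$ is the smallest integer $t\ge1$ with $\varepsilon_k(t)\le\frac{(1-\gamma)^2}{2\gamma^2(1+\gamma)}$, then for every $\epsilon\in(0,1/2]$ there is $K$ such that $\mathbb E[f(\pi_k)-f(\pi^*)]\le\epsilon$ for all $k\ge K$, while the total number $N$ of evaluations of the gradient $\nabla h^p(\cdot,\cdot)$ at policies $p$ (one per AGD iteration) in the first $K$ steps satisfies $$N\le l\,\Big(2+\log\Big(\frac{16L\sqrt{\log n}\,B}{(1-\gamma)\epsilon}+\frac8{(1-\gamma)^2}\Big)\Big)\Big(\log_2\frac{2B}\epsilon+5\sqrt{\frac{(1-\gamma)LB\sqrt{\gamma\log n}}\epsilon}\Big),$$ and, if $\epsilon\le L$, also $$N\le\frac{30(2+\log_2(1/\gamma))}{1-\gamma}\Big(1+\sqrt{B\sqrt{\log n}}\Big)\,(\log_\gamma\epsilon)\sqrt{L/\epsilon}.$$ In particular, $N=O\big((\log_\gamma\epsilon)\sqrt{L/\epsilon}\big)$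 with a constant that depends only on $\gamma$, $n$ and $f(\pi_0)-f(\pi^*)$. -/

import Mathlib

open scoped BigOperators MeasureTheory

noncomputable section

/-- A finite discounted Markov decision process with states `S` and actions `A`:
`P s a s'` is the probability of moving from `s` to `s'` under the action `a`. -/
structure MDP (S A : Type*) [Fintype S] where
  P : S → A → S → ℝ
  c : S → A → ℝ
  γ : ℝ
  P_nonneg : ∀ s a s', 0 ≤ P s a s'
  P_sum : ∀ s a, ∑ s', P s a s' = 1
  γ_pos : 0 < γ
  γ_lt_one : γ < 1

/-- `π s a` is the probability of taking the action `a` in the state `s`. -/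
def IsPolicy {S A : Type*} [Fintype A] (π : S → A → ℝ) : Prop :=
  ∀ s, π s ∈ stdSimplex ℝ A

/-- The uniform policy. -/
def uniformPolicy (S A : Type*) [Fintype A] : S → A → ℝ :=
  fun _ _ => 1 / (Fintype.card A : ℝ)

/-- The uniform distribution on the actions. -/
def uniformDist (A : Type*) [Fintype A] : A → ℝ :=
  fun _ => 1 / (Fintype.card A : ℝ)

/-- Kullback–Leibler divergence `KL(p ‖ p')`, the Bregman distance `D_{p'}^{p}` of the entropy.
It is used only where all `p' a` are positive; terms with `p a = 0` are `0`. -/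
def klDist {A : Type*} [Fintype A] (p p' : A → ℝ) : ℝ :=
  ∑ a, p a * Real.log (p a / p' a)

/-- `h s p` is the regularizer `h^p(s)`, a convex differentiable function of the action
distribution `p` at `s`; `dh s p` is its gradient, which is Lipschitz continuous on the simplex
with constant `L` (from the `ℓ₁` norm to the dual sup norm). -/
structure IsSmoothConvexRegularizer {S A : Type*} [Fintype A]
    (h : S → (A → ℝ) → ℝ) (dh : S → (A → ℝ) → (A → ℝ)) (L : ℝ) : Prop where
  convex : ∀ s, ConvexOn ℝ (stdSimplex ℝ A) (h s)
  hasGradient : ∀ s, ∀ p ∈ stdSimplex ℝ A,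
    HasFDerivWithinAt (h s)
      (∑ a, dh s p a • (ContinuousLinearMap.proj a : (A → ℝ) →L[ℝ] ℝ)) (stdSimplex ℝ A) p
  lipschitz : ∀ s, ∀ p ∈ stdSimplex ℝ A, ∀ p' ∈ stdSimplex ℝ A, ∀ a,
    |dh s p a - dh s p' a| ≤ L * ∑ b, |p b - p' b|

section Values

variable {S A : Type*} [Fintype S] [Fintype A]

/-- The law of `(s_t, a_t)` when `(s_0, a_0)` has law `m`, `s_{t+1} ∼ P(· | s_t, a_t)` and
`a_{t+1} ∼ π(· | s_{t+1})`. -/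
def stateActionLaw (M : MDP S A) (π : S → A → ℝ) (m : S → A → ℝ) : ℕ → S → A → ℝ
  | 0 => m
  | t + 1 => fun s' a' =>
      (∑ s, ∑ a, stateActionLaw M π m t s a * M.P s a s') * π s' a'

/-- `𝔼 ∑_t γ^t [c(s_t, a_t) + h^π(s_t) + τ D_{π₀}^π(s_t)]` when `(s_0, a_0)` has law `m`
and `π₀` is uniform. -/
def discountedCost (M : MDP S A) (h : S → (A → ℝ) → ℝ) (τ : ℝ) (π : S → A → ℝ)
    (m : S → A → ℝ) : ℝ :=
  ∑' t : ℕ, M.γ ^ t * ∑ s, ∑ a, stateActionLaw M π m t s a *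
    (M.c s a + h s (π s) + τ * klDist (π s) (uniformDist A))

open Classical in
/-- The perturbed action-value function `Q_τ^π(s, a)`. -/
def Qval (M : MDP S A) (h : S → (A → ℝ) → ℝ) (τ : ℝ) (π : S → A → ℝ) (s : S) (a : A) : ℝ :=
  discountedCost M h τ π (fun s' a' => if s' = s ∧ a' = a then 1 else 0)

open Classical in
/-- The (unperturbed) state-value function `V^π(s)`. -/
def Vval (M : MDP S A) (h : S → (A → ℝ) → ℝ) (π : S → A → ℝ) (s : S) : ℝ :=
  discountedCost M h 0 π (fun s' a' => if s' = s then π s' a' else 0)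

/-- `π` minimizes the value function over all policies at all states simultaneously. -/
def IsOptimalPolicy (M : MDP S A) (h : S → (A → ℝ) → ℝ) (πs : S → A → ℝ) : Prop :=
  IsPolicy πs ∧ ∀ π : S → A → ℝ, IsPolicy π → ∀ s, Vval M h πs s ≤ Vval M h π s

/-- `ν` is a stationary state distribution of the Markov chain induced by `π`. -/
def IsStationaryDist (M : MDP S A) (π : S → A → ℝ) (ν : S → ℝ) : Prop :=
  ν ∈ stdSimplex ℝ S ∧ ∀ s', ∑ s, ν s * ∑ a, π s a * M.P s a s' = ν s'

/-- The objective `f(π) = 𝔼_{s ∼ ν} [V^π(s)]`. -/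
def objective (M : MDP S A) (h : S → (A → ℝ) → ℝ) (ν : S → ℝ) (π : S → A → ℝ) : ℝ :=
  ∑ s, ν s * Vval M h π s

end Values

section AcceleratedGradient

open Classical in
/-- A minimizer of `F` over the simplex (the zero vector if there is none). In the algorithm
below the minimizer always exists and is unique. -/
def simplexArgmin {A : Type*} [Fintype A] (F : (A → ℝ) → ℝ) : A → ℝ :=
  if hF : ∃ p ∈ stdSimplex ℝ A, IsMinOn F (stdSimplex ℝ A) p then hF.choose else fun _ => 0

/-- The last iteration `t₀ = ⌊2 √(Lφ / μΦ) - 1⌋` of the first phase. -/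
def agdSwitch (Lφ μΦ : ℝ) : ℤ := ⌊2 * Real.sqrt (Lφ / μΦ) - 1⌋

/-- The averaging weight `ρ_t`. -/
def agdRho (Lφ μΦ : ℝ) (t : ℕ) : ℝ :=
  if (t : ℤ) ≤ agdSwitch Lφ μΦ then 2 / ((t : ℝ) + 1) else Real.sqrt (μΦ / Lφ)

/-- The extrapolation weight `q_t`. -/
def agdQ (Lφ μΦ : ℝ) (t : ℕ) : ℝ :=
  if (t : ℤ) ≤ agdSwitch Lφ μΦ then 2 / ((t : ℝ) + 1)
  else (Real.sqrt (μΦ / Lφ) - μΦ / Lφ) / (1 - μΦ / Lφ)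

/-- The stepsize `r_t`. -/
def agdR (Lφ μΦ : ℝ) (t : ℕ) : ℝ :=
  if (t : ℤ) ≤ agdSwitch Lφ μΦ then (t : ℝ) / (2 * Lφ)
  else 1 / (Real.sqrt (Lφ * μΦ) - μΦ)

/-- The accuracy `ε(t)` that is guaranteed after `t ≥ 1` accelerated gradient iterations. -/
def agdAccuracy (Lφ μΦ : ℝ) (t : ℕ) : ℝ :=
  2 * Lφ * min ((1 - Real.sqrt (μΦ / Lφ)) ^ (t - 1)) (2 / ((t : ℝ) * ((t : ℝ) + 1)))

/-- The state of the accelerated gradient method, run in parallel for all states of the MDP.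
`gradCalls` counts the evaluations of the gradient `p ↦ ∇h^p(·, ·)` of the regularizer. -/
structure AGDState (S A : Type*) where
  x : S → A → ℝ
  y : S → A → ℝ
  gradCalls : ℕ

/-- One iteration of accelerated gradient descent with parameters `q`, `r`, `ρ` for minimizing,
at every state `s`, `φ_s(p) + χ_s(p)` over the simplex, where
`φ_s(p) = η (⟨G s, p⟩ + h^p(s))` is the smooth part, which enters through its gradient only
(its convexity modulus `μφ` is `0`), and
`χ_s(p) = η τ D_{π₀}^p(s) + D_v^p(s)` is the simple part. -/
def agdStep {S A : Type*} [Fintype A] (dh : S → (A → ℝ) → (A → ℝ))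
    (η τ : ℝ) (G v : S → A → ℝ) (q r ρ : ℝ) (z : AGDState S A) : AGDState S A :=
  let u : S → A → ℝ := fun s a => (1 - q) * z.y s a + q * z.x s a
  let dφ : S → A → ℝ := fun s a => η * (G s a + dh s (u s) a)
  let x' : S → A → ℝ := fun s => simplexArgmin fun p =>
    r * ((∑ a, dφ s a * p a) + (η * τ * klDist p (uniformDist A) + klDist p (v s)))
      + klDist p (z.x s)
  { x := x'
    y := fun s a => (1 - ρ) * z.y s a + ρ * x' s a
    gradCalls := z.gradCalls + 1 }

/-- The state after `t` iterations (numbered `1, …, t`) from `x₀ = y₀ = π₀` uniform. -/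
def agdRun {S A : Type*} [Fintype A] (dh : S → (A → ℝ) → (A → ℝ))
    (η τ : ℝ) (G v : S → A → ℝ) (Lφ μΦ : ℝ) : ℕ → AGDState S A
  | 0 => { x := uniformPolicy S A, y := uniformPolicy S A, gradCalls := 0 }
  | t + 1 => agdStep dh η τ G v (agdQ Lφ μΦ (t + 1)) (agdR Lφ μΦ (t + 1)) (agdRho Lφ μΦ (t + 1))
      (agdRun dh η τ G v Lφ μΦ t)

end AcceleratedGradient

section Sapmd

/-- The epoch length `l = ⌈log_γ (1/4)⌉`. -/
def epochLen (γ : ℝ) : ℕ := ⌈Real.logb γ (1 / 4)⌉₊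

/-- The perturbation `τ_k = 2^{-(⌊k/l⌋ + 1)} / √(γ log n)`, with `n` the number of actions. -/
def sapmdTau (γ : ℝ) (n : ℕ) (k : ℕ) : ℝ :=
  1 / Real.sqrt (γ * Real.log n) * (1 / 2) ^ (k / epochLen γ + 1)

/-- The stepsize `η_k = (1 - γ) / (γ τ_k)`. -/
def sapmdEta (γ : ℝ) (n : ℕ) (k : ℕ) : ℝ := (1 - γ) / (γ * sapmdTau γ n k)

/-- The convexity modulus `1 + η_k τ_k` of the simple part of the `k`-th subproblem. -/
def sapmdMu (γ : ℝ) (n : ℕ) (k : ℕ) : ℝ := 1 + sapmdEta γ n k * sapmdTau γ n k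

/-- The smoothness constant handed to the accelerated gradient method in the `k`-th subproblem.
The smooth part has the Lipschitz constant `η_k L`; adding the modulus of the simple part gives
an upper bound of it for which all parameters of the method are well defined. -/
def sapmdSmooth (γ : ℝ) (n : ℕ) (L : ℝ) (k : ℕ) : ℝ := sapmdEta γ n k * L + sapmdMu γ n k

/-- The prescribed accuracy of the subproblem solutions, the same for all `k`. -/
def sapmdAccuracy (γ : ℝ) : ℝ := (1 - γ) ^ 2 / (2 * γ ^ 2 * (1 + γ))

/-- The state of the inexact SAPMD method: the policy `π_k`, the prox-center `v_k`, and the total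
number of evaluations of the gradient of the regularizer so far. -/
structure SapmdState (S A : Type*) where
  pol : S → A → ℝ
  center : S → A → ℝ
  gradCalls : ℕ

/-- The inexact SAPMD method with discount factor `γ`, driven by the sequence `G` of estimates of
the perturbed action-value functions, with `T k` accelerated gradient iterations in step `k`. -/
def sapmdRun {S A : Type*} [Fintype A] (γ : ℝ) (dh : S → (A → ℝ) → (A → ℝ)) (L : ℝ)
    (T : ℕ → ℕ) (G : ℕ → S → A → ℝ) : ℕ → SapmdState S A
  | 0 => { pol := uniformPolicy S A, center := uniformPolicy S A, gradCalls := 0 }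
  | k + 1 =>
      let st := sapmdRun γ dh L T G k
      let n := Fintype.card A
      let out := agdRun dh (sapmdEta γ n k) (sapmdTau γ n k) (G k) st.center
        (sapmdSmooth γ n L k) (sapmdMu γ n k) (T k)
      { pol := out.y
        center := out.x
        gradCalls := st.gradCalls + out.gradCalls }

/-- The bracket in the convergence bound, for the initial gap `Δ = f(π₀) - f(π*)`. -/
def sapmdRateConst (γ : ℝ) (n : ℕ) (Δ : ℝ) : ℝ :=
  Δ + 1 / (1 - γ) *
    (3 * Real.sqrt (Real.log n) / Real.sqrt γ + 5 * (2 - γ) / 2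
      + max 1 ((1 - γ) / γ) * (5 * Real.sqrt (Real.log n) / (4 * Real.sqrt γ)))

end Sapmd

end

/-! The method is mirror descent for the cost perturbed by τ times an entropy, with τ halved after
every epoch of length l. The proof tracks `lyapunov`: the perturbed value gap averaged over ν*, plus
τ/(1-γ) times the averaged divergence of π* from the prox-center. The subproblem inequality compared
with π* controls the advantage of π*. As ν* is stationary under π*, the averaged advantage of π*
over the old policy is exactly (1-γ) times the value difference. The choice ητ = (1-γ)/γ, μ = 1/γ
makes both parts of `lyapunov` contract by the same factor γ, up to errors (`lyapunov_step`).

An inexact subproblem solution satisfies no optimality condition. Its substitute is a property of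
the accelerated method (`agdRun_convergence`): for every comparison point p, the objective gap at
y_t plus μ times the divergence of p from x_t is at most ε(t) times the divergence of p from the
uniform distribution. This is why the x-iterate becomes the next prox-center, and the choice p = y_t
shows that the policy and the center stay close. Every prox objective is a multiple of the negative
entropy plus an affine function, so its minimizer is a Gibbs distribution and the three-point
inequality is an identity. Positivity of the iterates and measurability in the noise follow from the
same formula.

The error of the estimate enters in two ways. Paired with v_k - π*, where v_k is known before the
estimate is drawn, only its conditional bias survives in expectation. Its other occurrences are
bounded by the squared error through Pinsker's and Young's inequalities.

In epoch i, the temperature, the bias contribution, the variance contribution and the solver error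
are all of order 2^(-i). Since γ^l ≤ 1/4, one epoch halves the bound, including the cost of lowering
τ (`epoch_recursion`). This gives the rate.

For the complexity, η_k is proportional to 1/τ_k, so the condition number grows like 2^i and the
number of inner iterations like √2^i, up to a logarithm or a factor depending on γ. The geometric
sum is governed by the last epoch, where 2^i is about B/ε; this produces the √(L/ε). -/

/-! ### Relative entropy on the simplex: Pinsker's inequality, strong convexity, Gibbs
distributions. -/

section Entropy

/-- The function `t ↦ (t + 1) log t - 2 (t - 1)` is increasing on `(0, ∞)`. -/
theorem monotoneOn_add_one_mul_log :
    MonotoneOn (fun t : ℝ => (t + 1) * Real.log t - 2 * (t - 1)) (Set.Ioi 0) := by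
  have hder : ∀ t ∈ Set.Ioi (0 : ℝ),
      HasDerivAt (fun t : ℝ => (t + 1) * Real.log t - 2 * (t - 1))
        (Real.log t + t⁻¹ - 1) t := by
    intro t ht
    have ht' : t ≠ 0 := ne_of_gt ht
    have h1 := ((hasDerivAt_id t).add_const (1 : ℝ)).mul (Real.hasDerivAt_log ht')
    have h2 := ((hasDerivAt_id t).sub_const (1 : ℝ)).const_mul (2 : ℝ)
    refine (h1.sub h2).congr_deriv ?_
    simp only [id]
    field_simp
    ring
  refine monotoneOn_of_deriv_nonneg (convex_Ioi 0)
    (fun t ht => (hder t ht).continuousAt.continuousWithinAt) ?_ ?_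
  · intro t ht
    rw [interior_Ioi] at ht
    exact (hder t ht).differentiableAt.differentiableWithinAt
  · intro t ht
    rw [interior_Ioi] at ht
    rw [(hder t ht).deriv]
    have := Real.one_sub_inv_le_log_of_pos ht
    linarith

/-- The difference of the two sides has derivative 2((t+1) log t - 2(t-1)), which is increasing and
vanishes at 1. So the difference is convex with minimum value 0 at t = 1. -/
theorem kl_scalar_bound {t : ℝ} (ht : 0 < t) :
    3 / 2 * (t - 1) ^ 2 ≤ (t * Real.log t - t + 1) * (t + 2) := by
  let g : ℝ → ℝ := fun t => (t * Real.log t - t + 1) * (t + 2) - 3 / 2 * (t - 1) ^ 2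
  have hder : ∀ t ∈ Set.Ioi (0 : ℝ),
      HasDerivAt g (2 * ((t + 1) * Real.log t - 2 * (t - 1))) t := by
    intro t ht
    have ht' : t ≠ 0 := ne_of_gt ht
    have h1 := (((hasDerivAt_id t).mul (Real.hasDerivAt_log ht')).sub (hasDerivAt_id t)).add_const
      (1 : ℝ)
    have h2 := h1.mul ((hasDerivAt_id t).add_const (2 : ℝ))
    have h3 := (((hasDerivAt_id t).sub_const (1 : ℝ)).pow 2).const_mul (3 / 2 : ℝ)
    refine (h2.sub h3).congr_deriv ?_
    simp only [id, Pi.mul_apply, Pi.sub_apply]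
    field_simp
    norm_num
    ring
  have hconv : ConvexOn ℝ (Set.Ioi (0 : ℝ)) g := by
    refine MonotoneOn.convexOn_of_deriv (convex_Ioi 0)
      (fun t ht => (hder t ht).continuousAt.continuousWithinAt) ?_ ?_
    · intro t ht
      rw [interior_Ioi] at ht
      exact (hder t ht).differentiableAt.differentiableWithinAt
    · rw [interior_Ioi]
      intro a ha b hb hab
      rw [(hder a ha).deriv, (hder b hb).deriv]
      have := monotoneOn_add_one_mul_log ha hb hab
      simp only at this
      linarith
  have hmin : IsMinOn g (Set.Ioi 0) 1 := by
    refine hconv.isMinOn_of_rightDeriv_eq_zero (x := 1) ?_ ?_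
    · rw [interior_Ioi]
      exact Set.mem_Ioi.2 one_pos
    · rw [(hder 1 (Set.mem_Ioi.2 one_pos)).hasDerivWithinAt.derivWithin (uniqueDiffWithinAt_Ioi 1)]
      simp
  have := hmin (show t ∈ Set.Ioi (0 : ℝ) from ht)
  simp only [g, Set.mem_ofPred_eq] at this
  norm_num at this
  linarith

/-- The scalar bound at t = x / y, made homogeneous. The denominators x + 2y become the
Cauchy–Schwarz weights in Pinsker's inequality. -/
theorem kl_term_bound {x y : ℝ} (hx : 0 ≤ x) (hy : 0 < y) :
    3 / 2 * ((x - y) ^ 2 / (x + 2 * y)) ≤ x * Real.log (x / y) - x + y := by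
  rcases hx.eq_or_lt with rfl | hx
  · have : (0 - y) ^ 2 / (0 + 2 * y) = y / 2 := by
      field_simp
      ring
    rw [this]
    simp
    linarith
  · have h := kl_scalar_bound (div_pos hx hy)
    have e1 : 3 / 2 * (x / y - 1) ^ 2 = (3 / 2 * (x - y) ^ 2) / y ^ 2 := by
      field_simp
    have e2 : (x / y * Real.log (x / y) - x / y + 1) * (x / y + 2)
        = ((x * Real.log (x / y) - x + y) * (x + 2 * y)) / y ^ 2 := by
      field_simp
    rw [e1, e2, div_le_div_iff_of_pos_right (by positivity)] at h
    rw [← mul_div_assoc, div_le_iff₀ (by positivity)]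
    exact h

variable {A : Type*} [Fintype A]

/-- Pinsker's inequality. -/
theorem sq_sum_abs_sub_le_two_mul_klDist {p q : A → ℝ} (hp : p ∈ stdSimplex ℝ A)
    (hq : q ∈ stdSimplex ℝ A) (hq0 : ∀ a, 0 < q a) :
    (∑ a, |p a - q a|) ^ 2 ≤ 2 * klDist p q := by
  have hw : ∀ a, 0 < p a + 2 * q a := fun a => by linarith [hp.1 a, hq0 a]
  -- Cauchy–Schwarz with weights p + 2q of total mass 3; this 3 times the 2/3 from `kl_term_bound`
  -- is the constant 2.
  have h1 := Finset.sum_sq_le_sum_mul_sum_of_sq_le_mul Finset.univ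
    (r := fun a => |p a - q a|) (f := fun a => (p a - q a) ^ 2 / (p a + 2 * q a))
    (g := fun a => p a + 2 * q a) (fun a _ => div_nonneg (sq_nonneg _) (hw a).le)
    (fun a _ => (hw a).le) (fun a _ => by
      rw [sq_abs, div_mul_cancel₀ _ (hw a).ne'])
  have h2 : ∑ a, (p a + 2 * q a) = 3 := by
    rw [Finset.sum_add_distrib, ← Finset.mul_sum, hp.2, hq.2]
    norm_num
  have h3 : 3 / 2 * ∑ a, (p a - q a) ^ 2 / (p a + 2 * q a) ≤ klDist p q := by
    have : klDist p q = ∑ a, (p a * Real.log (p a / q a) - p a + q a) := by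
      rw [Finset.sum_add_distrib, Finset.sum_sub_distrib, hp.2, hq.2, klDist]
      ring
    rw [this, Finset.mul_sum]
    exact Finset.sum_le_sum fun a _ => kl_term_bound (hp.1 a) (hq0 a)
  rw [h2] at h1
  linarith

theorem klDist_nonneg {p q : A → ℝ} (hp : p ∈ stdSimplex ℝ A)
    (hq : q ∈ stdSimplex ℝ A) (hq0 : ∀ a, 0 < q a) : 0 ≤ klDist p q := by
  nlinarith [sq_sum_abs_sub_le_two_mul_klDist hp hq hq0, sq_nonneg (∑ a, |p a - q a|)]

theorem klDist_self {p : A → ℝ} (hp : ∀ a, 0 < p a) : klDist p p = 0 := by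
  simp [klDist, div_self (hp _).ne']

/-- The negative entropy. -/
noncomputable def negEntropy (p : A → ℝ) : ℝ := ∑ a, p a * Real.log (p a)

/-- The reference q enters only through a term linear in p. Convexity gaps therefore do not depend
on q, and sums of divergences collapse to one entropy plus a linear function. -/
theorem klDist_eq_negEntropy_sub {p q : A → ℝ} (hq : ∀ a, 0 < q a) :
    klDist p q = negEntropy p - ∑ a, p a * Real.log (q a) := by
  rw [klDist, negEntropy, ← Finset.sum_sub_distrib]
  refine Finset.sum_congr rfl fun a _ => ?_
  by_cases h : p a = 0
  · simp [h]
  · rw [Real.log_div h (hq a).ne']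
    ring

theorem negEntropy_nonpos {p : A → ℝ} (hp : p ∈ stdSimplex ℝ A) : negEntropy p ≤ 0 := by
  refine Finset.sum_nonpos fun a _ => ?_
  have h1 : p a ≤ 1 := by
    rw [← hp.2]
    exact Finset.single_le_sum (fun b _ => hp.1 b) (Finset.mem_univ a)
  exact mul_nonpos_of_nonneg_of_nonpos (hp.1 a) (Real.log_nonpos (hp.1 a) h1)

section Uniform

variable [Nonempty A]

theorem uniformDist_pos (a : A) : 0 < uniformDist A a := by
  unfold uniformDist
  have : 0 < Fintype.card A := Fintype.card_pos
  positivity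

theorem uniformDist_mem : uniformDist A ∈ stdSimplex ℝ A := by
  refine ⟨fun a => (uniformDist_pos a).le, ?_⟩
  have : (Fintype.card A : ℝ) ≠ 0 := Nat.cast_ne_zero.2 Fintype.card_ne_zero
  simp [uniformDist, this]

theorem klDist_uniformDist {p : A → ℝ} (hp : p ∈ stdSimplex ℝ A) :
    klDist p (uniformDist A) = negEntropy p + Real.log (Fintype.card A) := by
  rw [klDist_eq_negEntropy_sub uniformDist_pos, ← Finset.sum_congr rfl (fun a _ => rfl)]
  simp only [uniformDist, one_div, Real.log_inv, mul_neg, Finset.sum_neg_distrib]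
  rw [← Finset.sum_mul, hp.2]
  ring

theorem klDist_uniformDist_le {p : A → ℝ} (hp : p ∈ stdSimplex ℝ A) :
    klDist p (uniformDist A) ≤ Real.log (Fintype.card A) := by
  rw [klDist_uniformDist hp]
  linarith [negEntropy_nonpos hp]

theorem klDist_uniformDist_nonneg {p : A → ℝ} (hp : p ∈ stdSimplex ℝ A) :
    0 ≤ klDist p (uniformDist A) :=
  klDist_nonneg hp uniformDist_mem uniformDist_pos

end Uniform

theorem convexComb_mem {x y : A → ℝ} (hx : x ∈ stdSimplex ℝ A) (hy : y ∈ stdSimplex ℝ A)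
    {ρ : ℝ} (h0 : 0 ≤ ρ) (h1 : ρ ≤ 1) :
    (fun a => (1 - ρ) * y a + ρ * x a) ∈ stdSimplex ℝ A := by
  have := convex_stdSimplex ℝ A hy hx (sub_nonneg.2 h1) h0 (by ring)
  exact this

theorem convexComb_pos {A : Type*} {x y : A → ℝ} (hx : ∀ a, 0 < x a) (hy : ∀ a, 0 < y a)
    {ρ : ℝ} (h0 : 0 ≤ ρ) (h1 : ρ ≤ 1) (a : A) : 0 < (1 - ρ) * y a + ρ * x a := by
  rcases h0.eq_or_lt with rfl | h0
  · simpa using hy a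
  · have := mul_pos h0 (hx a)
    have := mul_nonneg (sub_nonneg.2 h1) (hy a).le
    linarith

/-- The relative entropy is strongly convex in its first argument with respect to the
`ℓ₁` norm. -/
theorem klDist_convexComb_le {x y v : A → ℝ} (hx : x ∈ stdSimplex ℝ A) (hx0 : ∀ a, 0 < x a)
    (hy : y ∈ stdSimplex ℝ A) (hy0 : ∀ a, 0 < y a) (hv : ∀ a, 0 < v a)
    {ρ : ℝ} (h0 : 0 ≤ ρ) (h1 : ρ ≤ 1) :
    klDist (fun a => (1 - ρ) * y a + ρ * x a) v + ρ * (1 - ρ) / 2 * (∑ a, |x a - y a|) ^ 2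
      ≤ (1 - ρ) * klDist y v + ρ * klDist x v := by
  set w : A → ℝ := fun a => (1 - ρ) * y a + ρ * x a with hw
  have hwm : w ∈ stdSimplex ℝ A := convexComb_mem hx hy h0 h1
  have hw0 : ∀ a, 0 < w a := convexComb_pos hx0 hy0 h0 h1
  have e1 : (∑ a, |y a - w a|) = ρ * ∑ a, |x a - y a| := by
    rw [Finset.mul_sum]
    refine Finset.sum_congr rfl fun a _ => ?_
    rw [show y a - w a = ρ * (y a - x a) by simp only [hw]; ring, abs_mul, abs_of_nonneg h0,
      abs_sub_comm]
  have e2 : (∑ a, |x a - w a|) = (1 - ρ) * ∑ a, |x a - y a| := by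
    rw [Finset.mul_sum]
    refine Finset.sum_congr rfl fun a _ => ?_
    rw [show x a - w a = (1 - ρ) * (x a - y a) by simp only [hw]; ring, abs_mul,
      abs_of_nonneg (sub_nonneg.2 h1)]
  have p1 := sq_sum_abs_sub_le_two_mul_klDist hy hwm hw0
  have p2 := sq_sum_abs_sub_le_two_mul_klDist hx hwm hw0
  rw [e1] at p1
  rw [e2] at p2
  have lin : ∀ f : A → ℝ, ∑ a, w a * f a = (1 - ρ) * ∑ a, y a * f a + ρ * ∑ a, x a * f a := by
    intro f
    rw [Finset.mul_sum, Finset.mul_sum, ← Finset.sum_add_distrib]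
    exact Finset.sum_congr rfl fun a _ => by simp only [hw]; ring
  -- The linear parts cancel, so the convexity gap is independent of v. Pinsker at both end points
  -- then gives ((1-ρ)ρ² + ρ(1-ρ)²)/2 = ρ(1-ρ)/2.
  have key : (1 - ρ) * klDist y v + ρ * klDist x v - klDist w v
      = (1 - ρ) * klDist y w + ρ * klDist x w := by
    rw [klDist_eq_negEntropy_sub hv, klDist_eq_negEntropy_sub hv, klDist_eq_negEntropy_sub hv,
      klDist_eq_negEntropy_sub hw0, klDist_eq_negEntropy_sub hw0, lin, negEntropy.eq_def w, lin]
    ring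
  have q1 := mul_le_mul_of_nonneg_left p1 (sub_nonneg.2 h1)
  have q2 := mul_le_mul_of_nonneg_left p2 h0
  nlinarith [q1, q2, key]

/-- The Gibbs distribution with energy `c` at temperature `β`. -/
noncomputable def gibbs (β : ℝ) (c : A → ℝ) : A → ℝ :=
  fun a => Real.exp (-(c a / β)) / ∑ b, Real.exp (-(c b / β))

section Gibbs

variable [Nonempty A]

theorem gibbs_pos (β : ℝ) (c : A → ℝ) (a : A) : 0 < gibbs β c a :=
  div_pos (Real.exp_pos _) (Finset.sum_pos (fun _ _ => Real.exp_pos _) Finset.univ_nonempty)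

theorem gibbs_mem (β : ℝ) (c : A → ℝ) : gibbs β c ∈ stdSimplex ℝ A := by
  refine ⟨fun a => (gibbs_pos β c a).le, ?_⟩
  unfold gibbs
  rw [← Finset.sum_div, div_self]
  exact (Finset.sum_pos (fun _ _ => Real.exp_pos _) Finset.univ_nonempty).ne'

/-- The Gibbs variational principle, with the exact gap. -/
theorem entropy_add_linear_eq {β : ℝ} (hβ : 0 < β) (c : A → ℝ) {p : A → ℝ}
    (hp : p ∈ stdSimplex ℝ A) :
    β * negEntropy p + ∑ a, c a * p a
      = β * klDist p (gibbs β c) - β * Real.log (∑ b, Real.exp (-(c b / β))) := by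
  have hZ : 0 < ∑ b, Real.exp (-(c b / β)) :=
    Finset.sum_pos (fun _ _ => Real.exp_pos _) Finset.univ_nonempty
  have hlog : ∀ a, Real.log (gibbs β c a)
      = -(c a / β) - Real.log (∑ b, Real.exp (-(c b / β))) := fun a => by
    unfold gibbs
    rw [Real.log_div (Real.exp_pos _).ne' hZ.ne', Real.log_exp]
  rw [klDist_eq_negEntropy_sub (gibbs_pos β c)]
  have : ∑ a, p a * Real.log (gibbs β c a)
      = -(β⁻¹ * ∑ a, c a * p a) - Real.log (∑ b, Real.exp (-(c b / β))) := by
    simp only [hlog, mul_sub, Finset.sum_sub_distrib]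
    rw [← Finset.sum_mul, hp.2, Finset.mul_sum, ← Finset.sum_neg_distrib, one_mul]
    congr 1
    refine Finset.sum_congr rfl fun a _ => ?_
    field_simp
  rw [this]
  field_simp
  ring

/-- If `F` is the sum of `β` times the negative entropy and an affine function, its minimizer over
the simplex is a Gibbs distribution, and the gap is a multiple of the relative entropy. -/
theorem simplexArgmin_eq_gibbs {β : ℝ} (hβ : 0 < β) (c : A → ℝ) (C : ℝ) (F : (A → ℝ) → ℝ)
    (hF : ∀ p ∈ stdSimplex ℝ A, F p = β * negEntropy p + ∑ a, c a * p a + C) :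
    simplexArgmin F = gibbs β c ∧
      ∀ p ∈ stdSimplex ℝ A, F p = F (gibbs β c) + β * klDist p (gibbs β c) := by
  have hgap : ∀ p ∈ stdSimplex ℝ A, F p = F (gibbs β c) + β * klDist p (gibbs β c) := by
    intro p hp
    rw [hF p hp, hF _ (gibbs_mem β c), entropy_add_linear_eq hβ c hp,
      entropy_add_linear_eq hβ c (gibbs_mem β c), klDist_self (gibbs_pos β c)]
    ring
  refine ⟨?_, hgap⟩
  have hex : ∃ p ∈ stdSimplex ℝ A, IsMinOn F (stdSimplex ℝ A) p := by
    refine ⟨gibbs β c, gibbs_mem β c, fun p hp => ?_⟩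
    rw [Set.mem_ofPred_eq, hgap p hp]
    have := mul_nonneg hβ.le (klDist_nonneg hp (gibbs_mem β c) (gibbs_pos β c))
    linarith
  rw [simplexArgmin, dif_pos hex]
  -- The chosen minimizer is arbitrary a priori; the exact gap forces its divergence from the Gibbs
  -- distribution to vanish, and Pinsker then identifies the two.
  obtain ⟨hm, hmin⟩ := hex.choose_spec
  set p := hex.choose
  have h1 : F p ≤ F (gibbs β c) := hmin (gibbs_mem β c)
  rw [hgap p hm] at h1
  have h2 : klDist p (gibbs β c) ≤ 0 := by
    by_contra! h
    nlinarith [mul_pos hβ h]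
  have h3 := sq_sum_abs_sub_le_two_mul_klDist hm (gibbs_mem β c) (gibbs_pos β c)
  have h4 : ∑ a, |p a - gibbs β c a| = 0 := by
    have := sq_nonneg (∑ a, |p a - gibbs β c a|)
    exact pow_eq_zero_iff (two_ne_zero) |>.1 (by linarith)
  funext a
  have := (Finset.sum_eq_zero_iff_of_nonneg fun a _ => abs_nonneg _).1 h4 a (Finset.mem_univ a)
  exact sub_eq_zero.1 (abs_eq_zero.1 this)

end Gibbs

end Entropy

/-! ### First-order inequalities for the regularizer. -/

section SmoothConvex

variable {S A : Type*} [Fintype A] {h : S → (A → ℝ) → ℝ} {dh : S → (A → ℝ) → (A → ℝ)} {L : ℝ}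

/-- Reduces the first-order inequalities to one variable. The derivative is one within [0, 1]
because differentiability is assumed only relative to the simplex. -/
theorem IsSmoothConvexRegularizer.hasDerivWithinAt_segment
    (hreg : IsSmoothConvexRegularizer h dh L) (s : S) {u p : A → ℝ}
    (hu : u ∈ stdSimplex ℝ A) (hp : p ∈ stdSimplex ℝ A) {t : ℝ} (ht : t ∈ Set.Icc (0 : ℝ) 1) :
    HasDerivWithinAt (fun t : ℝ => h s (fun a => (1 - t) * u a + t * p a))
      (∑ a, dh s (fun a => (1 - t) * u a + t * p a) a * (p a - u a)) (Set.Icc 0 1) t := by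
  have hm : ∀ t ∈ Set.Icc (0 : ℝ) 1, (fun a => (1 - t) * u a + t * p a) ∈ stdSimplex ℝ A :=
    fun t ht => convexComb_mem hp hu ht.1 ht.2
  have h1 : HasDerivAt (fun t : ℝ => (fun a => (1 - t) * u a + t * p a)) (fun a => p a - u a) t := by
    rw [hasDerivAt_pi]
    intro a
    have := (((hasDerivAt_id t).const_sub 1).mul_const (u a)).add
      ((hasDerivAt_id t).mul_const (p a))
    refine this.congr_deriv ?_
    simp
    ring
  have h2 := (hreg.hasGradient s _ (hm t ht)).comp_hasDerivWithinAt t h1.hasDerivWithinAt hm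
  refine h2.congr_deriv ?_
  simp

/-- The gradient inequality. -/
theorem IsSmoothConvexRegularizer.gradient_le (hreg : IsSmoothConvexRegularizer h dh L) (s : S)
    {u p : A → ℝ} (hu : u ∈ stdSimplex ℝ A) (hp : p ∈ stdSimplex ℝ A) :
    h s u + ∑ a, dh s u a * (p a - u a) ≤ h s p := by
  have hconv : ConvexOn ℝ (Set.Icc (0 : ℝ) 1)
      (fun t : ℝ => h s (fun a => (1 - t) * u a + t * p a)) := by
    refine ⟨convex_Icc 0 1, fun t₁ h₁ t₂ h₂ a b ha hb hab => ?_⟩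
    have := (hreg.convex s).2 (convexComb_mem hp hu h₁.1 h₁.2) (convexComb_mem hp hu h₂.1 h₂.2)
      ha hb hab
    refine le_trans (le_of_eq ?_) this
    refine congrArg (h s) (funext fun c => ?_)
    simp only [smul_eq_mul, Pi.add_apply, Pi.smul_apply]
    linear_combination (-u c) * hab
  have := hconv.le_slope_of_hasDerivWithinAt (x := 0) (y := 1) (by simp) (by simp) one_pos
    (hreg.hasDerivWithinAt_segment s hu hp (by simp))
  simp [slope] at this
  linarith

/-- The descent lemma. -/
theorem IsSmoothConvexRegularizer.le_gradient_add_sq (hreg : IsSmoothConvexRegularizer h dh L)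
    (s : S) {u p : A → ℝ} (hu : u ∈ stdSimplex ℝ A) (hp : p ∈ stdSimplex ℝ A) :
    h s p ≤ h s u + ∑ a, dh s u a * (p a - u a) + L / 2 * (∑ a, |p a - u a|) ^ 2 := by
  set d := ∑ a, |p a - u a| with hd
  -- The regularizer along the segment minus its quadratic model; the Lipschitz bound on the
  -- gradient makes the derivative nonpositive.
  set k : ℝ → ℝ := fun t => h s (fun a => (1 - t) * u a + t * p a)
    - (t * ∑ a, dh s u a * (p a - u a) + L / 2 * d ^ 2 * t ^ 2) with hk
  have hder : ∀ t ∈ Set.Icc (0 : ℝ) 1, HasDerivWithinAt k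
      (∑ a, dh s (fun a => (1 - t) * u a + t * p a) a * (p a - u a)
        - (∑ a, dh s u a * (p a - u a) + L * d ^ 2 * t)) (Set.Icc 0 1) t := by
    intro t ht
    have h1 := hreg.hasDerivWithinAt_segment s hu hp ht
    have h2 := ((hasDerivAt_id t).mul_const (∑ a, dh s u a * (p a - u a))).add
      (((hasDerivAt_id t).pow 2).const_mul (L / 2 * d ^ 2))
    refine (h1.sub h2.hasDerivWithinAt).congr_deriv ?_
    simp
    ring
  have hanti : AntitoneOn k (Set.Icc 0 1) := by
    refine antitoneOn_of_deriv_nonpos (convex_Icc 0 1)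
      (fun t ht => (hder t ht).continuousWithinAt) ?_ ?_
    · intro t ht
      exact ((hder t (interior_subset ht)).mono interior_subset).differentiableWithinAt
    · intro t ht
      have ht' := interior_subset ht
      rw [((hder t ht').hasDerivAt (mem_interior_iff_mem_nhds.1 ht)).deriv,
        ← sub_sub, ← Finset.sum_sub_distrib, sub_nonpos]
      have hsum : (∑ b, |((1 - t) * u b + t * p b) - u b|) = t * d := by
        rw [hd, Finset.mul_sum]
        refine Finset.sum_congr rfl fun b _ => ?_
        rw [show (1 - t) * u b + t * p b - u b = t * (p b - u b) by ring, abs_mul,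
          abs_of_nonneg ht'.1]
      calc ∑ a, (dh s (fun a => (1 - t) * u a + t * p a) a * (p a - u a)
            - dh s u a * (p a - u a))
          ≤ ∑ a, (L * (t * d)) * |p a - u a| := by
            refine Finset.sum_le_sum fun a _ => ?_
            rw [← sub_mul]
            refine (le_abs_self _).trans ?_
            rw [abs_mul]
            refine mul_le_mul_of_nonneg_right ?_ (abs_nonneg _)
            rw [← hsum]
            exact hreg.lipschitz s _ (convexComb_mem hp hu ht'.1 ht'.2) _ hu a
        _ = L * d ^ 2 * t := by
            rw [← Finset.mul_sum, ← hd]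
            ring
  have := hanti (show (0 : ℝ) ∈ Set.Icc (0 : ℝ) 1 by simp) (show (1 : ℝ) ∈ Set.Icc (0 : ℝ) 1 by simp)
    zero_le_one
  simp [hk] at this
  linarith

theorem IsSmoothConvexRegularizer.continuousOn (hreg : IsSmoothConvexRegularizer h dh L) (s : S) :
    ContinuousOn (h s) (stdSimplex ℝ A) :=
  fun p hp => (hreg.hasGradient s p hp).continuousWithinAt

theorem IsSmoothConvexRegularizer.continuousOn_gradient (hreg : IsSmoothConvexRegularizer h dh L)
    (s : S) (a : A) : ContinuousOn (fun p => dh s p a) (stdSimplex ℝ A) := by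
  intro p hp
  rw [ContinuousWithinAt, tendsto_iff_dist_tendsto_zero]
  have hlim : Filter.Tendsto (fun p' : A → ℝ => L * ∑ b, |p' b - p b|)
      (nhdsWithin p (stdSimplex ℝ A)) (nhds 0) := by
    have hc : Continuous fun p' : A → ℝ => L * ∑ b, |p' b - p b| := by fun_prop
    have := hc.tendsto p
    simp only [sub_self, abs_zero, Finset.sum_const_zero, mul_zero] at this
    exact this.mono_left nhdsWithin_le_nhds
  refine squeeze_zero' (Filter.Eventually.of_forall fun _ => dist_nonneg) ?_ hlim
  filter_upwards [self_mem_nhdsWithin] with p' hp'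
  exact hreg.lipschitz s p' hp' p hp a

end SmoothConvex

/-! ### One accelerated gradient iteration with arbitrary parameters. -/

section AGD

variable {S A : Type*} [Fintype A] [Nonempty A]
  {h : S → (A → ℝ) → ℝ} {dh : S → (A → ℝ) → (A → ℝ)} {L : ℝ}

/-- The energy of the Gibbs distribution computed by one proximal step. -/
noncomputable def proxEnergy (r : ℝ) (d v x : A → ℝ) : A → ℝ := fun a =>
  r * d a - r * Real.log (v a) - Real.log (x a)

/-- The objective of one proximal step. -/
noncomputable def proxObjective (η τ r : ℝ) (d v x : A → ℝ) (p : A → ℝ) : ℝ :=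
  r * ((∑ a, d a * p a) + (η * τ * klDist p (uniformDist A) + klDist p v)) + klDist p x

/-- The three divergences contribute negative entropies with weights rητ, r and 1; the rest is
affine. Hence the usual three-point inequality holds with equality. -/
theorem proxObjective_argmin {η τ r : ℝ} (hητ : 0 ≤ η * τ) (hr : 0 < r) (d : A → ℝ) {v x : A → ℝ}
    (hv : ∀ a, 0 < v a) (hx : ∀ a, 0 < x a) :
    simplexArgmin (proxObjective η τ r d v x)
        = gibbs (1 + r * (1 + η * τ)) (proxEnergy r d v x) ∧
      ∀ p ∈ stdSimplex ℝ A, proxObjective η τ r d v x p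
        = proxObjective η τ r d v x (simplexArgmin (proxObjective η τ r d v x))
          + (1 + r * (1 + η * τ)) * klDist p (simplexArgmin (proxObjective η τ r d v x)) := by
  have hβ : 0 < 1 + r * (1 + η * τ) := by positivity
  have := simplexArgmin_eq_gibbs hβ (proxEnergy r d v x)
    (r * (η * τ * Real.log (Fintype.card A))) (proxObjective η τ r d v x) (fun p hp => by
      rw [proxObjective, klDist_uniformDist hp, klDist_eq_negEntropy_sub hv,
        klDist_eq_negEntropy_sub hx]
      have : ∑ a, proxEnergy r d v x a * p a = r * ∑ a, d a * p a
          - r * ∑ a, p a * Real.log (v a) - ∑ a, p a * Real.log (x a) := by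
        rw [Finset.mul_sum, Finset.mul_sum, ← Finset.sum_sub_distrib, ← Finset.sum_sub_distrib]
        refine Finset.sum_congr rfl fun a _ => ?_
        rw [proxEnergy]
        ring
      rw [this]
      ring)
  refine ⟨this.1, ?_⟩
  rw [this.1]
  exact this.2

/-- The objective `φ + χ` of the subproblem at the state `s`. -/
noncomputable def subObjective (h : S → (A → ℝ) → ℝ) (η τ : ℝ) (g v : S → A → ℝ) (s : S)
    (p : A → ℝ) : ℝ :=
  η * ((∑ a, g s a * p a) + h s p) + (η * τ * klDist p (uniformDist A) + klDist p (v s))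

/-- Both sequences of the accelerated gradient method stay in the interior of the simplex. -/
structure AGDState.Interior (z : AGDState S A) : Prop where
  x_mem : ∀ s, z.x s ∈ stdSimplex ℝ A
  x_pos : ∀ s a, 0 < z.x s a
  y_mem : ∀ s, z.y s ∈ stdSimplex ℝ A
  y_pos : ∀ s a, 0 < z.y s a

theorem agdStep_x_eq {η τ q r ρ : ℝ} (hητ : 0 ≤ η * τ) (hr : 0 < r)
    {G v : S → A → ℝ} (hv : ∀ s a, 0 < v s a) {z : AGDState S A} (hz : z.Interior) (s : S) :
    (agdStep dh η τ G v q r ρ z).x s = gibbs (1 + r * (1 + η * τ))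
      (proxEnergy r
        (fun a => η * (G s a + dh s (fun a => (1 - q) * z.y s a + q * z.x s a) a))
        (v s) (z.x s)) :=
  (proxObjective_argmin hητ hr _ (hv s) (hz.x_pos s)).1

theorem AGDState.Interior.step {η τ q r ρ : ℝ} (hητ : 0 ≤ η * τ) (hr : 0 < r) (h0 : 0 ≤ ρ)
    (h1 : ρ ≤ 1) {G v : S → A → ℝ} (hv : ∀ s a, 0 < v s a) {z : AGDState S A}
    (hz : z.Interior) : (agdStep dh η τ G v q r ρ z).Interior := by
  have hm : ∀ s, (agdStep dh η τ G v q r ρ z).x s ∈ stdSimplex ℝ A := fun s => by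
    rw [agdStep_x_eq hητ hr hv hz]
    exact gibbs_mem _ _
  have hp : ∀ s a, 0 < (agdStep dh η τ G v q r ρ z).x s a := fun s => by
    rw [agdStep_x_eq hητ hr hv hz]
    exact gibbs_pos _ _
  exact ⟨hm, hp, fun s => convexComb_mem (hm s) (hz.y_mem s) h0 h1,
    fun s => convexComb_pos (hp s) (hz.y_pos s) h0 h1⟩

/-- One step of the accelerated gradient method. -/
theorem agdStep_progress (hreg : IsSmoothConvexRegularizer h dh L) {η τ q r ρ : ℝ} (hη : 0 ≤ η)
    (hητ : 0 ≤ η * τ) (hr : 0 < r) (hρ0 : 0 ≤ ρ) (hρ1 : ρ ≤ 1) (hq0 : 0 ≤ q) (hq1 : q ≤ 1)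
    {G v : S → A → ℝ} (hv : ∀ s a, 0 < v s a)
    {z : AGDState S A} (hz : z.Interior) {z' : AGDState S A}
    (hz' : z' = agdStep dh η τ G v q r ρ z) (s : S) {p : A → ℝ} (hp : p ∈ stdSimplex ℝ A) :
    subObjective h η τ G v s (z'.y s) - subObjective h η τ G v s p
        + ρ * (1 / r + (1 + η * τ)) * klDist p (z'.x s)
      ≤ (1 - ρ) * (subObjective h η τ G v s (z.y s) - subObjective h η τ G v s p)
        + ρ / r * klDist p (z.x s)
        + (η * L / 2 * (∑ a, |z'.y s a - ((1 - q) * z.y s a + q * z.x s a)|) ^ 2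
          - (1 + η * τ) * (ρ * (1 - ρ) / 2) * (∑ a, |z'.x s a - z.y s a|) ^ 2
          - ρ / r * ((∑ a, |z'.x s a - z.x s a|) ^ 2 / 2)) := by
  have hzi : z'.Interior := by
    rw [hz']
    exact hz.step hητ hr hρ0 hρ1 hv
  set u : A → ℝ := fun a => (1 - q) * z.y s a + q * z.x s a with hu
  have hum : u ∈ stdSimplex ℝ A := convexComb_mem (hz.x_mem s) (hz.y_mem s) hq0 hq1
  set d : A → ℝ := fun a => η * (G s a + dh s u a) with hd
  set x := z.x s
  set y := z.y s
  set x' := z'.x s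
  have hy' : z'.y s = fun a => (1 - ρ) * y a + ρ * x' a := by
    subst hz'
    rfl
  have hx' : x' = simplexArgmin (proxObjective η τ r d (v s) x) := by
    simp only [x', hz']
    rfl
  have prox := (proxObjective_argmin hητ hr d (hv s) (hz.x_pos s)).2 p hp
  rw [← hx'] at prox
  simp only [proxObjective] at prox
  have hxm := hzi.x_mem s
  have hym := hzi.y_mem s
  -- the smooth part
  have desc := mul_le_mul_of_nonneg_left (hreg.le_gradient_add_sq s hum hym) hη
  have gy := mul_le_mul_of_nonneg_left (mul_le_mul_of_nonneg_left
    (hreg.gradient_le s hum (hz.y_mem s)) hη) (sub_nonneg.2 hρ1)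
  have gp := mul_le_mul_of_nonneg_left (mul_le_mul_of_nonneg_left
    (hreg.gradient_le s hum hp) hη) hρ0
  -- the simple part
  have c1 := mul_le_mul_of_nonneg_left (klDist_convexComb_le (hzi.x_mem s) (hzi.x_pos s)
    (hz.y_mem s) (hz.y_pos s) uniformDist_pos hρ0 hρ1) hητ
  have c2 := klDist_convexComb_le (hzi.x_mem s) (hzi.x_pos s)
    (hz.y_mem s) (hz.y_pos s) (hv s) hρ0 hρ1
  rw [← hy'] at c1 c2
  -- The divergence of x' from x produced by the prox identity becomes a negative quadratic term,
  -- kept to absorb the error of the descent lemma.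
  have pin := sq_sum_abs_sub_le_two_mul_klDist hxm (hz.x_mem s) (hz.x_pos s)
  have pin' := mul_le_mul_of_nonneg_left pin (div_nonneg hρ0 hr.le)
  -- linear terms
  have split : ∀ w : A → ℝ, ∑ a, dh s u a * (w a - u a)
      = ∑ a, dh s u a * w a - ∑ a, dh s u a * u a := fun w => by
    rw [← Finset.sum_sub_distrib]
    exact Finset.sum_congr rfl fun a _ => by ring
  have lin : ∀ f : A → ℝ, ∑ a, f a * z'.y s a
      = (1 - ρ) * ∑ a, f a * y a + ρ * ∑ a, f a * x' a := by
    intro f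
    rw [Finset.mul_sum, Finset.mul_sum, ← Finset.sum_add_distrib, hy']
    exact Finset.sum_congr rfl fun a _ => by ring
  have dsum : ∀ w : A → ℝ, ∑ a, d a * w a
      = η * (∑ a, G s a * w a + ∑ a, dh s u a * w a) := by
    intro w
    rw [← Finset.sum_add_distrib, Finset.mul_sum]
    exact Finset.sum_congr rfl fun a _ => by simp only [hd]; ring
  rw [dsum, dsum] at prox
  simp only [split] at desc gy gp
  rw [lin] at desc
  simp only [subObjective]
  rw [lin]
  have prox' : ρ * (η * (∑ a, G s a * p a + ∑ a, dh s u a * p a)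
        + (η * τ * klDist p (uniformDist A) + klDist p (v s))) + ρ / r * klDist p x
      = ρ * (η * (∑ a, G s a * x' a + ∑ a, dh s u a * x' a)
        + (η * τ * klDist x' (uniformDist A) + klDist x' (v s))) + ρ / r * klDist x' x
        + ρ * (1 / r + (1 + η * τ)) * klDist p x' := by
    have := congrArg (fun w => ρ / r * w) prox
    field_simp at this ⊢
    linarith
  linarith [desc, gy, gp, c1, c2, pin', prox']

end AGD

/-! ### Both phases of the accelerated method and its accuracy. -/

section AGDRun

section Parameters

variable {l μ : ℝ} (hμ : 0 < μ) (hl : μ < l)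
include hμ hl

theorem sqrt_ratio_pos : 0 < Real.sqrt (μ / l) :=
  Real.sqrt_pos.2 (div_pos hμ (hμ.trans hl))

theorem sqrt_ratio_lt_one : Real.sqrt (μ / l) < 1 := by
  rw [Real.sqrt_lt' one_pos, one_pow, div_lt_one (hμ.trans hl)]
  exact hl

theorem sq_sqrt_ratio : Real.sqrt (μ / l) ^ 2 = μ / l :=
  Real.sq_sqrt (div_pos hμ (hμ.trans hl)).le

theorem sqrt_mul_eq_mul_sqrt_ratio : Real.sqrt (l * μ) = l * Real.sqrt (μ / l) := by
  have hl0 := hμ.trans hl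
  rw [Real.sqrt_eq_iff_mul_self_eq (by positivity) (by positivity)]
  have := sq_sqrt_ratio hμ hl
  symm
  calc l * Real.sqrt (μ / l) * (l * Real.sqrt (μ / l)) = l ^ 2 * Real.sqrt (μ / l) ^ 2 := by ring
    _ = l * μ := by rw [this]; field_simp

/-- The switch happens when 2/(t+1) drops below √(μ/l), so ρ_t is the larger of these two numbers.
-/
theorem le_agdSwitch_iff (t : ℕ) :
    (t : ℤ) ≤ agdSwitch l μ ↔ Real.sqrt (μ / l) * ((t : ℝ) + 1) ≤ 2 := by
  have hw := sqrt_ratio_pos hμ hl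
  have e : Real.sqrt (l / μ) = (Real.sqrt (μ / l))⁻¹ := by
    rw [← Real.sqrt_inv, inv_div]
  rw [agdSwitch, Int.le_floor, e, Int.cast_natCast, le_sub_iff_add_le, ← div_eq_mul_inv,
    le_div_iff₀ hw, mul_comm]

theorem agdRho_mem (t : ℕ) (ht : 1 ≤ t) : 0 ≤ agdRho l μ t ∧ agdRho l μ t ≤ 1 := by
  have ht' : (1 : ℝ) ≤ t := by exact_mod_cast ht
  unfold agdRho
  split_ifs
  · refine ⟨by positivity, ?_⟩
    rw [div_le_one (by positivity)]
    linarith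
  · exact ⟨(sqrt_ratio_pos hμ hl).le, (sqrt_ratio_lt_one hμ hl).le⟩

theorem agdQ_second_eq : (Real.sqrt (μ / l) - μ / l) / (1 - μ / l)
    = Real.sqrt (μ / l) / (1 + Real.sqrt (μ / l)) := by
  have h0 := sqrt_ratio_pos hμ hl
  have h1 := sqrt_ratio_lt_one hμ hl
  have h2 := sq_sqrt_ratio hμ hl
  set w := Real.sqrt (μ / l)
  rw [← h2, div_eq_div_iff (by nlinarith) (by positivity)]
  ring

theorem agdQ_mem (t : ℕ) (ht : 1 ≤ t) : 0 ≤ agdQ l μ t ∧ agdQ l μ t ≤ 1 := by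
  have ht' : (1 : ℝ) ≤ t := by exact_mod_cast ht
  have h0 := sqrt_ratio_pos hμ hl
  unfold agdQ
  split_ifs
  · refine ⟨by positivity, ?_⟩
    rw [div_le_one (by positivity)]
    linarith
  · rw [agdQ_second_eq hμ hl]
    refine ⟨by positivity, ?_⟩
    rw [div_le_one (by positivity)]
    linarith

theorem agdR_second_eq : 1 / (Real.sqrt (l * μ) - μ)
    = 1 / (l * Real.sqrt (μ / l) * (1 - Real.sqrt (μ / l))) := by
  have hl0 := hμ.trans hl
  congr 1
  rw [sqrt_mul_eq_mul_sqrt_ratio hμ hl]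
  have h2 := sq_sqrt_ratio hμ hl
  have h3 : μ = l * Real.sqrt (μ / l) ^ 2 := by
    rw [h2]
    field_simp
  linear_combination -h3

theorem agdR_pos (t : ℕ) (ht : 1 ≤ t) : 0 < agdR l μ t := by
  have hl0 := hμ.trans hl
  unfold agdR
  split_ifs
  · positivity
  · rw [agdR_second_eq hμ hl]
    have h0 := sqrt_ratio_pos hμ hl
    have h1 := sub_pos.2 (sqrt_ratio_lt_one hμ hl)
    positivity

end Parameters

/-- Consecutive left-hand sides have ratio (t+1)/(t+3) = 1 - 2/(t+3), which is at most 1 - w in this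
range. So before the switch the sublinear rate is the better one. -/
theorem two_div_le_pow {w : ℝ} (t : ℕ) (hw : w * ((t : ℝ) + 2) ≤ 2) (hw0 : 0 ≤ w) :
    2 / (((t : ℝ) + 1) * ((t : ℝ) + 2)) ≤ (1 - w) ^ t := by
  induction t with
  | zero => norm_num
  | succ t ih =>
    push_cast at hw ⊢
    have ih' := ih (by nlinarith)
    have h1 : ((t : ℝ) + 1) / ((t : ℝ) + 3) ≤ 1 - w := by
      rw [div_le_iff₀ (by positivity)]
      nlinarith
    calc 2 / (((t : ℝ) + 1 + 1) * ((t : ℝ) + 1 + 2))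
        = 2 / (((t : ℝ) + 1) * ((t : ℝ) + 2)) * (((t : ℝ) + 1) / ((t : ℝ) + 3)) := by
          field_simp
          ring
      _ ≤ (1 - w) ^ t * (1 - w) := by
          have : 0 ≤ ((t : ℝ) + 1) / ((t : ℝ) + 3) := by positivity
          exact mul_le_mul ih' h1 this (le_trans (by positivity) ih')
      _ = _ := (pow_succ _ _).symm

variable {S A : Type*} [Fintype A] [Nonempty A]
  {h : S → (A → ℝ) → ℝ} {dh : S → (A → ℝ) → (A → ℝ)} {L : ℝ}

theorem agdRun_interior {η τ l μ : ℝ} (hητ : 0 ≤ η * τ) (hμ : 0 < μ) (hl : μ < l)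
    {G v : S → A → ℝ} (hv : ∀ s a, 0 < v s a) (t : ℕ) :
    (agdRun dh η τ G v l μ t).Interior := by
  induction t with
  | zero =>
    exact ⟨fun _ => uniformDist_mem, fun _ => uniformDist_pos, fun _ => uniformDist_mem,
      fun _ => uniformDist_pos⟩
  | succ t ih =>
    have h1 : 1 ≤ t + 1 := Nat.le_add_left 1 t
    have hρ := agdRho_mem hμ hl (t + 1) h1
    exact ih.step hητ (agdR_pos hμ hl _ h1) hρ.1 hρ.2 hv

/-- A step of the first phase. -/
theorem agdRun_first_phase_step (hreg : IsSmoothConvexRegularizer h dh L) (hL : 0 < L)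
    {η τ l μ : ℝ} (hη : 0 < η) (hτ : 0 ≤ τ) (hμ : μ = 1 + η * τ) (hl : l = η * L + μ)
    {G v : S → A → ℝ} (hv : ∀ s a, 0 < v s a) (s : S) {p : A → ℝ} (hp : p ∈ stdSimplex ℝ A)
    (t : ℕ) (ht : ((t + 1 : ℕ) : ℤ) ≤ agdSwitch l μ) :
    ((t : ℝ) + 1) * ((t : ℝ) + 2) * (subObjective h η τ G v s ((agdRun dh η τ G v l μ (t + 1)).y s)
          - subObjective h η τ G v s p)
        + (4 * l + 2 * ((t : ℝ) + 1) * μ) * klDist p ((agdRun dh η τ G v l μ (t + 1)).x s)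
      ≤ (t : ℝ) * ((t : ℝ) + 1) * (subObjective h η τ G v s ((agdRun dh η τ G v l μ t).y s)
          - subObjective h η τ G v s p)
        + 4 * l * klDist p ((agdRun dh η τ G v l μ t).x s) := by
  have hητ : 0 ≤ η * τ := by positivity
  have hμ0 : 0 < μ := by linarith
  have hlt : μ < l := by nlinarith
  have hl0 : 0 < l := hμ0.trans hlt
  have h1 : 1 ≤ t + 1 := Nat.le_add_left 1 t
  have hρ := agdRho_mem hμ0 hlt (t + 1) h1
  have hq := agdQ_mem hμ0 hlt (t + 1) h1
  have hr := agdR_pos hμ0 hlt (t + 1) h1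
  have hz := agdRun_interior (dh := dh) hητ hμ0 hlt (G := G) hv t
  have step := agdStep_progress hreg hη.le hητ hr hρ.1 hρ.2 hq.1 hq.2 hv hz
    (z' := agdRun dh η τ G v l μ (t + 1)) rfl s hp
  have hy : ∀ a, (agdRun dh η τ G v l μ (t + 1)).y s a
      = (1 - agdRho l μ (t + 1)) * (agdRun dh η τ G v l μ t).y s a
        + agdRho l μ (t + 1) * (agdRun dh η τ G v l μ (t + 1)).x s a := fun a => rfl
  simp only [hy] at step
  have eρ : agdRho l μ (t + 1) = 2 / ((t : ℝ) + 2) := by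
    rw [agdRho, if_pos ht]
    push_cast
    ring
  have eq : agdQ l μ (t + 1) = 2 / ((t : ℝ) + 2) := by
    rw [agdQ, if_pos ht]
    push_cast
    ring
  have er : agdR l μ (t + 1) = ((t : ℝ) + 1) / (2 * l) := by
    rw [agdR, if_pos ht]
    push_cast
    ring
  rw [eρ, eq, er, ← hμ] at step
  set z := agdRun dh η τ G v l μ t
  set z' := agdRun dh η τ G v l μ (t + 1)
  have e1 : (∑ a, |(1 - 2 / ((t : ℝ) + 2)) * z.y s a + 2 / ((t : ℝ) + 2) * z'.x s a
      - ((1 - 2 / ((t : ℝ) + 2)) * z.y s a + 2 / ((t : ℝ) + 2) * z.x s a)|)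
      = 2 / ((t : ℝ) + 2) * ∑ a, |z'.x s a - z.x s a| := by
    rw [Finset.mul_sum]
    refine Finset.sum_congr rfl fun a _ => ?_
    rw [add_sub_add_left_eq_sub, ← mul_sub, abs_mul, abs_of_nonneg (by positivity)]
  rw [e1] at step
  -- Since q = ρ, the displacement from the extrapolated point is ρ(x' - x), and ηLρ²/2 ≤ 2l/(t+2)²
  -- is dominated by ρ/(2r) = 2l/((t+1)(t+2)). The strong convexity term is merely discarded.
  have hneg : η * L / 2 * (2 / ((t : ℝ) + 2) * ∑ a, |z'.x s a - z.x s a|) ^ 2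
      - μ * (2 / ((t : ℝ) + 2) * (1 - 2 / ((t : ℝ) + 2)) / 2) * (∑ a, |z'.x s a - z.y s a|) ^ 2
      - 2 / ((t : ℝ) + 2) / (((t : ℝ) + 1) / (2 * l)) * ((∑ a, |z'.x s a - z.x s a|) ^ 2 / 2)
      ≤ 0 := by
    have g1 : 0 ≤ μ * (2 / ((t : ℝ) + 2) * (1 - 2 / ((t : ℝ) + 2)) / 2)
        * (∑ a, |z'.x s a - z.y s a|) ^ 2 := by
      have : 0 ≤ 1 - 2 / ((t : ℝ) + 2) := by
        rw [sub_nonneg, div_le_one (by positivity)]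
        linarith [Nat.cast_nonneg (α := ℝ) t]
      positivity
    have g2 : η * L / 2 * (2 / ((t : ℝ) + 2)) ^ 2
        ≤ 2 / ((t : ℝ) + 2) / (((t : ℝ) + 1) / (2 * l)) / 2 := by
      have a1 : η * L ≤ l := by linarith
      calc η * L / 2 * (2 / ((t : ℝ) + 2)) ^ 2 ≤ l / 2 * (2 / ((t : ℝ) + 2)) ^ 2 := by gcongr
        _ = 2 * l / ((t : ℝ) + 2) * (1 / ((t : ℝ) + 2)) := by field_simp
        _ ≤ 2 * l / ((t : ℝ) + 2) * (1 / ((t : ℝ) + 1)) := by gcongr; norm_num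
        _ = _ := by field_simp
    have g3 := mul_le_mul_of_nonneg_right g2 (sq_nonneg (∑ a, |z'.x s a - z.x s a|))
    nlinarith
  have step' := mul_le_mul_of_nonneg_left (step.trans (add_le_of_nonpos_right hneg))
    (show 0 ≤ ((t : ℝ) + 1) * ((t : ℝ) + 2) by positivity)
  refine (le_of_eq ?_).trans (step'.trans (le_of_eq ?_))
  · field_simp
    ring
  · field_simp
    ring

/-- A step of the second phase. -/
theorem agdRun_second_phase_step (hreg : IsSmoothConvexRegularizer h dh L) (hL : 0 < L)
    {η τ l μ : ℝ} (hη : 0 < η) (hτ : 0 ≤ τ) (hμ : μ = 1 + η * τ) (hl : l = η * L + μ)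
    {G v : S → A → ℝ} (hv : ∀ s a, 0 < v s a) (s : S) {p : A → ℝ} (hp : p ∈ stdSimplex ℝ A)
    (t : ℕ) (ht : ¬ ((t + 1 : ℕ) : ℤ) ≤ agdSwitch l μ) :
    (subObjective h η τ G v s ((agdRun dh η τ G v l μ (t + 1)).y s)
          - subObjective h η τ G v s p)
        + μ * klDist p ((agdRun dh η τ G v l μ (t + 1)).x s)
      ≤ (1 - Real.sqrt (μ / l)) * ((subObjective h η τ G v s ((agdRun dh η τ G v l μ t).y s)
          - subObjective h η τ G v s p) + μ * klDist p ((agdRun dh η τ G v l μ t).x s)) := by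
  have hητ : 0 ≤ η * τ := by positivity
  have hμ0 : 0 < μ := by linarith
  have hlt : μ < l := by nlinarith
  have hl0 : 0 < l := hμ0.trans hlt
  have h1 : 1 ≤ t + 1 := Nat.le_add_left 1 t
  have hρ := agdRho_mem hμ0 hlt (t + 1) h1
  have hq := agdQ_mem hμ0 hlt (t + 1) h1
  have hr := agdR_pos hμ0 hlt (t + 1) h1
  have hz := agdRun_interior (dh := dh) hητ hμ0 hlt (G := G) hv t
  have step := agdStep_progress hreg hη.le hητ hr hρ.1 hρ.2 hq.1 hq.2 hv hz
    (z' := agdRun dh η τ G v l μ (t + 1)) rfl s hp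
  have hy : ∀ a, (agdRun dh η τ G v l μ (t + 1)).y s a
      = (1 - agdRho l μ (t + 1)) * (agdRun dh η τ G v l μ t).y s a
        + agdRho l μ (t + 1) * (agdRun dh η τ G v l μ (t + 1)).x s a := fun a => rfl
  simp only [hy] at step
  have w0 := sqrt_ratio_pos hμ0 hlt
  have w1 := sqrt_ratio_lt_one hμ0 hlt
  have hw2 := sq_sqrt_ratio hμ0 hlt
  have eρ : agdRho l μ (t + 1) = Real.sqrt (μ / l) := by
    rw [agdRho, if_neg ht]
  have eq : agdQ l μ (t + 1) = Real.sqrt (μ / l) / (1 + Real.sqrt (μ / l)) := by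
    rw [agdQ, if_neg ht, agdQ_second_eq hμ0 hlt]
  have er : agdR l μ (t + 1) = 1 / (l * Real.sqrt (μ / l) * (1 - Real.sqrt (μ / l))) := by
    rw [agdR, if_neg ht, agdR_second_eq hμ0 hlt]
  rw [eρ, eq, er, ← hμ] at step
  set w := Real.sqrt (μ / l)
  set z := agdRun dh η τ G v l μ t
  set z' := agdRun dh η τ G v l μ (t + 1)
  have hμw : μ = l * w ^ 2 := by
    rw [hw2]
    field_simp
  have hηL : η * L = l * (1 - w ^ 2) := by
    linarith
  have w1' : 0 < 1 - w := sub_pos.2 w1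
  set dx := ∑ a, |z'.x s a - z.x s a| with hdx
  set dy := ∑ a, |z'.x s a - z.y s a| with hdy
  have dx0 : 0 ≤ dx := Finset.sum_nonneg fun _ _ => abs_nonneg _
  have dy0 : 0 ≤ dy := Finset.sum_nonneg fun _ _ => abs_nonneg _
  have e1 : (∑ a, |(1 - w) * z.y s a + w * z'.x s a
      - ((1 - w / (1 + w)) * z.y s a + w / (1 + w) * z.x s a)|)
      ≤ w / (1 + w) * (dx + w * dy) := by
    rw [hdx, hdy, Finset.mul_sum (f := fun a => |z'.x s a - z.y s a|), ← Finset.sum_add_distrib,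
      Finset.mul_sum]
    refine Finset.sum_le_sum fun a _ => ?_
    have : (1 - w) * z.y s a + w * z'.x s a
        - ((1 - w / (1 + w)) * z.y s a + w / (1 + w) * z.x s a)
        = w / (1 + w) * ((z'.x s a - z.x s a) + w * (z'.x s a - z.y s a)) := by
      field_simp
      ring
    rw [this, abs_mul, abs_of_nonneg (by positivity : 0 ≤ w / (1 + w))]
    refine mul_le_mul_of_nonneg_left ((abs_add_le _ _).trans ?_) (by positivity)
    rw [abs_mul, abs_of_nonneg w0.le]
  set du := ∑ a, |(1 - w) * z.y s a + w * z'.x s a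
      - ((1 - w / (1 + w)) * z.y s a + w / (1 + w) * z.x s a)|
  have du0 : 0 ≤ du := Finset.sum_nonneg fun _ _ => abs_nonneg _
  -- Convexity with weights 1 and w splits du². Because l includes μ, one has ηL = l(1 - w²), and
  -- the two resulting terms are then exactly the available ones: the Pinsker term in dx² and the
  -- strong convexity term in dy².
  have hneg : η * L / 2 * du ^ 2 - μ * (w * (1 - w) / 2) * dy ^ 2
      - w / (1 / (l * w * (1 - w))) * (dx ^ 2 / 2) ≤ 0 := by
    have g1 : du ^ 2 ≤ (w / (1 + w) * (dx + w * dy)) ^ 2 := pow_le_pow_left₀ du0 e1 2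
    have g2 : (dx + w * dy) ^ 2 ≤ (1 + w) * (dx ^ 2 + w * dy ^ 2) := by
      nlinarith [mul_nonneg w0.le (sq_nonneg (dx - dy))]
    have g3 : du ^ 2 ≤ w ^ 2 / (1 + w) * (dx ^ 2 + w * dy ^ 2) := by
      refine g1.trans ?_
      calc (w / (1 + w) * (dx + w * dy)) ^ 2 = (w / (1 + w)) ^ 2 * (dx + w * dy) ^ 2 := by ring
        _ ≤ (w / (1 + w)) ^ 2 * ((1 + w) * (dx ^ 2 + w * dy ^ 2)) := by gcongr
        _ = _ := by field_simp
    have g4 := mul_le_mul_of_nonneg_left g3 (show 0 ≤ η * L / 2 by positivity)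
    have g5 : η * L / 2 * (w ^ 2 / (1 + w) * (dx ^ 2 + w * dy ^ 2))
        = l * (1 - w) * w ^ 2 / 2 * (dx ^ 2 + w * dy ^ 2) := by
      rw [hηL]
      field_simp
      ring
    have g6 : w / (1 / (l * w * (1 - w))) = l * w ^ 2 * (1 - w) := by
      field_simp
    rw [g6, hμw]
    rw [g5] at g4
    linarith [g4]
  refine (le_of_eq ?_).trans ((step.trans (add_le_of_nonpos_right hneg)).trans (le_of_eq ?_))
  · rw [hμw]
    field_simp
    ring
  · rw [hμw]
    field_simp

/-- The weighted steps telescope. The surplus 2tμ in front of the divergence is given up at each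
further step; only its final value is kept, to start the second phase. -/
theorem agdRun_first_phase (hreg : IsSmoothConvexRegularizer h dh L) (hL : 0 < L)
    {η τ l μ : ℝ} (hη : 0 < η) (hτ : 0 ≤ τ) (hμ : μ = 1 + η * τ) (hl : l = η * L + μ)
    {G v : S → A → ℝ} (hv : ∀ s a, 0 < v s a) (s : S) {p : A → ℝ} (hp : p ∈ stdSimplex ℝ A)
    (t : ℕ) (ht : (t : ℤ) ≤ agdSwitch l μ) :
    (t : ℝ) * ((t : ℝ) + 1) * (subObjective h η τ G v s ((agdRun dh η τ G v l μ t).y s)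
          - subObjective h η τ G v s p)
        + (4 * l + 2 * (t : ℝ) * μ) * klDist p ((agdRun dh η τ G v l μ t).x s)
      ≤ 4 * l * klDist p (uniformDist A) := by
  induction t with
  | zero =>
    have : (agdRun dh η τ G v l μ 0).x s = uniformDist A := rfl
    rw [this]
    simp
  | succ t ih =>
    have hητ : 0 ≤ η * τ := by positivity
    have hμ0 : 0 < μ := by linarith
    have hlt : μ < l := by nlinarith
    have h1 := agdRun_first_phase_step hreg hL hη hτ hμ hl hv s hp (G := G) t ht
    have h2 := ih (by push_cast at ht; omega)
    have hz := agdRun_interior (dh := dh) hητ hμ0 hlt (G := G) hv t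
    have h3 := mul_nonneg (mul_nonneg (Nat.cast_nonneg (α := ℝ) t) hμ0.le)
      (klDist_nonneg hp (hz.x_mem s) (hz.x_pos s))
    push_cast
    rw [show (t : ℝ) + 1 + 1 = t + 2 by ring]
    linarith

/-- Convergence of the accelerated gradient method. -/
theorem agdRun_convergence (hreg : IsSmoothConvexRegularizer h dh L) (hL : 0 < L)
    {η τ l μ : ℝ} (hη : 0 < η) (hτ : 0 ≤ τ) (hμ : μ = 1 + η * τ) (hl : l = η * L + μ)
    {G v : S → A → ℝ} (hv : ∀ s a, 0 < v s a) (s : S) {p : A → ℝ} (hp : p ∈ stdSimplex ℝ A)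
    (t : ℕ) (ht : 1 ≤ t) :
    (subObjective h η τ G v s ((agdRun dh η τ G v l μ t).y s) - subObjective h η τ G v s p)
        + μ * klDist p ((agdRun dh η τ G v l μ t).x s)
      ≤ agdAccuracy l μ t * klDist p (uniformDist A) := by
  have hητ : 0 ≤ η * τ := by positivity
  have hμ0 : 0 < μ := by linarith
  have hlt : μ < l := by nlinarith
  have hl0 : 0 < l := hμ0.trans hlt
  have w0 := sqrt_ratio_pos hμ0 hlt
  have w1 := sqrt_ratio_lt_one hμ0 hlt
  have hw2 := sq_sqrt_ratio hμ0 hlt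
  have hμw : μ = l * Real.sqrt (μ / l) ^ 2 := by
    rw [hw2]
    field_simp
  have hD : 0 ≤ klDist p (uniformDist A) := klDist_uniformDist_nonneg hp
  set E : ℕ → ℝ := fun t => (subObjective h η τ G v s ((agdRun dh η τ G v l μ t).y s)
    - subObjective h η τ G v s p) + μ * klDist p ((agdRun dh η τ G v l μ t).x s) with hE
  set w := Real.sqrt (μ / l) with hw
  have first : ∀ t : ℕ, ((t + 1 : ℕ) : ℤ) ≤ agdSwitch l μ →
      E (t + 1) ≤ 2 * l * (1 - w) ^ t * klDist p (uniformDist A) ∧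
      E (t + 1) ≤ 2 * l * (2 / (((t : ℝ) + 1) * ((t : ℝ) + 2))) * klDist p (uniformDist A) := by
    intro t hs
    have h1 := agdRun_first_phase hreg hL hη hτ hμ hl hv s hp (G := G) (t + 1) hs
    have hs' := (le_agdSwitch_iff hμ0 hlt (t + 1)).1 hs
    push_cast at hs' h1
    rw [show (t : ℝ) + 1 + 1 = t + 2 by ring] at hs' h1
    have hz := agdRun_interior (dh := dh) hητ hμ0 hlt (G := G) hv (t + 1)
    have hD' := klDist_nonneg hp (hz.x_mem s) (hz.x_pos s)
    -- Before the switch μ(t+2)² ≤ 4l, so the first-phase bound already contains the divergence with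
    -- the weight μ that the potential E of the second phase requires.
    have hcoef : ((t : ℝ) + 1) * ((t : ℝ) + 2) * μ ≤ 4 * l + 2 * ((t : ℝ) + 1) * μ := by
      have h2 : (w * ((t : ℝ) + 2)) ^ 2 ≤ 2 ^ 2 :=
        pow_le_pow_left₀ (by positivity) hs' 2
      have h3 : μ * ((t : ℝ) + 2) ^ 2 ≤ 4 * l := by
        rw [hμw]
        nlinarith [mul_le_mul_of_nonneg_left h2 hl0.le]
      nlinarith
    have h4 := mul_le_mul_of_nonneg_right hcoef hD'
    have h5 : E (t + 1)
        ≤ 2 * l * (2 / (((t : ℝ) + 1) * ((t : ℝ) + 2))) * klDist p (uniformDist A) := by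
      have : ((t : ℝ) + 1) * ((t : ℝ) + 2) * E (t + 1) ≤ 4 * l * klDist p (uniformDist A) := by
        simp only [hE]
        linarith
      rw [show 2 * l * (2 / (((t : ℝ) + 1) * ((t : ℝ) + 2))) * klDist p (uniformDist A)
        = 4 * l * klDist p (uniformDist A) / (((t : ℝ) + 1) * ((t : ℝ) + 2)) by ring,
        le_div_iff₀ (by positivity)]
      linarith
    refine ⟨h5.trans ?_, h5⟩
    have := two_div_le_pow t hs' w0.le
    gcongr
  -- Both rates hold in both phases: after the switch the contraction factor 1 - w is at most
  -- (t+1)/(t+3), the ratio of consecutive sublinear bounds. Iteration 1 always belongs to the first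
  -- phase, since w ≤ 1.
  have key : ∀ t : ℕ, E (t + 1) ≤ 2 * l * (1 - w) ^ t * klDist p (uniformDist A) ∧
      E (t + 1) ≤ 2 * l * (2 / (((t : ℝ) + 1) * ((t : ℝ) + 2))) * klDist p (uniformDist A) := by
    intro t
    induction t with
    | zero =>
      refine first 0 ?_
      rw [le_agdSwitch_iff hμ0 hlt]
      push_cast
      linarith
    | succ t hprev =>
      by_cases hs : ((t + 1 + 1 : ℕ) : ℤ) ≤ agdSwitch l μ
      · exact first (t + 1) hs
      · have hstep : E (t + 1 + 1) ≤ (1 - w) * E (t + 1) :=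
          agdRun_second_phase_step hreg hL hη hτ hμ hl hv s hp (G := G) (t + 1) hs
        have w1' : 0 ≤ 1 - w := sub_nonneg.2 w1.le
        refine ⟨hstep.trans ((mul_le_mul_of_nonneg_left hprev.1 w1').trans (le_of_eq ?_)),
          hstep.trans ((mul_le_mul_of_nonneg_left hprev.2 w1').trans ?_)⟩
        · rw [pow_succ]
          ring
        · have hs' := mt (le_agdSwitch_iff hμ0 hlt (t + 1 + 1)).2 hs
          push_cast at hs' ⊢
          have h6 : 1 - w ≤ ((t : ℝ) + 1) / ((t : ℝ) + 3) := by
            rw [le_div_iff₀ (by positivity)]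
            nlinarith
          calc (1 - w) * (2 * l * (2 / (((t : ℝ) + 1) * ((t : ℝ) + 2)))
                * klDist p (uniformDist A))
              ≤ ((t : ℝ) + 1) / ((t : ℝ) + 3) * (2 * l * (2 / (((t : ℝ) + 1) * ((t : ℝ) + 2)))
                * klDist p (uniformDist A)) := by
                  gcongr
            _ = _ := by
                  field_simp
                  ring
  obtain ⟨t, rfl⟩ : ∃ t', t = t' + 1 := ⟨t - 1, by omega⟩
  have h7 := key t
  rw [agdAccuracy, ← hw, Nat.add_sub_cancel]
  push_cast
  rw [show (t : ℝ) + 1 + 1 = t + 2 by ring]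
  rcases min_cases ((1 - w) ^ t) (2 / (((t : ℝ) + 1) * ((t : ℝ) + 2))) with h8 | h8
  · rw [h8.1]
    exact h7.1
  · rw [h8.1]
    exact h7.2

end AGDRun

/-! ### Bellman equations, performance difference, and dependence on the perturbation. -/

section Bellman

variable {S A : Type*} [Fintype S] [Fintype A]

/-- The cost of one transition. -/
noncomputable def stageCost (M : MDP S A) (h : S → (A → ℝ) → ℝ) (τ : ℝ) (π : S → A → ℝ)
    (s : S) (a : A) : ℝ :=
  M.c s a + h s (π s) + τ * klDist (π s) (uniformDist A)

open Classical in
/-- The state-value function of the perturbed cost. -/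
noncomputable def perturbedValue (M : MDP S A) (h : S → (A → ℝ) → ℝ) (τ : ℝ) (π : S → A → ℝ)
    (s : S) : ℝ :=
  discountedCost M h τ π (fun s' a' => if s' = s then π s' a' else 0)

theorem Vval_eq_perturbedValue (M : MDP S A) (h : S → (A → ℝ) → ℝ) (π : S → A → ℝ) :
    Vval M h π = perturbedValue M h 0 π := rfl

variable (M : MDP S A) (h : S → (A → ℝ) → ℝ) (τ : ℝ) {π : S → A → ℝ}

/-- Transitions do not increase the ℓ₁ norm of a signed measure, so the discounted series is
dominated by a geometric one for every m. -/
theorem sum_abs_stateActionLaw_le (hπ : IsPolicy π) (m : S → A → ℝ) (t : ℕ) :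
    ∑ s, ∑ a, |stateActionLaw M π m t s a| ≤ ∑ s, ∑ a, |m s a| := by
  induction t with
  | zero => exact le_rfl
  | succ t ih =>
    refine le_trans ?_ ih
    calc ∑ s', ∑ a', |stateActionLaw M π m (t + 1) s' a'|
        = ∑ s', |∑ s, ∑ a, stateActionLaw M π m t s a * M.P s a s'| := by
          refine Finset.sum_congr rfl fun s' _ => ?_
          simp only [stateActionLaw, abs_mul, abs_of_nonneg ((hπ s').1 _)]
          rw [← Finset.mul_sum, (hπ s').2, mul_one]
      _ ≤ ∑ s', ∑ s, ∑ a, |stateActionLaw M π m t s a| * M.P s a s' := by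
          refine Finset.sum_le_sum fun s' _ => (Finset.abs_sum_le_sum_abs _ _).trans ?_
          refine Finset.sum_le_sum fun s _ => (Finset.abs_sum_le_sum_abs _ _).trans ?_
          refine Finset.sum_le_sum fun a _ => ?_
          rw [abs_mul, abs_of_nonneg (M.P_nonneg s a s')]
      _ = ∑ s, ∑ a, |stateActionLaw M π m t s a| := by
          rw [Finset.sum_comm]
          refine Finset.sum_congr rfl fun s _ => ?_
          rw [Finset.sum_comm]
          refine Finset.sum_congr rfl fun a _ => ?_
          rw [← Finset.mul_sum, M.P_sum, mul_one]

theorem summable_discountedCost (hπ : IsPolicy π) (m : S → A → ℝ) :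
    Summable fun t : ℕ => M.γ ^ t * ∑ s, ∑ a, stateActionLaw M π m t s a *
      (M.c s a + h s (π s) + τ * klDist (π s) (uniformDist A)) := by
  refine Summable.of_norm_bounded (g := fun t : ℕ => M.γ ^ t *
    ((∑ s, ∑ a, |m s a|) * ∑ s, ∑ a, |stageCost M h τ π s a|))
    ((summable_geometric_of_lt_one M.γ_pos.le M.γ_lt_one).mul_right _) fun t => ?_
  rw [Real.norm_eq_abs, abs_mul, abs_of_nonneg (pow_nonneg M.γ_pos.le t)]
  refine mul_le_mul_of_nonneg_left ?_ (pow_nonneg M.γ_pos.le t)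
  have hR : ∀ s a, |stageCost M h τ π s a| ≤ ∑ s, ∑ a, |stageCost M h τ π s a| := fun s a =>
    (Finset.single_le_sum (f := fun a => |stageCost M h τ π s a|) (fun _ _ => abs_nonneg _)
      (Finset.mem_univ a)).trans
    (Finset.single_le_sum (f := fun s => ∑ a, |stageCost M h τ π s a|)
      (fun _ _ => Finset.sum_nonneg fun _ _ => abs_nonneg _) (Finset.mem_univ s))
  calc |∑ s, ∑ a, stateActionLaw M π m t s a *
        (M.c s a + h s (π s) + τ * klDist (π s) (uniformDist A))|
      ≤ ∑ s, ∑ a, |stateActionLaw M π m t s a| * ∑ s, ∑ a, |stageCost M h τ π s a| := by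
        refine (Finset.abs_sum_le_sum_abs _ _).trans (Finset.sum_le_sum fun s _ => ?_)
        refine (Finset.abs_sum_le_sum_abs _ _).trans (Finset.sum_le_sum fun a _ => ?_)
        rw [abs_mul]
        exact mul_le_mul_of_nonneg_left (hR s a) (abs_nonneg _)
    _ = (∑ s, ∑ a, |stateActionLaw M π m t s a|) * ∑ s, ∑ a, |stageCost M h τ π s a| := by
        simp only [Finset.sum_mul]
    _ ≤ _ := mul_le_mul_of_nonneg_right (sum_abs_stateActionLaw_le M hπ m t)
        (Finset.sum_nonneg fun _ _ => Finset.sum_nonneg fun _ _ => abs_nonneg _)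

theorem stateActionLaw_succ' (m : S → A → ℝ) (t : ℕ) :
    stateActionLaw M π m (t + 1) = stateActionLaw M π (stateActionLaw M π m 1) t := by
  induction t with
  | zero => rfl
  | succ t ih =>
    rw [stateActionLaw, ih]
    rfl

theorem discountedCost_bellman (hπ : IsPolicy π) (m : S → A → ℝ) :
    discountedCost M h τ π m = ∑ s, ∑ a, m s a * stageCost M h τ π s a
      + M.γ * discountedCost M h τ π (stateActionLaw M π m 1) := by
  rw [discountedCost, (summable_discountedCost M h τ hπ m).tsum_eq_zero_add, discountedCost,
    ← tsum_mul_left]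
  congr 1
  · simp [stateActionLaw, stageCost]
  · refine tsum_congr fun t => ?_
    rw [stateActionLaw_succ' M m t, pow_succ]
    ring

theorem sum_sum_sum_sum_comm {S A : Type*} [Fintype S] [Fintype A] (f : S → A → S → A → ℝ) :
    ∑ s, ∑ a, ∑ s₀, ∑ a₀, f s a s₀ a₀ = ∑ s₀, ∑ a₀, ∑ s, ∑ a, f s a s₀ a₀ := by
  have : ∑ i : S × A, ∑ j : S × A, f i.1 i.2 j.1 j.2 = ∑ j : S × A, ∑ i : S × A, f i.1 i.2 j.1 j.2 :=
    Finset.sum_comm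
  simpa only [Fintype.sum_prod_type] using this

open Classical in
theorem stateActionLaw_eq_sum (m : S → A → ℝ) (t : ℕ) (s' : S) (a' : A) :
    stateActionLaw M π m t s' a' = ∑ s, ∑ a, m s a *
      stateActionLaw M π (fun s' a' => if s' = s ∧ a' = a then 1 else 0) t s' a' := by
  induction t generalizing s' a' with
  | zero =>
    simp only [stateActionLaw]
    rw [Finset.sum_eq_single s', Finset.sum_eq_single a']
    · simp
    · intro b _ hb
      simp [hb.symm]
    · simp
    · intro b _ hb
      simp [hb.symm]
    · simp
  | succ t ih =>
    simp only [stateActionLaw]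
    simp only [← mul_assoc, ← Finset.sum_mul]
    congr 1
    calc ∑ s, ∑ a, stateActionLaw M π m t s a * M.P s a s'
        = ∑ s, ∑ a, ∑ s₀, ∑ a₀, m s₀ a₀ * (stateActionLaw M π
            (fun s' a' => if s' = s₀ ∧ a' = a₀ then 1 else 0) t s a * M.P s a s') := by
          refine Finset.sum_congr rfl fun s _ => Finset.sum_congr rfl fun a _ => ?_
          rw [ih, Finset.sum_mul]
          refine Finset.sum_congr rfl fun s₀ _ => ?_
          rw [Finset.sum_mul]
          exact Finset.sum_congr rfl fun a₀ _ => mul_assoc _ _ _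
      _ = ∑ s₀, ∑ a₀, ∑ s, ∑ a, m s₀ a₀ * (stateActionLaw M π
            (fun s' a' => if s' = s₀ ∧ a' = a₀ then 1 else 0) t s a * M.P s a s') := sum_sum_sum_sum_comm _
      _ = _ := by simp only [Finset.mul_sum]

/-- The law at time t is linear in the initial one, which is a superposition of point masses. -/
theorem discountedCost_eq_sum_Qval (hπ : IsPolicy π) (m : S → A → ℝ) :
    discountedCost M h τ π m = ∑ s, ∑ a, m s a * Qval M h τ π s a := by
  classical
  have hs := hasSum_sum (s := Finset.univ) fun s (_ : s ∈ Finset.univ) =>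
    hasSum_sum (s := Finset.univ) fun a (_ : a ∈ Finset.univ) =>
      (summable_discountedCost M h τ hπ
        (fun s' a' => if s' = s ∧ a' = a then 1 else 0)).hasSum.mul_left (m s a)
  rw [discountedCost]
  refine Eq.trans (tsum_congr fun t => ?_) hs.tsum_eq
  calc M.γ ^ t * ∑ s, ∑ a, stateActionLaw M π m t s a *
        (M.c s a + h s (π s) + τ * klDist (π s) (uniformDist A))
      = ∑ s, ∑ a, ∑ s₀, ∑ a₀, m s₀ a₀ * (M.γ ^ t * (stateActionLaw M π
            (fun s' a' => if s' = s₀ ∧ a' = a₀ then 1 else 0) t s a *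
          (M.c s a + h s (π s) + τ * klDist (π s) (uniformDist A)))) := by
        rw [Finset.mul_sum]
        refine Finset.sum_congr rfl fun s _ => ?_
        rw [Finset.mul_sum]
        refine Finset.sum_congr rfl fun a _ => ?_
        rw [stateActionLaw_eq_sum, Finset.sum_mul, Finset.mul_sum]
        refine Finset.sum_congr rfl fun s₀ _ => ?_
        rw [Finset.sum_mul, Finset.mul_sum]
        exact Finset.sum_congr rfl fun a₀ _ => by ring
    _ = ∑ s₀, ∑ a₀, ∑ s, ∑ a, m s₀ a₀ * (M.γ ^ t * (stateActionLaw M π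
            (fun s' a' => if s' = s₀ ∧ a' = a₀ then 1 else 0) t s a *
          (M.c s a + h s (π s) + τ * klDist (π s) (uniformDist A)))) :=
        sum_sum_sum_sum_comm _
    _ = _ := by simp only [Finset.mul_sum]

theorem perturbedValue_eq (hπ : IsPolicy π) (s : S) :
    perturbedValue M h τ π s = ∑ a, π s a * Qval M h τ π s a := by
  classical
  rw [perturbedValue, discountedCost_eq_sum_Qval M h τ hπ, Finset.sum_eq_single s]
  · simp
  · intro b _ hb
    simp [hb]
  · simp

theorem Qval_eq (hπ : IsPolicy π) (s : S) (a : A) :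
    Qval M h τ π s a
      = stageCost M h τ π s a + M.γ * ∑ s', M.P s a s' * perturbedValue M h τ π s' := by
  classical
  rw [Qval, discountedCost_bellman M h τ hπ, discountedCost_eq_sum_Qval M h τ hπ]
  congr 1
  · rw [Finset.sum_eq_single s, Finset.sum_eq_single a]
    · simp
    · intro b _ hb
      simp [hb]
    · simp
    · intro b _ hb
      simp [hb]
    · simp
  · congr 1
    refine Finset.sum_congr rfl fun s' _ => ?_
    rw [perturbedValue_eq M h τ hπ, Finset.mul_sum]
    refine Finset.sum_congr rfl fun a' _ => ?_
    rw [← mul_assoc]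
    congr 1
    simp only [stateActionLaw]
    congr 1
    rw [Finset.sum_eq_single s, Finset.sum_eq_single a]
    · simp
    · intro b _ hb
      simp [hb]
    · simp
    · intro b _ hb
      simp [hb]
    · simp

/-- The transition operator of the state chain under `π`. -/
noncomputable def stateTransition (π : S → A → ℝ) (U : S → ℝ) (s : S) : ℝ :=
  ∑ a, π s a * ∑ s', M.P s a s' * U s'

theorem perturbedValue_bellman (hπ : IsPolicy π) (s : S) :
    perturbedValue M h τ π s = ∑ a, π s a * stageCost M h τ π s a
      + M.γ * stateTransition M π (perturbedValue M h τ π) s := by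
  rw [perturbedValue_eq M h τ hπ, stateTransition, Finset.mul_sum, ← Finset.sum_add_distrib]
  refine Finset.sum_congr rfl fun a _ => ?_
  rw [Qval_eq M h τ hπ]
  ring

theorem stateTransition_le {C : ℝ} (hπ : IsPolicy π) {U : S → ℝ} (hU : ∀ s, U s ≤ C) (s : S) :
    stateTransition M π U s ≤ C := by
  calc stateTransition M π U s ≤ ∑ a, π s a * C := by
        refine Finset.sum_le_sum fun a _ => mul_le_mul_of_nonneg_left ?_ ((hπ s).1 a)
        calc ∑ s', M.P s a s' * U s' ≤ ∑ s', M.P s a s' * C :=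
              Finset.sum_le_sum fun s' _ => mul_le_mul_of_nonneg_left (hU s') (M.P_nonneg s a s')
          _ = C := by rw [← Finset.sum_mul, M.P_sum, one_mul]
    _ = C := by rw [← Finset.sum_mul, (hπ s).2, one_mul]

/-- A maximum principle for the Bellman equation. -/
theorem le_of_le_add_stateTransition (hπ : IsPolicy π) {U : S → ℝ} {C : ℝ}
    (hU : ∀ s, U s ≤ C + M.γ * stateTransition M π U s) (s : S) : U s ≤ C / (1 - M.γ) := by
  have : Nonempty S := ⟨s⟩
  obtain ⟨s₀, h₀⟩ := Finite.exists_max U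
  have h1 := stateTransition_le M hπ h₀ s₀
  have h2 := hU s₀
  have h3 := mul_le_mul_of_nonneg_left h1 M.γ_pos.le
  rw [le_div_iff₀ (by linarith [M.γ_lt_one])]
  have h4 := mul_le_mul_of_nonneg_right (h₀ s) (sub_nonneg.2 M.γ_lt_one.le)
  linarith

theorem stateTransition_sub (U W : S → ℝ) (s : S) :
    stateTransition M π (fun s => U s - W s) s
      = stateTransition M π U s - stateTransition M π W s := by
  simp only [stateTransition, mul_sub, Finset.sum_sub_distrib]

theorem stateTransition_neg (U : S → ℝ) (s : S) :
    stateTransition M π (fun s => - U s) s = - stateTransition M π U s := by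
  simp only [stateTransition, mul_neg, Finset.sum_neg_distrib]

/-- The advantage of `π'` over `π` at `s`, for the perturbed cost. -/
noncomputable def advantage (π' π : S → A → ℝ) (s : S) : ℝ :=
  (∑ a, Qval M h τ π s a * (π' s a - π s a)) + (h s (π' s) - h s (π s))
    + τ * (klDist (π' s) (uniformDist A) - klDist (π s) (uniformDist A))

/-- The performance difference lemma in fixed point form. -/
theorem perturbedValue_sub_eq {π' : S → A → ℝ} (hπ' : IsPolicy π') (hπ : IsPolicy π) (s : S) :
    perturbedValue M h τ π' s - perturbedValue M h τ π s = advantage M h τ π' π s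
      + M.γ * stateTransition M π' (fun s => perturbedValue M h τ π' s - perturbedValue M h τ π s)
        s := by
  rw [perturbedValue_bellman M h τ hπ' s, stateTransition_sub, mul_sub]
  have e1 : ∑ a, π' s a * stageCost M h τ π' s a = ∑ a, π' s a * stageCost M h τ π s a
      + ((h s (π' s) - h s (π s))
        + τ * (klDist (π' s) (uniformDist A) - klDist (π s) (uniformDist A))) := by
    have : ∀ a, stageCost M h τ π' s a = stageCost M h τ π s a + ((h s (π' s) - h s (π s))
        + τ * (klDist (π' s) (uniformDist A) - klDist (π s) (uniformDist A))) := fun a => by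
      simp only [stageCost]
      ring
    simp only [this, mul_add, Finset.sum_add_distrib]
    simp only [← Finset.sum_mul, (hπ' s).2]
    ring
  have e2 : ∑ a, Qval M h τ π s a * (π' s a - π s a)
      = ∑ a, π' s a * stageCost M h τ π s a
        + M.γ * stateTransition M π' (perturbedValue M h τ π) s - perturbedValue M h τ π s := by
    rw [perturbedValue_eq M h τ hπ s, stateTransition, Finset.mul_sum, ← Finset.sum_add_distrib,
      ← Finset.sum_sub_distrib]
    refine Finset.sum_congr rfl fun a _ => ?_
    rw [Qval_eq M h τ hπ]
    ring
  rw [advantage, e1, e2]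
  ring

theorem sum_stationary_stateTransition {ν : S → ℝ} (hν : IsStationaryDist M π ν) (U : S → ℝ) :
    ∑ s, ν s * stateTransition M π U s = ∑ s, ν s * U s := by
  calc ∑ s, ν s * stateTransition M π U s
      = ∑ s, ∑ s', (ν s * ∑ a, π s a * M.P s a s') * U s' := by
        refine Finset.sum_congr rfl fun s _ => ?_
        simp only [stateTransition, Finset.mul_sum, Finset.sum_mul]
        rw [Finset.sum_comm]
        exact Finset.sum_congr rfl fun s' _ => Finset.sum_congr rfl fun a _ => by ring
    _ = ∑ s', (∑ s, ν s * ∑ a, π s a * M.P s a s') * U s' := by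
        rw [Finset.sum_comm]
        exact Finset.sum_congr rfl fun s' _ => (Finset.sum_mul _ _ _).symm
    _ = _ := Finset.sum_congr rfl fun s' _ => by rw [hν.2]

/-- Averaging over a stationary distribution removes the transition operator. Used for π*, this
makes the performance difference formula exact. -/
theorem sum_stationary_eq_of_fixedPoint {ν : S → ℝ} (hν : IsStationaryDist M π ν) {U b : S → ℝ}
    (hU : ∀ s, U s = b s + M.γ * stateTransition M π U s) :
    (1 - M.γ) * ∑ s, ν s * U s = ∑ s, ν s * b s := by
  have h1 : ∑ s, ν s * U s = ∑ s, ν s * b s + M.γ * ∑ s, ν s * stateTransition M π U s := by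
    rw [Finset.mul_sum, ← Finset.sum_add_distrib]
    refine Finset.sum_congr rfl fun s _ => ?_
    linear_combination ν s * hU s
  rw [sum_stationary_stateTransition M hν] at h1
  linarith

/-- The two Bellman equations share their transition operator. For τ' ≤ τ the source lies between 0
and (τ - τ') log n, so the maximum principle bounds the difference from both sides. -/
theorem perturbedValue_sub_perturbation (hπ : IsPolicy π) (τ' : ℝ) (s : S) :
    perturbedValue M h τ π s - perturbedValue M h τ' π s
      = (τ - τ') * klDist (π s) (uniformDist A)
      + M.γ * stateTransition M π
        (fun s => perturbedValue M h τ π s - perturbedValue M h τ' π s) s := by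
  rw [stateTransition_sub, perturbedValue_bellman M h τ hπ s, perturbedValue_bellman M h τ' hπ s]
  have : ∑ a, π s a * stageCost M h τ π s a = ∑ a, π s a * stageCost M h τ' π s a
      + (τ - τ') * klDist (π s) (uniformDist A) := by
    have : ∀ a, stageCost M h τ π s a = stageCost M h τ' π s a
        + (τ - τ') * klDist (π s) (uniformDist A) := fun a => by
      simp only [stageCost]
      ring
    simp only [this, mul_add, Finset.sum_add_distrib]
    simp only [← Finset.sum_mul, (hπ s).2]
    ring
  rw [this]
  ring

variable [Nonempty A]

theorem perturbedValue_mono_perturbation (hπ : IsPolicy π) {τ τ' : ℝ} (hτ : τ' ≤ τ) (s : S) :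
    perturbedValue M h τ' π s ≤ perturbedValue M h τ π s := by
  have := le_of_le_add_stateTransition M hπ (C := 0)
    (U := fun s => -(perturbedValue M h τ π s - perturbedValue M h τ' π s)) (fun s => by
      rw [stateTransition_neg]
      have h1 := perturbedValue_sub_perturbation M h τ hπ τ' s
      have h2 := mul_nonneg (sub_nonneg.2 hτ) (klDist_uniformDist_nonneg (hπ s))
      linarith) s
  simp only [zero_div] at this
  linarith

theorem perturbedValue_sub_perturbation_le (hπ : IsPolicy π) {τ τ' : ℝ} (hτ : τ' ≤ τ) (s : S) :
    perturbedValue M h τ π s - perturbedValue M h τ' π s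
      ≤ (τ - τ') * Real.log (Fintype.card A) / (1 - M.γ) := by
  refine le_of_le_add_stateTransition M hπ
    (U := fun s => perturbedValue M h τ π s - perturbedValue M h τ' π s) (fun s => ?_) s
  have h1 := perturbedValue_sub_perturbation M h τ hπ τ' s
  have h2 := mul_le_mul_of_nonneg_left (klDist_uniformDist_le (hπ s)) (sub_nonneg.2 hτ)
  linarith

end Bellman

/-! ### Contraction of the Lyapunov function in one inexact step. -/

section PolicyStep

variable {S A : Type*} [Fintype S] [Fintype A]

theorem sum_mul_le_norm_mul_sum_abs (δ : S → A → ℝ) (s : S) (d : A → ℝ) :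
    ∑ a, δ s a * d a ≤ ‖δ‖ * ∑ a, |d a| := by
  rw [Finset.mul_sum]
  refine Finset.sum_le_sum fun a _ => (le_abs_self _).trans ?_
  rw [abs_mul]
  refine mul_le_mul_of_nonneg_right ?_ (abs_nonneg _)
  exact (norm_le_pi_norm (δ s) a).trans (norm_le_pi_norm δ s)

/-- The Lyapunov function of the method: the perturbed optimality gap, averaged over `ν`, plus a
multiple of the divergence of the optimal policy from the prox-center. -/
noncomputable def lyapunov (M : MDP S A) (h : S → (A → ℝ) → ℝ) (ν : S → ℝ) (πs : S → A → ℝ)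
    (τ : ℝ) (π v : S → A → ℝ) : ℝ :=
  (∑ s, ν s * (perturbedValue M h τ π s - perturbedValue M h τ πs s))
    + τ / (1 - M.γ) * ∑ s, ν s * klDist (πs s) (v s)

/-- The subproblem inequality `hsub` is used twice. With p = π it bounds the advantage of π' over π
from above at every state, which serves as approximate policy improvement; with p = π* it gives the
contraction. The noise paired with v - π* stays linear, so that its conditional expectation can be
taken later; all other noise is made quadratic, with the free parameter σ in Young's inequality. -/
theorem lyapunov_step [Nonempty A] (M : MDP S A) (h : S → (A → ℝ) → ℝ) {ν : S → ℝ}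
    {πs : S → A → ℝ}
    (hπs : IsPolicy πs) (hν : IsStationaryDist M πs ν) {τ η : ℝ} (hτ : 0 < τ)
    (hη : η = (1 - M.γ) / (M.γ * τ)) {π v π' v' G : S → A → ℝ} (hπ : IsPolicy π)
    (hv : IsPolicy v) (hv0 : ∀ s a, 0 < v s a) (hπ' : IsPolicy π') (hv' : IsPolicy v')
    (hv'0 : ∀ s a, 0 < v' s a) {e c σ : ℝ} (hσ : 0 < σ)
    (hsub : ∀ s, ∀ p ∈ stdSimplex ℝ A,
      (subObjective h η τ G v s (π' s) - subObjective h η τ G v s p)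
        + 1 / M.γ * klDist p (v' s) ≤ e)
    (hD : ∀ s, klDist (π s) (v s) ≤ M.γ * e) (hc : ∀ s, ∑ a, |π s a - v s a| ≤ c) (hc0 : 0 ≤ c) :
    lyapunov M h ν πs τ π' v' ≤ M.γ * lyapunov M h ν πs τ π v
      + (e / η + η / (2 * (1 - M.γ)) * ‖G - Qval M h τ π‖ ^ 2
        + M.γ / (1 - M.γ) * ((1 + M.γ) * e / η
          + c * (‖G - Qval M h τ π‖ ^ 2 / (2 * σ) + σ / 2)))
      - ∑ s, ν s * ∑ a, (G s a - Qval M h τ π s a) * (v s a - πs s a) := by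
  have hγ := M.γ_pos
  have hγ1 : 0 < 1 - M.γ := sub_pos.2 M.γ_lt_one
  have hη0 : 0 < η := by
    rw [hη]
    positivity
  set N := ‖G - Qval M h τ π‖ with hN
  have hN0 : 0 ≤ N := norm_nonneg _
  set δ : S → A → ℝ := G - Qval M h τ π with hδ
  set ζ : ℝ := (1 + M.γ) * e / η + c * (N ^ 2 / (2 * σ) + σ / 2) with hζ
  have hyoung : N * c ≤ c * (N ^ 2 / (2 * σ) + σ / 2) := by
    rw [mul_comm]
    refine mul_le_mul_of_nonneg_left ?_ hc0
    rw [div_add_div _ _ (by positivity) (by positivity), le_div_iff₀ (by positivity)]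
    nlinarith [sq_nonneg (N - σ)]
  -- the linear term with the estimate in terms of the exact action-value function
  have hG : ∀ s (p q : A → ℝ), (∑ a, G s a * p a) - ∑ a, G s a * q a
      = (∑ a, Qval M h τ π s a * (p a - q a)) + ∑ a, δ s a * (p a - q a) := by
    intro s p q
    rw [← Finset.sum_sub_distrib, ← Finset.sum_add_distrib]
    refine Finset.sum_congr rfl fun a _ => ?_
    simp only [hδ, Pi.sub_apply]
    ring
  have hsplit : ∀ s (p q r : A → ℝ), ∑ a, δ s a * (p a - q a)
      = (∑ a, δ s a * (p a - r a)) + ∑ a, δ s a * (r a - q a) := by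
    intro s p q r
    rw [← Finset.sum_add_distrib]
    exact Finset.sum_congr rfl fun a _ => by ring
  -- Young's inequality for ηN times the ℓ₁ distance of π' and v; half of the squared distance is
  -- paid by the divergence, through Pinsker.
  have hnoise : ∀ s, -(η ^ 2 * N ^ 2 / 2)
      ≤ η * ∑ a, δ s a * (π' s a - v s a) + klDist (π' s) (v s) := by
    intro s
    have h1 := sum_mul_le_norm_mul_sum_abs δ s (fun a => -(π' s a - v s a))
    simp only [abs_neg, mul_neg, Finset.sum_neg_distrib] at h1
    have h2 := sq_sum_abs_sub_le_two_mul_klDist (hπ' s) (hv s) (hv0 s)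
    have h3 := mul_le_mul_of_nonneg_left h1 hη0.le
    nlinarith [sq_nonneg (η * N - ∑ a, |π' s a - v s a|)]
  set X := advantage M h τ π' π with hX
  -- Comparison with p = π: the solver contributes e, the divergence of π from v contributes γe, and
  -- the noise paired with v - π costs at most Nc.
  have hXle : ∀ s, X s ≤ ζ + η * N ^ 2 / 2 := by
    intro s
    have h1 := hsub s (π s) (hπ s)
    have h2 : 0 ≤ 1 / M.γ * klDist (π s) (v' s) :=
      mul_nonneg (by positivity) (klDist_nonneg (hπ s) (hv' s) (hv'0 s))
    have h3 := hD s
    have h4 := hnoise s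
    have h5 := sum_mul_le_norm_mul_sum_abs δ s (fun a => -(v s a - π s a))
    simp only [abs_neg, mul_neg, Finset.sum_neg_distrib] at h5
    have h6 : (∑ a, |v s a - π s a|) ≤ c := by
      simpa only [abs_sub_comm] using hc s
    have h7 := mul_le_mul_of_nonneg_left h6 hN0
    have h8 := mul_le_mul_of_nonneg_left (h5.trans (h7.trans hyoung)) hη0.le
    have h9 : η * X s ≤ (1 + M.γ) * e + η * (c * (N ^ 2 / (2 * σ) + σ / 2))
        + η ^ 2 * N ^ 2 / 2 := by
      have := hG s (π' s) (π s)
      rw [hsplit s (π' s) (π s) (v s)] at this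
      simp only [subObjective] at h1
      simp only [hX, advantage]
      have key := congrArg (fun z => η * z) this
      beta_reduce at key
      linarith
    have h10 : X s ≤ ((1 + M.γ) * e + η * (c * (N ^ 2 / (2 * σ) + σ / 2))
        + η ^ 2 * N ^ 2 / 2) / η := by
      rw [le_div_iff₀ hη0]
      linarith
    refine h10.trans (le_of_eq ?_)
    rw [hζ]
    field_simp
  set U : S → ℝ := fun s => perturbedValue M h τ π' s - perturbedValue M h τ π s with hU
  have hfix : ∀ s, U s = X s + M.γ * stateTransition M π' U s :=
    fun s => perturbedValue_sub_eq M h τ hπ' hπ s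
  have hUle : ∀ s, U s ≤ (ζ + η * N ^ 2 / 2) / (1 - M.γ) := by
    refine fun s => le_of_le_add_stateTransition M hπ' (fun s => ?_) s
    have := hfix s
    have := hXle s
    linarith
  -- The value change U exceeds the advantage X by γ times a transition average of U, which the
  -- maximum principle bounds. This lets U replace X at every state, whatever the visitation measure
  -- of π'.
  have hXge : ∀ s, U s - M.γ * ((ζ + η * N ^ 2 / 2) / (1 - M.γ)) ≤ X s := by
    intro s
    have h1 := hfix s
    have h2 := mul_le_mul_of_nonneg_left (stateTransition_le M hπ' hUle s) hγ.le
    linarith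
  have hmain : ∀ s, U s - advantage M h τ πs π s + (∑ a, δ s a * (v s a - πs s a))
      + τ / (1 - M.γ) * klDist (πs s) (v' s)
      ≤ M.γ * (τ / (1 - M.γ)) * klDist (πs s) (v s)
        + (e / η + η * N ^ 2 / 2 + M.γ * ((ζ + η * N ^ 2 / 2) / (1 - M.γ))) := by
    intro s
    have h1 := hsub s (πs s) (hπs s)
    have h2 := hnoise s
    have h3 := hXge s
    have h4 := hG s (π' s) (πs s)
    rw [hsplit s (π' s) (πs s) (v s)] at h4
    have h5 : (∑ a, Qval M h τ π s a * (π' s a - πs s a))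
        = (∑ a, Qval M h τ π s a * (π' s a - π s a))
          - ∑ a, Qval M h τ π s a * (πs s a - π s a) := by
      rw [← Finset.sum_sub_distrib]
      exact Finset.sum_congr rfl fun a _ => by ring
    rw [h5] at h4
    have h6 : η * (X s - advantage M h τ πs π s + ∑ a, δ s a * (v s a - πs s a))
        + 1 / M.γ * klDist (πs s) (v' s)
        ≤ klDist (πs s) (v s) + e + η ^ 2 * N ^ 2 / 2 := by
      simp only [subObjective] at h1
      simp only [hX, advantage]
      have key := congrArg (fun z => η * z) h4
      beta_reduce at key
      linarith
    have h7 : X s - advantage M h τ πs π s + (∑ a, δ s a * (v s a - πs s a))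
        + τ / (1 - M.γ) * klDist (πs s) (v' s)
        ≤ M.γ * (τ / (1 - M.γ)) * klDist (πs s) (v s) + (e / η + η * N ^ 2 / 2) := by
      have h8 := div_le_div_of_nonneg_right h6 hη0.le
      -- The stepsize gives 1/(γη) = τ/(1-γ) and 1/η = γτ/(1-γ), so the coefficient of the
      -- divergence also contracts by γ.
      have e1 : (η * (X s - advantage M h τ πs π s + ∑ a, δ s a * (v s a - πs s a))
          + 1 / M.γ * klDist (πs s) (v' s)) / η
          = X s - advantage M h τ πs π s + (∑ a, δ s a * (v s a - πs s a))
            + τ / (1 - M.γ) * klDist (πs s) (v' s) := by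
        rw [add_div, mul_div_cancel_left₀ _ hη0.ne', hη]
        field_simp
      have e2 : (klDist (πs s) (v s) + e + η ^ 2 * N ^ 2 / 2) / η
          = M.γ * (τ / (1 - M.γ)) * klDist (πs s) (v s) + (e / η + η * N ^ 2 / 2) := by
        have : klDist (πs s) (v s) / η = M.γ * (τ / (1 - M.γ)) * klDist (πs s) (v s) := by
          rw [hη]
          field_simp
        rw [← this]
        field_simp
        ring
      rw [e1, e2] at h8
      exact h8
    linarith
  have havg := Finset.sum_le_sum fun s (_ : s ∈ Finset.univ) =>
    mul_le_mul_of_nonneg_left (hmain s) (hν.1.1 s)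
  have hlin1 : ∀ (f g d D : S → ℝ) (k : ℝ), ∑ s, ν s * (f s - g s + d s + k * D s)
      = ∑ s, ν s * f s - ∑ s, ν s * g s + ∑ s, ν s * d s + k * ∑ s, ν s * D s := by
    intro f g d D k
    rw [Finset.mul_sum, ← Finset.sum_sub_distrib, ← Finset.sum_add_distrib,
      ← Finset.sum_add_distrib]
    exact Finset.sum_congr rfl fun s _ => by ring
  have hlin2 : ∀ (D : S → ℝ) (k b : ℝ), ∑ s, ν s * (k * D s + b)
      = k * ∑ s, ν s * D s + b := by
    intro D k b
    simp only [mul_add, Finset.sum_add_distrib, ← Finset.sum_mul, hν.1.2, Finset.mul_sum,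
      one_mul, mul_left_comm]
  have hlin3 : ∀ f g : S → ℝ, ∑ s, ν s * (f s - g s) = ∑ s, ν s * f s - ∑ s, ν s * g s := by
    intro f g
    simp only [mul_sub, Finset.sum_sub_distrib]
  -- Here the averaged advantage of π* becomes (1-γ) times the value difference; together with U
  -- this leaves the new gap minus γ times the old one.
  rw [hlin1 U (advantage M h τ πs π) (fun s => ∑ a, δ s a * (v s a - πs s a))
    (fun s => klDist (πs s) (v' s)), hlin2 (fun s => klDist (πs s) (v s)),
    ← sum_stationary_eq_of_fixedPoint M hν
    (fun s => perturbedValue_sub_eq M h τ hπs hπ s), hlin3, hlin3] at havg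
  have e3 : e / η + η * N ^ 2 / 2 + M.γ * ((ζ + η * N ^ 2 / 2) / (1 - M.γ))
      = e / η + η / (2 * (1 - M.γ)) * N ^ 2 + M.γ / (1 - M.γ) * ζ := by
    field_simp
    ring
  have e4 : (∑ s, ν s * ∑ a, (G s a - Qval M h τ π s a) * (v s a - πs s a))
      = ∑ s, ν s * ∑ a, δ s a * (v s a - πs s a) := rfl
  rw [e3] at havg
  rw [lyapunov, lyapunov, hlin3, hlin3, e4]
  linarith

end PolicyStep

/-! ### Parameters of the method and pathwise properties of its iterates. -/

section SapmdParameters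

variable {γ : ℝ} {n : ℕ} (hγ : 0 < γ) (hn : 2 ≤ n)
include hγ hn

theorem sapmdTau_pos (k : ℕ) : 0 < sapmdTau γ n k := by
  have : 0 < Real.log n := Real.log_pos (by exact_mod_cast hn)
  unfold sapmdTau
  positivity

theorem sapmdEta_pos (hγ1 : γ < 1) (k : ℕ) : 0 < sapmdEta γ n k :=
  div_pos (sub_pos.2 hγ1) (mul_pos hγ (sapmdTau_pos hγ hn k))

theorem sapmdEta_mul_sapmdTau (k : ℕ) : sapmdEta γ n k * sapmdTau γ n k = (1 - γ) / γ := by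
  have := sapmdTau_pos hγ hn k
  unfold sapmdEta
  field_simp

theorem sapmdMu_eq (k : ℕ) : sapmdMu γ n k = 1 / γ := by
  rw [sapmdMu, sapmdEta_mul_sapmdTau hγ hn]
  field_simp
  ring

end SapmdParameters

theorem sapmdAccuracy_pos {γ : ℝ} (hγ : 0 < γ) (hγ1 : γ < 1) : 0 < sapmdAccuracy γ := by
  have := sub_pos.2 hγ1
  unfold sapmdAccuracy
  positivity

section SapmdRun

variable {S A : Type*} [Fintype A] {h : S → (A → ℝ) → ℝ}
  {dh : S → (A → ℝ) → (A → ℝ)} {L γ : ℝ} {T : ℕ → ℕ} {G : ℕ → S → A → ℝ}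

/-- The accelerated gradient iterates in the `k`-th step. -/
noncomputable def sapmdInner (γ : ℝ) (dh : S → (A → ℝ) → (A → ℝ)) (L : ℝ)
    (T : ℕ → ℕ) (G : ℕ → S → A → ℝ) (k t : ℕ) : AGDState S A :=
  agdRun dh (sapmdEta γ (Fintype.card A) k) (sapmdTau γ (Fintype.card A) k) (G k)
    (sapmdRun γ dh L T G k).center (sapmdSmooth γ (Fintype.card A) L k)
    (sapmdMu γ (Fintype.card A) k) t

variable (hA : 2 ≤ Fintype.card A) (hγ : 0 < γ) (hγ1 : γ < 1) (hL : 0 < L)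
include hA hγ hγ1 hL

theorem sapmdInner_interior_of_center {k : ℕ}
    (hv : ∀ s a, 0 < (sapmdRun γ dh L T G k).center s a) (t : ℕ) :
    (sapmdInner γ dh L T G k t).Interior := by
  have : Nonempty A := Fintype.card_pos_iff.1 (by omega)
  have hη := sapmdEta_pos hγ hA hγ1 k
  have hτ := sapmdTau_pos hγ hA k
  refine agdRun_interior (by positivity) (by unfold sapmdMu; positivity) ?_ hv t
  unfold sapmdSmooth
  linarith [mul_pos hη hL]

theorem sapmdRun_interior (k : ℕ) : IsPolicy (sapmdRun γ dh L T G k).pol ∧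
    IsPolicy (sapmdRun γ dh L T G k).center ∧ ∀ s a, 0 < (sapmdRun γ dh L T G k).center s a := by
  have : Nonempty A := Fintype.card_pos_iff.1 (by omega)
  induction k with
  | zero => exact ⟨fun _ => uniformDist_mem, fun _ => uniformDist_mem, fun _ => uniformDist_pos⟩
  | succ k ih =>
    have := sapmdInner_interior_of_center (dh := dh) (T := T) hA hγ hγ1 hL ih.2.2 (T k)
    exact ⟨this.y_mem, this.x_mem, this.x_pos⟩

theorem sapmdInner_interior (k t : ℕ) : (sapmdInner γ dh L T G k t).Interior :=
  sapmdInner_interior_of_center hA hγ hγ1 hL (sapmdRun_interior hA hγ hγ1 hL k).2.2 t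

/-- The subproblems are solved to the prescribed accuracy. -/
theorem sapmdRun_subproblem (hreg : IsSmoothConvexRegularizer h dh L) {k : ℕ} (hT : 1 ≤ T k)
    (hTacc : agdAccuracy (sapmdSmooth γ (Fintype.card A) L k)
      (sapmdMu γ (Fintype.card A) k) (T k) ≤ sapmdAccuracy γ) (s : S) {p : A → ℝ}
    (hp : p ∈ stdSimplex ℝ A) :
    (subObjective h (sapmdEta γ (Fintype.card A) k) (sapmdTau γ (Fintype.card A) k) (G k)
          (sapmdRun γ dh L T G k).center s ((sapmdRun γ dh L T G (k + 1)).pol s)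
        - subObjective h (sapmdEta γ (Fintype.card A) k) (sapmdTau γ (Fintype.card A) k) (G k)
          (sapmdRun γ dh L T G k).center s p)
      + 1 / γ * klDist p ((sapmdRun γ dh L T G (k + 1)).center s)
      ≤ sapmdAccuracy γ * Real.log (Fintype.card A) := by
  have : Nonempty A := Fintype.card_pos_iff.1 (by omega)
  have hη := sapmdEta_pos hγ hA hγ1 k
  have hτ := sapmdTau_pos hγ hA k
  have h1 := agdRun_convergence hreg hL hη hτ.le (l := sapmdSmooth γ (Fintype.card A) L k)
    (μ := sapmdMu γ (Fintype.card A) k) rfl rfl (G := G k)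
    (sapmdRun_interior (dh := dh) (T := T) (G := G) hA hγ hγ1 hL k).2.2 s hp (T k) hT
  have h2 := mul_le_mul_of_nonneg_right hTacc (klDist_uniformDist_nonneg hp)
  have h3 := mul_le_mul_of_nonneg_left (klDist_uniformDist_le hp) (sapmdAccuracy_pos hγ hγ1).le
  rw [← sapmdMu_eq hγ hA k]
  exact h1.trans (h2.trans h3)

/-- The policy stays close to the prox-center. -/
theorem sapmdRun_klDist_center_le (hreg : IsSmoothConvexRegularizer h dh L) (hT : ∀ k, 1 ≤ T k)
    (hTacc : ∀ k, agdAccuracy (sapmdSmooth γ (Fintype.card A) L k)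
      (sapmdMu γ (Fintype.card A) k) (T k) ≤ sapmdAccuracy γ) (k : ℕ) (s : S) :
    klDist ((sapmdRun γ dh L T G k).pol s) ((sapmdRun γ dh L T G k).center s)
      ≤ γ * (sapmdAccuracy γ * Real.log (Fintype.card A)) := by
  have : Nonempty A := Fintype.card_pos_iff.1 (by omega)
  cases k with
  | zero =>
    have : klDist ((sapmdRun γ dh L T G 0).pol s) ((sapmdRun γ dh L T G 0).center s) = 0 :=
      klDist_self uniformDist_pos
    rw [this]
    have := sapmdAccuracy_pos hγ hγ1
    have : 0 ≤ Real.log (Fintype.card A) := Real.log_natCast_nonneg _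
    positivity
  | succ k =>
    -- With the new policy itself as comparison point the objective gap vanishes and only the
    -- divergence is left.
    have h1 := sapmdRun_subproblem (G := G) hA hγ hγ1 hL hreg (hT k) (hTacc k) s
      ((sapmdRun_interior (dh := dh) (T := T) (G := G) hA hγ hγ1 hL (k + 1)).1 s)
    rw [sub_self, zero_add, one_div, inv_mul_le_iff₀ hγ] at h1
    exact h1

/-- By Pinsker the squared distance is at most (1-γ)² log n / (γ(1+γ)); the factor 1+γ is dropped.
The factor 1-γ in the bound later cancels a 1/(1-γ) from the maximum principle. -/
theorem sapmdRun_dist_center_le (hreg : IsSmoothConvexRegularizer h dh L) (hT : ∀ k, 1 ≤ T k)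
    (hTacc : ∀ k, agdAccuracy (sapmdSmooth γ (Fintype.card A) L k)
      (sapmdMu γ (Fintype.card A) k) (T k) ≤ sapmdAccuracy γ) (k : ℕ) (s : S) :
    ∑ a, |(sapmdRun γ dh L T G k).pol s a - (sapmdRun γ dh L T G k).center s a|
      ≤ (1 - γ) * (Real.sqrt (Real.log (Fintype.card A)) / Real.sqrt γ) := by
  have h1 := sapmdRun_klDist_center_le (G := G) hA hγ hγ1 hL hreg hT hTacc k s
  have hi := sapmdRun_interior (dh := dh) (T := T) (G := G) hA hγ hγ1 hL k
  have h2 := sq_sum_abs_sub_le_two_mul_klDist (hi.1 s) (hi.2.1 s) (hi.2.2 s)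
  have hγ1' := sub_pos.2 hγ1
  have hlog : 0 ≤ Real.log (Fintype.card A) := Real.log_natCast_nonneg _
  refine abs_le_of_sq_le_sq' (b := (1 - γ) * (Real.sqrt (Real.log (Fintype.card A))
    / Real.sqrt γ)) ?_ (by positivity) |>.2
  rw [mul_pow, div_pow, Real.sq_sqrt hlog, Real.sq_sqrt hγ.le]
  refine h2.trans ((mul_le_mul_of_nonneg_left h1 zero_le_two).trans ?_)
  rw [sapmdAccuracy]
  have e1 : 2 * (γ * ((1 - γ) ^ 2 / (2 * γ ^ 2 * (1 + γ)) * Real.log (Fintype.card A)))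
      = (1 - γ) ^ 2 * (Real.log (Fintype.card A) / γ) / (1 + γ) := by
    field_simp
  rw [e1]
  exact div_le_self (by positivity) (by linarith)

end SapmdRun

/-! ### The one-step inequality with the parameters inserted. -/

section OneStep

/-- The deterministic error scales like 2^(-i) in epoch i, while N² has the coefficient 2^i; with N²
of order 4^(-i) in expectation the two balance. -/
theorem step_constants {γ : ℝ} {n : ℕ} {k : ℕ} {N : ℝ} (hγ : 0 < γ) (hγ1 : γ < 1)
    (hlog : 0 < Real.log n) :
    sapmdAccuracy γ * Real.log n / sapmdEta γ n k + sapmdEta γ n k / (2 * (1 - γ)) * N ^ 2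
        + γ / (1 - γ) * ((1 + γ) * (sapmdAccuracy γ * Real.log n) / sapmdEta γ n k
          + (1 - γ) * (Real.sqrt (Real.log n) / Real.sqrt γ)
            * (N ^ 2 / (2 * ((1 / 2) ^ (k / epochLen γ) / 4)) + (1 / 2) ^ (k / epochLen γ) / 4 / 2))
      = (1 / 2) ^ (k / epochLen γ) * (Real.sqrt (Real.log n) / Real.sqrt γ
          * ((1 - γ) / (4 * γ * (1 + γ)) + 1 / 4 + γ / 8))
        + 2 ^ (k / epochLen γ) * (Real.sqrt (Real.log n) / Real.sqrt γ) * (1 + 2 * γ) * N ^ 2 := by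
  have hτ : sapmdTau γ n k
      = (1 / 2) ^ (k / epochLen γ) / (2 * (Real.sqrt γ * Real.sqrt (Real.log n))) := by
    rw [sapmdTau, Real.sqrt_mul hγ.le, pow_succ]
    field_simp
  have h2 : (2 : ℝ) ^ (k / epochLen γ) = 1 / (1 / 2) ^ (k / epochLen γ) := by
    rw [one_div, ← inv_pow]
    norm_num
  have hγ1' := sub_pos.2 hγ1
  have hu : (0 : ℝ) < (1 / 2) ^ (k / epochLen γ) := by positivity
  rw [sapmdEta, hτ, sapmdAccuracy, h2]
  generalize (1 / 2 : ℝ) ^ (k / epochLen γ) = u at hu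
  -- Writing log n and γ as squares turns the claim into an identity of rational functions.
  obtain ⟨s, hs, hs2⟩ : ∃ s, 0 < s ∧ Real.log n = s ^ 2 :=
    ⟨_, Real.sqrt_pos.2 hlog, (Real.sq_sqrt hlog.le).symm⟩
  obtain ⟨g, hg, rfl⟩ : ∃ g, 0 < g ∧ γ = g ^ 2 :=
    ⟨_, Real.sqrt_pos.2 hγ, (Real.sq_sqrt hγ.le).symm⟩
  rw [hs2, Real.sqrt_sq hs.le, Real.sqrt_sq hg.le]
  field_simp
  ring

variable {S A : Type*} [Fintype S] [Fintype A] {M : MDP S A} {h : S → (A → ℝ) → ℝ}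
  {dh : S → (A → ℝ) → (A → ℝ)} {L : ℝ} {πs : S → A → ℝ} {ν : S → ℝ} {T : ℕ → ℕ}

/-- One step of the method, for a fixed realization of the estimates. -/
theorem sapmdRun_lyapunov_step (hA : 2 ≤ Fintype.card A) (hL : 0 < L)
    (hreg : IsSmoothConvexRegularizer h dh L) (hπs : IsPolicy πs)
    (hν : IsStationaryDist M πs ν) (hT : ∀ k, 1 ≤ T k)
    (hTacc : ∀ k, agdAccuracy (sapmdSmooth M.γ (Fintype.card A) L k)
      (sapmdMu M.γ (Fintype.card A) k) (T k) ≤ sapmdAccuracy M.γ) (G : ℕ → S → A → ℝ) (k : ℕ) :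
    lyapunov M h ν πs (sapmdTau M.γ (Fintype.card A) k) (sapmdRun M.γ dh L T G (k + 1)).pol
        (sapmdRun M.γ dh L T G (k + 1)).center
      ≤ M.γ * lyapunov M h ν πs (sapmdTau M.γ (Fintype.card A) k) (sapmdRun M.γ dh L T G k).pol
        (sapmdRun M.γ dh L T G k).center
      + (1 / 2) ^ (k / epochLen M.γ) * (Real.sqrt (Real.log (Fintype.card A)) / Real.sqrt M.γ
          * ((1 - M.γ) / (4 * M.γ * (1 + M.γ)) + 1 / 4 + M.γ / 8))
      + 2 ^ (k / epochLen M.γ) * (Real.sqrt (Real.log (Fintype.card A)) / Real.sqrt M.γ)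
          * (1 + 2 * M.γ)
          * ‖G k - Qval M h (sapmdTau M.γ (Fintype.card A) k) (sapmdRun M.γ dh L T G k).pol‖ ^ 2
      - ∑ s, ν s * ∑ a, (G k s a - Qval M h (sapmdTau M.γ (Fintype.card A) k)
          (sapmdRun M.γ dh L T G k).pol s a)
          * ((sapmdRun M.γ dh L T G k).center s a - πs s a) := by
  have : Nonempty A := Fintype.card_pos_iff.1 (by omega)
  have hγ := M.γ_pos
  have hγ1 := M.γ_lt_one
  have hγ1' := sub_pos.2 hγ1
  have hi := sapmdRun_interior (dh := dh) (T := T) (G := G) hA hγ hγ1 hL k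
  have hi' := sapmdRun_interior (dh := dh) (T := T) (G := G) hA hγ hγ1 hL (k + 1)
  have hlog : 0 < Real.log (Fintype.card A) := Real.log_pos (by exact_mod_cast hA)
  have step := lyapunov_step M h hπs hν (sapmdTau_pos hγ hA k) (η := sapmdEta M.γ (Fintype.card A) k)
    rfl hi.1 hi.2.1 hi.2.2 hi'.1 hi'.2.1 hi'.2.2 (G := G k)
    (e := sapmdAccuracy M.γ * Real.log (Fintype.card A))
    (c := (1 - M.γ) * (Real.sqrt (Real.log (Fintype.card A)) / Real.sqrt M.γ))
    -- This is 2^(-(i+2)), the root of the variance bound, which balances the two terms of Young's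
    -- inequality.
    (σ := (1 / 2) ^ (k / epochLen M.γ) / 4) (by positivity)
    (fun s p hp => sapmdRun_subproblem hA hγ hγ1 hL hreg (hT k) (hTacc k) s hp)
    (sapmdRun_klDist_center_le hA hγ hγ1 hL hreg hT hTacc k)
    (sapmdRun_dist_center_le hA hγ hγ1 hL hreg hT hTacc k) (by positivity)
  rw [step_constants hγ hγ1 hlog] at step
  linarith

end OneStep

/-! ### Measurability of the iterates in the noise. -/

section Measurability

variable {S A : Type*} [Fintype A] {h : S → (A → ℝ) → ℝ}
  {dh : S → (A → ℝ) → (A → ℝ)} {L γ : ℝ} {T : ℕ → ℕ} {Ω : Type*} [MeasurableSpace Ω]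

theorem measurable_comp_stdSimplex {f : (A → ℝ) → ℝ} (hf : ContinuousOn f (stdSimplex ℝ A))
    {u : Ω → A → ℝ} (hu : ∀ a, Measurable fun ω => u ω a) (hm : ∀ ω, u ω ∈ stdSimplex ℝ A) :
    Measurable fun ω => f (u ω) :=
  (continuousOn_iff_continuous_domRestrict.1 hf).measurable.comp
    ((measurable_pi_lambda u hu).subtype_mk (h := hm))

theorem measurable_klDist {u v : Ω → A → ℝ} (hu : ∀ a, Measurable fun ω => u ω a)
    (hv : ∀ a, Measurable fun ω => v ω a) : Measurable fun ω => klDist (u ω) (v ω) := by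
  unfold klDist
  exact Finset.measurable_sum _ fun a _ => (hu a).mul (((hu a).div (hv a)).log)

theorem measurable_gibbs {c : Ω → A → ℝ} (hc : ∀ a, Measurable fun ω => c ω a) (β : ℝ) (a : A) :
    Measurable fun ω => gibbs β (c ω) a := by
  have h1 : ∀ a, Measurable fun ω => Real.exp (-(c ω a / β)) := fun a =>
    (((hc a).div_const β).neg).exp
  exact (h1 a).div (Finset.measurable_sum _ fun b _ => h1 b)

variable {G : ℕ → Ω → S → A → ℝ} (hA : 2 ≤ Fintype.card A) (hγ : 0 < γ) (hγ1 : γ < 1) (hL : 0 < L)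
include hA hγ hγ1 hL

/-- The argmin is defined by choice, so measurability rests on its explicit Gibbs form. The gradient
is known to be continuous only on the simplex, where all its arguments lie. -/
theorem measurable_sapmdInner (hreg : IsSmoothConvexRegularizer h dh L) {k : ℕ}
    (hG : ∀ s a, Measurable fun ω => G k ω s a)
    (hv : ∀ s a, Measurable fun ω => (sapmdRun γ dh L T (fun j => G j ω) k).center s a) (t : ℕ) :
    (∀ s a, Measurable fun ω => (sapmdInner γ dh L T (fun j => G j ω) k t).x s a) ∧
      ∀ s a, Measurable fun ω => (sapmdInner γ dh L T (fun j => G j ω) k t).y s a := by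
  have : Nonempty A := Fintype.card_pos_iff.1 (by omega)
  induction t with
  | zero => exact ⟨fun _ _ => measurable_const, fun _ _ => measurable_const⟩
  | succ t ih =>
    have hη := sapmdEta_pos hγ hA hγ1 k
    have hτ := sapmdTau_pos hγ hA k
    have hμ : 0 < sapmdMu γ (Fintype.card A) k := by
      unfold sapmdMu
      positivity
    have hl : sapmdMu γ (Fintype.card A) k < sapmdSmooth γ (Fintype.card A) L k := by
      unfold sapmdSmooth
      linarith [mul_pos hη hL]
    have hq := agdQ_mem hμ hl (t + 1) (Nat.le_add_left 1 t)
    have hr := agdR_pos hμ hl (t + 1) (Nat.le_add_left 1 t)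
    have hi := fun ω => sapmdInner_interior (dh := dh) (T := T) (G := fun j => G j ω)
      hA hγ hγ1 hL k t
    have hc := fun ω => (sapmdRun_interior (dh := dh) (T := T) (G := fun j => G j ω)
      hA hγ hγ1 hL k).2.2
    have hx : ∀ s a, Measurable fun ω =>
        (sapmdInner γ dh L T (fun j => G j ω) k (t + 1)).x s a := by
      intro s a
      have e := fun ω => agdStep_x_eq (dh := dh) (q := agdQ (sapmdSmooth γ (Fintype.card A) L k)
        (sapmdMu γ (Fintype.card A) k) (t + 1)) (ρ := agdRho (sapmdSmooth γ (Fintype.card A) L k)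
        (sapmdMu γ (Fintype.card A) k) (t + 1)) (mul_pos hη hτ).le hr (G := G k ω) (hc ω) (hi ω) s
      have e' := funext fun ω => congrFun (e ω) a
      refine (congrArg Measurable e').mpr ?_
      refine measurable_gibbs (fun b => ?_) _ a
      unfold proxEnergy
      refine ((Measurable.const_mul ?_ _).sub ((hv s b).log.const_mul _)).sub (ih.1 s b).log
      refine ((hG s b).add ?_).const_mul _
      exact measurable_comp_stdSimplex (hreg.continuousOn_gradient s b)
        (u := fun ω a => (1 - _) * (sapmdInner γ dh L T (fun j => G j ω) k t).y s a
          + _ * (sapmdInner γ dh L T (fun j => G j ω) k t).x s a)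
        (fun a => ((ih.2 s a).const_mul _).add ((ih.1 s a).const_mul _))
        (fun ω => convexComb_mem ((hi ω).x_mem s) ((hi ω).y_mem s) hq.1 hq.2)
    exact ⟨hx, fun s a => ((ih.2 s a).const_mul _).add ((hx s a).const_mul _)⟩

theorem measurable_sapmdRun (hreg : IsSmoothConvexRegularizer h dh L) (k : ℕ)
    (hG : ∀ j < k, ∀ s a, Measurable fun ω => G j ω s a) :
    (∀ s a, Measurable fun ω => (sapmdRun γ dh L T (fun j => G j ω) k).pol s a) ∧
      ∀ s a, Measurable fun ω => (sapmdRun γ dh L T (fun j => G j ω) k).center s a := by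
  induction k with
  | zero => exact ⟨fun _ _ => measurable_const, fun _ _ => measurable_const⟩
  | succ k ih =>
    have ih' := ih fun j hj => hG j (hj.trans k.lt_succ_self)
    have := measurable_sapmdInner hA hγ hγ1 hL hreg (hG k k.lt_succ_self) ih'.2 (T k)
    exact ⟨this.2, this.1⟩

end Measurability

/-! ### Measurability and uniform bounds for the value functions. -/

section ValueBounds

variable {S A : Type*} [Fintype S] [Fintype A] (M : MDP S A) {h : S → (A → ℝ) → ℝ}
  {dh : S → (A → ℝ) → (A → ℝ)} {L : ℝ} {Ω : Type*} [MeasurableSpace Ω]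

theorem measurable_stateActionLaw {π m : Ω → S → A → ℝ}
    (hπ : ∀ s a, Measurable fun ω => π ω s a) (hm : ∀ s a, Measurable fun ω => m ω s a) (t : ℕ)
    (s : S) (a : A) : Measurable fun ω => stateActionLaw M (π ω) (m ω) t s a := by
  induction t generalizing s a with
  | zero => exact hm s a
  | succ t ih =>
    exact (Finset.measurable_sum _ fun s' _ => Finset.measurable_sum _ fun a' _ =>
      (ih s' a').mul_const _).mul (hπ s a)

theorem measurable_discountedCost (hreg : IsSmoothConvexRegularizer h dh L) (τ : ℝ)
    {π m : Ω → S → A → ℝ} (hp : ∀ ω, IsPolicy (π ω))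
    (hπ : ∀ s a, Measurable fun ω => π ω s a) (hm : ∀ s a, Measurable fun ω => m ω s a) :
    Measurable fun ω => discountedCost M h τ (π ω) (m ω) := by
  refine measurable_of_tendsto_metrizable (f := fun N ω => ∑ t ∈ Finset.range N,
    M.γ ^ t * ∑ s, ∑ a, stateActionLaw M (π ω) (m ω) t s a *
      (M.c s a + h s (π ω s) + τ * klDist (π ω s) (uniformDist A))) (fun N => ?_)
    (tendsto_pi_nhds.2 fun ω => (summable_discountedCost M h τ (hp ω) (m ω)).hasSum.tendsto_sum_nat)
  refine Finset.measurable_sum _ fun t _ => Measurable.const_mul ?_ _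
  refine Finset.measurable_sum _ fun s _ => Finset.measurable_sum _ fun a _ => ?_
  refine (measurable_stateActionLaw M hπ hm t s a).mul ((measurable_const.add ?_).add
    ((measurable_klDist (hπ s) fun _ => measurable_const).const_mul _))
  exact measurable_comp_stdSimplex (hreg.continuousOn s) (hπ s) fun ω => hp ω s

theorem measurable_Qval (hreg : IsSmoothConvexRegularizer h dh L) (τ : ℝ)
    {π : Ω → S → A → ℝ} (hp : ∀ ω, IsPolicy (π ω))
    (hπ : ∀ s a, Measurable fun ω => π ω s a) (s : S) (a : A) :
    Measurable fun ω => Qval M h τ (π ω) s a :=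
  measurable_discountedCost M hreg τ hp hπ fun _ _ => measurable_const

theorem measurable_perturbedValue (hreg : IsSmoothConvexRegularizer h dh L) (τ : ℝ)
    {π : Ω → S → A → ℝ} (hp : ∀ ω, IsPolicy (π ω))
    (hπ : ∀ s a, Measurable fun ω => π ω s a) (s : S) :
    Measurable fun ω => perturbedValue M h τ (π ω) s := by
  simp only [perturbedValue_eq M h τ (hp _)]
  exact Finset.measurable_sum _ fun a _ => (hπ s a).mul (measurable_Qval M hreg τ hp hπ s a)

theorem IsSmoothConvexRegularizer.exists_bound (hreg : IsSmoothConvexRegularizer h dh L) :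
    ∃ C, 0 ≤ C ∧ ∀ s, ∀ p ∈ stdSimplex ℝ A, |h s p| ≤ C := by
  have h1 := fun s => (isCompact_stdSimplex ℝ A).exists_bound_of_continuousOn (hreg.continuousOn s)
  choose C hC using h1
  refine ⟨∑ s, |C s|, Finset.sum_nonneg fun _ _ => abs_nonneg _, fun s p hp => ?_⟩
  exact (hC s p hp).trans ((le_abs_self _).trans
    (Finset.single_le_sum (f := fun s => |C s|) (fun _ _ => abs_nonneg _) (Finset.mem_univ s)))

variable [Nonempty A]

theorem exists_stageCost_bound (hreg : IsSmoothConvexRegularizer h dh L) (τ : ℝ) :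
    ∃ R, 0 ≤ R ∧ ∀ π, IsPolicy π → ∀ s a, |stageCost M h τ π s a| ≤ R := by
  obtain ⟨C, hC0, hC⟩ := hreg.exists_bound
  have hc0 : 0 ≤ ∑ s, ∑ a, |M.c s a| :=
    Finset.sum_nonneg fun _ _ => Finset.sum_nonneg fun _ _ => abs_nonneg _
  have hl0 := Real.log_natCast_nonneg (Fintype.card A)
  refine ⟨(∑ s, ∑ a, |M.c s a|) + C + |τ| * Real.log (Fintype.card A), by positivity,
    fun π hπ s a => ?_⟩
  have hc : |M.c s a| ≤ ∑ s, ∑ a, |M.c s a| :=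
    (Finset.single_le_sum (f := fun a => |M.c s a|) (fun _ _ => abs_nonneg _)
      (Finset.mem_univ a)).trans
    (Finset.single_le_sum (f := fun s => ∑ a, |M.c s a|)
      (fun _ _ => Finset.sum_nonneg fun _ _ => abs_nonneg _) (Finset.mem_univ s))
  have hk : |τ * klDist (π s) (uniformDist A)| ≤ |τ| * Real.log (Fintype.card A) := by
    rw [abs_mul, abs_of_nonneg (klDist_uniformDist_nonneg (hπ s))]
    exact mul_le_mul_of_nonneg_left (klDist_uniformDist_le (hπ s)) (abs_nonneg _)
  exact (abs_add_le _ _).trans (add_le_add ((abs_add_le _ _).trans (add_le_add hc (hC s _ (hπ s)))) hk)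

/-- The bound is uniform over policies, as h is bounded on the compact simplex and the entropy by
log n. It makes the values integrable along the random run. -/
theorem exists_value_bound (hreg : IsSmoothConvexRegularizer h dh L) (τ : ℝ) :
    ∃ C, 0 ≤ C ∧ ∀ π, IsPolicy π →
      (∀ s, |perturbedValue M h τ π s| ≤ C) ∧ ∀ s a, |Qval M h τ π s a| ≤ C := by
  obtain ⟨R, hR0, hR⟩ := exists_stageCost_bound M hreg τ
  have hγ1 := sub_pos.2 M.γ_lt_one
  have hγ := M.γ_pos
  have hV : ∀ π, IsPolicy π → ∀ s, |perturbedValue M h τ π s| ≤ R / (1 - M.γ) := by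
    intro π hπ s
    have hr : ∀ s, |∑ a, π s a * stageCost M h τ π s a| ≤ R := by
      intro s
      refine (Finset.abs_sum_le_sum_abs _ _).trans ?_
      calc ∑ a, |π s a * stageCost M h τ π s a| ≤ ∑ a, π s a * R := by
            refine Finset.sum_le_sum fun a _ => ?_
            rw [abs_mul, abs_of_nonneg ((hπ s).1 a)]
            exact mul_le_mul_of_nonneg_left (hR π hπ s a) ((hπ s).1 a)
        _ = R := by rw [← Finset.sum_mul, (hπ s).2, one_mul]
    rw [abs_le]
    constructor
    · have := le_of_le_add_stateTransition M hπ (U := fun s => -perturbedValue M h τ π s) (C := R)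
        (fun s => by
          rw [stateTransition_neg]
          have := perturbedValue_bellman M h τ hπ s
          have := (abs_le.1 (hr s)).1
          linarith) s
      linarith
    · refine le_of_le_add_stateTransition M hπ (fun s => ?_) s
      have := perturbedValue_bellman M h τ hπ s
      have := (abs_le.1 (hr s)).2
      linarith
  refine ⟨R + R / (1 - M.γ), by positivity, fun π hπ => ⟨fun s => (hV π hπ s).trans (by linarith),
    fun s a => ?_⟩⟩
  rw [Qval_eq M h τ hπ]
  refine (abs_add_le _ _).trans (add_le_add (hR π hπ s a) ?_)
  have hs : |∑ s', M.P s a s' * perturbedValue M h τ π s'| ≤ R / (1 - M.γ) := by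
    refine (Finset.abs_sum_le_sum_abs _ _).trans ?_
    calc ∑ s', |M.P s a s' * perturbedValue M h τ π s'| ≤ ∑ s', M.P s a s' * (R / (1 - M.γ)) := by
          refine Finset.sum_le_sum fun s' _ => ?_
          rw [abs_mul, abs_of_nonneg (M.P_nonneg s a s')]
          exact mul_le_mul_of_nonneg_left (hV π hπ s') (M.P_nonneg s a s')
      _ = R / (1 - M.γ) := by rw [← Finset.sum_mul, M.P_sum, one_mul]
  rw [abs_mul, abs_of_pos hγ]
  exact (mul_le_of_le_one_left (abs_nonneg _) M.γ_lt_one.le).trans hs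

end ValueBounds

/-- Pulling the known factor y out of the conditional expectation. With y a coordinate of v_k - π*,
the noise reduces to its conditional bias. -/
theorem integral_sub_mul_eq_condExp {Ω : Type*} {m mΩ : MeasurableSpace Ω}
    {μ : MeasureTheory.Measure Ω} [MeasureTheory.IsProbabilityMeasure μ]
    (hm : m ≤ mΩ) {g q y : Ω → ℝ} {C D : ℝ} (hg : MeasureTheory.Integrable g μ)
    (hq : Measurable q) (hqC : ∀ ω, |q ω| ≤ C) (hy : Measurable[m] y) (hyD : ∀ ω, |y ω| ≤ D) :
    MeasureTheory.Integrable (fun ω => (g ω - q ω) * y ω) μ ∧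
      MeasureTheory.Integrable (fun ω => ((μ[g|m]) ω - q ω) * y ω) μ ∧
      ∫ ω, (g ω - q ω) * y ω ∂μ = ∫ ω, ((μ[g|m]) ω - q ω) * y ω ∂μ := by
  have hym : Measurable y := hy.mono hm le_rfl
  have hyb : ∀ᵐ ω ∂μ, ‖y ω‖ ≤ D := Filter.Eventually.of_forall hyD
  have hqi : MeasureTheory.Integrable q μ :=
    MeasureTheory.Integrable.of_bound hq.aestronglyMeasurable C (Filter.Eventually.of_forall hqC)
  have hgy : MeasureTheory.Integrable (fun ω => g ω * y ω) μ :=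
    hg.mul_bdd hym.aestronglyMeasurable hyb
  have hqy : MeasureTheory.Integrable (fun ω => q ω * y ω) μ :=
    hqi.mul_bdd hym.aestronglyMeasurable hyb
  have hcy : MeasureTheory.Integrable (fun ω => (μ[g|m]) ω * y ω) μ :=
    MeasureTheory.integrable_condExp.mul_bdd hym.aestronglyMeasurable hyb
  have h1 := MeasureTheory.condExp_mul_of_stronglyMeasurable_right (μ := μ) (f := g) (g := y)
    hy.stronglyMeasurable hgy hg
  have h2 : ∫ ω, g ω * y ω ∂μ = ∫ ω, (μ[g|m]) ω * y ω ∂μ := by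
    rw [← MeasureTheory.integral_condExp hm]
    exact MeasureTheory.integral_congr_ae h1
  simp only [sub_mul]
  refine ⟨hgy.sub hqy, hcy.sub hqy, ?_⟩
  rw [MeasureTheory.integral_sub hgy hqy, MeasureTheory.integral_sub hcy hqy, h2]

theorem integral_le_of_le_affine {Ω : Type*} [MeasurableSpace Ω]
    {μ : MeasureTheory.Measure Ω} [MeasureTheory.IsProbabilityMeasure μ] {V W X Y : Ω → ℝ}
    {a b c : ℝ} (hV : MeasureTheory.Integrable V μ) (hW : MeasureTheory.Integrable W μ)
    (hX : MeasureTheory.Integrable X μ) (hY : MeasureTheory.Integrable Y μ)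
    (h : ∀ ω, V ω ≤ a * W ω + b + c * X ω - Y ω) :
    ∫ ω, V ω ∂μ ≤ a * (∫ ω, W ω ∂μ) + b + c * (∫ ω, X ω ∂μ) - ∫ ω, Y ω ∂μ := by
  have h1 : MeasureTheory.Integrable (fun ω => a * W ω + b) μ :=
    (hW.const_mul a).add (MeasureTheory.integrable_const b)
  have h2 : MeasureTheory.Integrable (fun ω => a * W ω + b + c * X ω) μ := h1.add (hX.const_mul c)
  refine (MeasureTheory.integral_mono hV (h2.sub hY) h).trans (le_of_eq ?_)
  rw [MeasureTheory.integral_sub' h2 hY, MeasureTheory.integral_add h1 (hX.const_mul c),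
    MeasureTheory.integral_add (hW.const_mul a) (MeasureTheory.integrable_const b),
    MeasureTheory.integral_const_mul, MeasureTheory.integral_const_mul]
  simp

/-! ### Adaptedness, integrability, and the one-step inequality in expectation. -/

section Expectation

variable {S A : Type*} [Fintype S] [Fintype A] {M : MDP S A} {h : S → (A → ℝ) → ℝ}
  {dh : S → (A → ℝ) → (A → ℝ)} {L : ℝ} {πs : S → A → ℝ} {ν : S → ℝ} {T : ℕ → ℕ}
  {Ω : Type*} {mΩ : MeasurableSpace Ω} {ℙ : MeasureTheory.Measure Ω}
  [MeasureTheory.IsProbabilityMeasure ℙ] {ℱ : MeasureTheory.Filtration ℕ mΩ}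
  {G : ℕ → Ω → S → A → ℝ}
  (hA : 2 ≤ Fintype.card A) (hL : 0 < L) (hreg : IsSmoothConvexRegularizer h dh L)
  (hGmeas : ∀ k s a, Measurable[ℱ (k + 1)] fun ω => G k ω s a)

section Adapted

include hA hL hreg hGmeas

/-- Step k depends on the estimates with index below k only, so the pathwise measurability result
applies with ℱ k as the underlying σ-algebra. -/
theorem adapted_sapmdRun (k : ℕ) :
    (∀ s a, Measurable[ℱ k] fun ω => (sapmdRun M.γ dh L T (fun j => G j ω) k).pol s a) ∧
      ∀ s a, Measurable[ℱ k] fun ω => (sapmdRun M.γ dh L T (fun j => G j ω) k).center s a :=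
  @measurable_sapmdRun S A _ h dh L M.γ T Ω (ℱ k) G hA M.γ_pos M.γ_lt_one hL hreg k
    fun j hj s a => (hGmeas j s a).mono (ℱ.mono hj) le_rfl

theorem integrable_perturbedValue (τ : ℝ) (k : ℕ) (s : S) : MeasureTheory.Integrable
    (fun ω => perturbedValue M h τ (sapmdRun M.γ dh L T (fun j => G j ω) k).pol s) ℙ := by
  have : Nonempty A := Fintype.card_pos_iff.1 (by omega)
  have hp := fun ω => (sapmdRun_interior (dh := dh) (T := T) (G := fun j => G j ω)
    hA M.γ_pos M.γ_lt_one hL k).1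
  have had := (adapted_sapmdRun (M := M) (T := T) hA hL hreg hGmeas k).1
  obtain ⟨C, -, hC⟩ := exists_value_bound M hreg τ
  exact MeasureTheory.Integrable.of_bound (measurable_perturbedValue M hreg τ hp
    (fun s a => (had s a).mono (ℱ.le k) le_rfl) s).aestronglyMeasurable C
    (Filter.Eventually.of_forall fun ω => (hC _ (hp ω)).1 s)

end Adapted

variable (hGL2 : ∀ k s a, MeasureTheory.MemLp (fun ω => G k ω s a) 2 ℙ)
  (hT : ∀ k, 1 ≤ T k)
  (hTacc : ∀ k, agdAccuracy (sapmdSmooth M.γ (Fintype.card A) L k)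
    (sapmdMu M.γ (Fintype.card A) k) (T k) ≤ sapmdAccuracy M.γ)

include hA hL hreg hGmeas hGL2

theorem memLp_estimation_error (τ : ℝ) (k : ℕ) : MeasureTheory.MemLp (fun ω => G k ω -
    Qval M h τ (sapmdRun M.γ dh L T (fun j => G j ω) k).pol) 2 ℙ := by
  have : Nonempty A := Fintype.card_pos_iff.1 (by omega)
  have hp := fun ω => (sapmdRun_interior (dh := dh) (T := T) (G := fun j => G j ω)
    hA M.γ_pos M.γ_lt_one hL k).1
  have had := (adapted_sapmdRun (M := M) (T := T) hA hL hreg hGmeas k).1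
  obtain ⟨C, -, hC⟩ := exists_value_bound M hreg τ
  refine (MeasureTheory.MemLp.of_eval (μ := ℙ) fun s =>
    MeasureTheory.MemLp.of_eval (μ := ℙ) fun a => ?_)
  exact (hGL2 k s a).sub (MeasureTheory.MemLp.of_bound (μ := ℙ) (measurable_Qval M hreg τ hp
    (fun s a => (had s a).mono (ℱ.le k) le_rfl) s a).aestronglyMeasurable C
    (Filter.Eventually.of_forall fun ω => (hC _ (hp ω)).2 s a))

include hT hTacc

/-- No uniform bound is at hand here, since the estimates may be unbounded and the center may
approach the boundary of the simplex. Instead the subproblem inequality bounds the divergence from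
the new center by the divergence from the old one, plus an affine function of the absolute values of
the estimate. -/
theorem integrable_klDist_center {p : A → ℝ} (hp : p ∈ stdSimplex ℝ A) (k : ℕ) (s : S) :
    MeasureTheory.Integrable
      (fun ω => klDist p ((sapmdRun M.γ dh L T (fun j => G j ω) k).center s)) ℙ := by
  have : Nonempty A := Fintype.card_pos_iff.1 (by omega)
  have hγ := M.γ_pos
  have hi := fun k ω => sapmdRun_interior (dh := dh) (T := T) (G := fun j => G j ω)
    hA hγ M.γ_lt_one hL k
  induction k with
  | zero => exact MeasureTheory.integrable_const (μ := ℙ) (klDist p (uniformPolicy S A s))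
  | succ k ih =>
    obtain ⟨C, hC0, hC⟩ := hreg.exists_bound
    have hη := sapmdEta_pos hγ hA M.γ_lt_one k
    have hτ := sapmdTau_pos hγ hA k
    have hGi : ∀ a, MeasureTheory.Integrable (fun ω => |G k ω s a|) ℙ := fun a =>
      ((hGL2 k s a).integrable one_le_two).abs
    have hbd : MeasureTheory.Integrable (fun ω => M.γ * (sapmdAccuracy M.γ
        * Real.log (Fintype.card A) + sapmdEta M.γ (Fintype.card A) k * ((∑ a, |G k ω s a|) + 2 * C)
        + sapmdEta M.γ (Fintype.card A) k * sapmdTau M.γ (Fintype.card A) k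
          * Real.log (Fintype.card A)
        + klDist p ((sapmdRun M.γ dh L T (fun j => G j ω) k).center s))) ℙ := by
      refine MeasureTheory.Integrable.const_mul ?_ _
      refine ((MeasureTheory.Integrable.add (MeasureTheory.integrable_const _) ?_).add
        (MeasureTheory.integrable_const _)).add ih
      exact ((MeasureTheory.integrable_finsetSum _ fun a _ => hGi a).add
        (MeasureTheory.integrable_const _)).const_mul _
    refine hbd.mono' ?_ (Filter.Eventually.of_forall fun ω => ?_)
    · exact (measurable_klDist (u := fun _ => p)
        (v := fun ω => (sapmdRun M.γ dh L T (fun j => G j ω) (k + 1)).center s)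
        (fun _ => measurable_const) fun a =>
        ((adapted_sapmdRun (M := M) (T := T) hA hL hreg hGmeas (k + 1)).2 s a).mono
          (ℱ.le _) le_rfl).aestronglyMeasurable
    · have h1 := sapmdRun_subproblem (G := fun j => G j ω) hA hγ M.γ_lt_one hL hreg (hT k)
        (hTacc k) s hp
      have hπ' := (hi (k + 1) ω).1 s
      have h2 := klDist_nonneg hp ((hi (k + 1) ω).2.1 s) ((hi (k + 1) ω).2.2 s)
      have h3 := klDist_nonneg hπ' ((hi k ω).2.1 s) ((hi k ω).2.2 s)
      have h4 := klDist_uniformDist_nonneg hπ'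
      have h5 := klDist_uniformDist_le hp
      rw [Real.norm_eq_abs, abs_of_nonneg h2]
      have h6 := (abs_le.1 (hC s _ hp)).2
      have h7 := (abs_le.1 (hC s _ hπ')).1
      set π' := (sapmdRun M.γ dh L T (fun j => G j ω) (k + 1)).pol
      have h8 : (∑ a, G k ω s a * p a) - ∑ a, G k ω s a * π' s a ≤ ∑ a, |G k ω s a| := by
        rw [← Finset.sum_sub_distrib]
        refine Finset.sum_le_sum fun a _ => ?_
        have hle : ∀ q ∈ stdSimplex ℝ A, q a ≤ 1 := fun q hq => by
          rw [← hq.2]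
          exact Finset.single_le_sum (fun b _ => hq.1 b) (Finset.mem_univ a)
        have ha : |p a - π' s a| ≤ 1 := by
          rw [abs_le]
          constructor <;> linarith [hle p hp, hle _ hπ', hp.1 a, hπ'.1 a]
        rw [← mul_sub]
        refine (le_abs_self _).trans ?_
        rw [abs_mul]
        exact mul_le_of_le_one_right (abs_nonneg _) ha
      have h9 : 1 / M.γ * klDist p ((sapmdRun M.γ dh L T (fun j => G j ω) (k + 1)).center s)
          ≤ sapmdAccuracy M.γ
        * Real.log (Fintype.card A) + sapmdEta M.γ (Fintype.card A) k * ((∑ a, |G k ω s a|) + 2 * C)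
        + sapmdEta M.γ (Fintype.card A) k * sapmdTau M.γ (Fintype.card A) k
          * Real.log (Fintype.card A)
        + klDist p ((sapmdRun M.γ dh L T (fun j => G j ω) k).center s) := by
        simp only [subObjective] at h1
        have g1 := mul_le_mul_of_nonneg_left h8 hη.le
        have g2 := mul_le_mul_of_nonneg_left h6 hη.le
        have g3 := mul_le_mul_of_nonneg_left h7 hη.le
        have g4 := mul_le_mul_of_nonneg_left h5 (mul_pos hη hτ).le
        have g5 := mul_nonneg (mul_pos hη hτ).le h4
        linarith
      rwa [one_div, inv_mul_le_iff₀ hγ] at h9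

theorem integrable_lyapunov (hπs : IsPolicy πs) (τ : ℝ) (k : ℕ) : MeasureTheory.Integrable
    (fun ω => lyapunov M h ν πs τ (sapmdRun M.γ dh L T (fun j => G j ω) k).pol
      (sapmdRun M.γ dh L T (fun j => G j ω) k).center) ℙ := by
  unfold lyapunov
  refine MeasureTheory.Integrable.add ?_ (MeasureTheory.Integrable.const_mul ?_ _)
  · exact MeasureTheory.integrable_finsetSum _ fun s _ =>
      ((integrable_perturbedValue hA hL hreg hGmeas τ k s).sub
        (MeasureTheory.integrable_const _)).const_mul _
  · exact MeasureTheory.integrable_finsetSum _ fun s _ =>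
      (integrable_klDist_center hA hL hreg hGmeas hGL2 hT hTacc (hπs s) k s).const_mul _

/-- The expected decrease of the Lyapunov function in one step. -/
theorem integral_lyapunov_step (hπs : IsPolicy πs) (hν : IsStationaryDist M πs ν) (k : ℕ)
    (hbias : ∀ᵐ ω ∂ℙ, ∀ s a,
      |(ℙ[fun ω' => G k ω' s a|ℱ k]) ω
          - Qval M h (sapmdTau M.γ (Fintype.card A) k)
            (sapmdRun M.γ dh L T (fun j => G j ω) k).pol s a|
        ≤ (1 / 2 : ℝ) ^ (k / epochLen M.γ + 2))
    (hvar : ∀ᵐ ω ∂ℙ, (ℙ[fun ω' =>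
          ‖G k ω' - Qval M h (sapmdTau M.γ (Fintype.card A) k)
            (sapmdRun M.γ dh L T (fun j => G j ω') k).pol‖ ^ 2|ℱ k]) ω
        ≤ (1 / 4 : ℝ) ^ (k / epochLen M.γ + 2)) :
    ∫ ω, lyapunov M h ν πs (sapmdTau M.γ (Fintype.card A) k)
        (sapmdRun M.γ dh L T (fun j => G j ω) (k + 1)).pol
        (sapmdRun M.γ dh L T (fun j => G j ω) (k + 1)).center ∂ℙ
      ≤ M.γ * ∫ ω, lyapunov M h ν πs (sapmdTau M.γ (Fintype.card A) k)
        (sapmdRun M.γ dh L T (fun j => G j ω) k).pol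
        (sapmdRun M.γ dh L T (fun j => G j ω) k).center ∂ℙ
      + (1 / 2) ^ (k / epochLen M.γ) * (Real.sqrt (Real.log (Fintype.card A)) / Real.sqrt M.γ
          * ((1 - M.γ) / (4 * M.γ * (1 + M.γ)) + 5 / 16 + M.γ / 4) + 1 / 2) := by
  have : Nonempty A := Fintype.card_pos_iff.1 (by omega)
  have hγ := M.γ_pos
  set τ := sapmdTau M.γ (Fintype.card A) k
  set u : ℝ := (1 / 2) ^ (k / epochLen M.γ) with hu
  have hu0 : 0 < u := by positivity
  have hi := fun ω => sapmdRun_interior (dh := dh) (T := T) (G := fun j => G j ω)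
    hA hγ M.γ_lt_one hL k
  have had := adapted_sapmdRun (M := M) (T := T) hA hL hreg hGmeas k
  obtain ⟨C, -, hC⟩ := exists_value_bound M hreg τ
  have hN := (memLp_estimation_error (M := M) (T := T) hA hL hreg hGmeas hGL2 τ k).integrable_norm_pow
    two_ne_zero
  have hW := fun j => integrable_lyapunov (ν := ν) hA hL hreg hGmeas hGL2 hT hTacc hπs τ j
  -- the bias
  have hle1 : ∀ s a q, q ∈ stdSimplex ℝ A → |q a - πs s a| ≤ 1 := by
    intro s a q hq
    have hle : ∀ q ∈ stdSimplex ℝ A, q a ≤ 1 := fun q hq => by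
      rw [← hq.2]
      exact Finset.single_le_sum (fun b _ => hq.1 b) (Finset.mem_univ a)
    rw [abs_le]
    constructor <;> linarith [hle q hq, hle _ (hπs s), hq.1 a, (hπs s).1 a]
  have hcond := fun s a => integral_sub_mul_eq_condExp (μ := ℙ) (ℱ.le k)
    (g := fun ω => G k ω s a)
    (q := fun ω => Qval M h τ (sapmdRun M.γ dh L T (fun j => G j ω) k).pol s a)
    (y := fun ω => (sapmdRun M.γ dh L T (fun j => G j ω) k).center s a - πs s a)
    ((hGL2 k s a).integrable one_le_two)
    (measurable_Qval M hreg τ (fun ω => (hi ω).1)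
      (fun s a => (had.1 s a).mono (ℱ.le k) le_rfl) s a)
    (fun ω => (hC _ (hi ω).1).2 s a) ((had.2 s a).sub_const _)
    (fun ω => hle1 s a _ ((hi ω).2.1 s))
  have hB1 : MeasureTheory.Integrable (fun ω => ∑ s, ν s * ∑ a, (G k ω s a
      - Qval M h τ (sapmdRun M.γ dh L T (fun j => G j ω) k).pol s a)
      * ((sapmdRun M.γ dh L T (fun j => G j ω) k).center s a - πs s a)) ℙ :=
    MeasureTheory.integrable_finsetSum _ fun s _ => (MeasureTheory.integrable_finsetSum _
      fun a _ => (hcond s a).1).const_mul _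
  have hB2 : MeasureTheory.Integrable (fun ω => ∑ s, ν s * ∑ a, ((ℙ[fun ω' => G k ω' s a|ℱ k]) ω
      - Qval M h τ (sapmdRun M.γ dh L T (fun j => G j ω) k).pol s a)
      * ((sapmdRun M.γ dh L T (fun j => G j ω) k).center s a - πs s a)) ℙ :=
    MeasureTheory.integrable_finsetSum _ fun s _ => (MeasureTheory.integrable_finsetSum _
      fun a _ => (hcond s a).2.1).const_mul _
  have hBeq : ∫ ω, (∑ s, ν s * ∑ a, (G k ω s a
      - Qval M h τ (sapmdRun M.γ dh L T (fun j => G j ω) k).pol s a)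
      * ((sapmdRun M.γ dh L T (fun j => G j ω) k).center s a - πs s a)) ∂ℙ
      = ∫ ω, (∑ s, ν s * ∑ a, ((ℙ[fun ω' => G k ω' s a|ℱ k]) ω
      - Qval M h τ (sapmdRun M.γ dh L T (fun j => G j ω) k).pol s a)
      * ((sapmdRun M.γ dh L T (fun j => G j ω) k).center s a - πs s a)) ∂ℙ := by
    rw [MeasureTheory.integral_finsetSum _ fun s _ => (MeasureTheory.integrable_finsetSum _
        fun a _ => (hcond s a).1).const_mul _,
      MeasureTheory.integral_finsetSum _ fun s _ => (MeasureTheory.integrable_finsetSum _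
        fun a _ => (hcond s a).2.1).const_mul _]
    refine Finset.sum_congr rfl fun s _ => ?_
    rw [MeasureTheory.integral_const_mul, MeasureTheory.integral_const_mul,
      MeasureTheory.integral_finsetSum _ fun a _ => (hcond s a).1,
      MeasureTheory.integral_finsetSum _ fun a _ => (hcond s a).2.1]
    congr 1
    exact Finset.sum_congr rfl fun a _ => (hcond s a).2.2
  -- The bias is at most u/4 in each coordinate, and the ℓ₁ distance of two distributions is at most
  -- 2.
  have hBge : -(u / 2) ≤ ∫ ω, (∑ s, ν s * ∑ a, ((ℙ[fun ω' => G k ω' s a|ℱ k]) ω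
      - Qval M h τ (sapmdRun M.γ dh L T (fun j => G j ω) k).pol s a)
      * ((sapmdRun M.γ dh L T (fun j => G j ω) k).center s a - πs s a)) ∂ℙ := by
    have hc : ∫ _ω, -(u / 2) ∂ℙ = -(u / 2) := by simp
    rw [← hc]
    refine MeasureTheory.integral_mono_ae (MeasureTheory.integrable_const _) hB2 ?_
    filter_upwards [hbias] with ω hω
    have hs : ∀ s, -(u / 2) ≤ ∑ a, ((ℙ[fun ω' => G k ω' s a|ℱ k]) ω
        - Qval M h τ (sapmdRun M.γ dh L T (fun j => G j ω) k).pol s a)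
        * ((sapmdRun M.γ dh L T (fun j => G j ω) k).center s a - πs s a) := by
      intro s
      have hpow : (1 / 2 : ℝ) ^ (k / epochLen M.γ + 2) = u / 4 := by
        rw [pow_add, hu]
        ring
      calc -(u / 2) = ∑ a, -(u / 4 * ((sapmdRun M.γ dh L T (fun j => G j ω) k).center s a
            + πs s a)) := by
            rw [Finset.sum_neg_distrib, ← Finset.mul_sum, Finset.sum_add_distrib,
              ((hi ω).2.1 s).2, (hπs s).2]
            ring
        _ ≤ _ := by
            refine Finset.sum_le_sum fun a _ => ?_
            have h1 := hω s a
            rw [hpow] at h1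
            refine (neg_le_neg ?_).trans (neg_abs_le _)
            rw [abs_mul]
            refine mul_le_mul h1 ?_ (abs_nonneg _) (by positivity)
            have h2 := ((hi ω).2.1 s).1 a
            have h3 := (hπs s).1 a
            rw [abs_le]
            constructor <;> linarith
    calc -(u / 2) = ∑ s, ν s * -(u / 2) := by rw [← Finset.sum_mul, hν.1.2, one_mul]
      _ ≤ _ := Finset.sum_le_sum fun s _ => mul_le_mul_of_nonneg_left (hs s) (hν.1.1 s)
  -- the variance
  have hV : ∫ ω, ‖G k ω - Qval M h τ (sapmdRun M.γ dh L T (fun j => G j ω) k).pol‖ ^ 2 ∂ℙ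
      ≤ u ^ 2 / 16 := by
    rw [← MeasureTheory.integral_condExp (ℱ.le k)]
    have hpow : (1 / 4 : ℝ) ^ (k / epochLen M.γ + 2) = u ^ 2 / 16 := by
      rw [pow_add, hu, ← pow_mul, mul_comm _ 2, pow_mul]
      norm_num
      ring
    have hc : ∫ _ω, u ^ 2 / 16 ∂ℙ = u ^ 2 / 16 := by simp
    rw [← hc, ← hpow]
    exact MeasureTheory.integral_mono_ae MeasureTheory.integrable_condExp
      (MeasureTheory.integrable_const _) hvar
  have hstep := integral_le_of_le_affine (hW (k + 1)) (hW k) hN hB1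
    (fun ω => sapmdRun_lyapunov_step hA hL hreg hπs hν hT hTacc (fun j => G j ω) k)
  have hcoef : 0 ≤ 2 ^ (k / epochLen M.γ)
      * (Real.sqrt (Real.log (Fintype.card A)) / Real.sqrt M.γ) * (1 + 2 * M.γ) := by positivity
  have hV' := mul_le_mul_of_nonneg_left hV hcoef
  -- The coefficient 2^i = 1/u against the variance u²/16 leaves u/16.
  have h2 : (2 : ℝ) ^ (k / epochLen M.γ) * u = 1 := by
    rw [hu, ← mul_pow]
    norm_num
  have h3 : 2 ^ (k / epochLen M.γ) * (Real.sqrt (Real.log (Fintype.card A)) / Real.sqrt M.γ)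
      * (1 + 2 * M.γ) * (u ^ 2 / 16)
      = u * (Real.sqrt (Real.log (Fintype.card A)) / Real.sqrt M.γ * ((1 + 2 * M.γ) / 16)) := by
    linear_combination (Real.sqrt (Real.log (Fintype.card A)) / Real.sqrt M.γ
      * ((1 + 2 * M.γ) / 16) * u) * h2
  rw [h3] at hV'
  rw [hBeq] at hstep
  linarith

end Expectation

/-! ### The recursion over epochs. -/

section Epochs

theorem epochLen_pos {γ : ℝ} (hγ : 0 < γ) (hγ1 : γ < 1) : 0 < epochLen γ :=
  Nat.ceil_pos.2 (Real.logb_pos_of_base_lt_one hγ hγ1 (by norm_num) (by norm_num))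

theorem pow_epochLen_le {γ : ℝ} (hγ : 0 < γ) (hγ1 : γ < 1) : γ ^ epochLen γ ≤ 1 / 4 := by
  rw [← Real.rpow_natCast]
  calc γ ^ (epochLen γ : ℝ) ≤ γ ^ Real.logb γ (1 / 4) :=
        Real.rpow_le_rpow_of_exponent_ge hγ hγ1.le (Nat.le_ceil _)
    _ = 1 / 4 := Real.rpow_logb hγ hγ1.ne (by norm_num)

/-- A linear recursion whose perturbation is halved in every epoch of length `l`. -/
theorem epoch_recursion {γ F b C : ℝ} {l : ℕ} (hl : 0 < l) (hγ : 0 < γ) (hγ1 : γ < 1)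
    (hpow : γ ^ l ≤ 1 / 4) {w : ℕ → ℝ} (h0 : w 0 ≤ C) (hF : 0 ≤ F) (hb : 0 ≤ b)
    (hC : F + b / 2 ≤ C / 4)
    (hstep : ∀ k, w (k + 1) ≤ γ * w k + (1 / 2) ^ (k / l) * ((1 - γ) * F)
      + ((1 / 2) ^ (k / l) - (1 / 2) ^ ((k + 1) / l)) * b) (k : ℕ) :
    w k ≤ (1 / 2) ^ (k / l) * C := by
  -- In units of 2^(-i), the bound moves geometrically from C towards the equilibrium F within an
  -- epoch and restarts at C in the next one.
  have key : ∀ k, w k ≤ (1 / 2) ^ (k / l) * (γ ^ (k % l) * C + (1 - γ ^ (k % l)) * F) := by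
    intro k
    induction k with
    | zero => simpa using h0
    | succ k ih =>
      have hu : (0 : ℝ) < (1 / 2) ^ (k / l) := by positivity
      have hs := hstep k
      have ih' := mul_le_mul_of_nonneg_left ih hγ.le
      by_cases hj : k % l + 1 < l
      · have e1 : (k + 1) / l = k / l := by
          conv_lhs => rw [← Nat.div_add_mod k l, add_assoc, Nat.mul_add_div hl,
            Nat.div_eq_of_lt hj, add_zero]
        have e2 : (k + 1) % l = k % l + 1 := by
          have h1 := Nat.div_add_mod k l
          have h2 := Nat.div_add_mod (k + 1) l
          rw [e1] at h2
          omega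
        rw [e1, e2, pow_succ]
        rw [e1] at hs
        linarith
      · have e0 : k % l + 1 = l := by
          have := Nat.mod_lt k hl
          omega
        have h1 := Nat.div_add_mod k l
        have e3 : k + 1 = l * (k / l + 1) := by
          rw [mul_add, mul_one]
          omega
        have e1 : (k + 1) / l = k / l + 1 := by
          conv_lhs => rw [e3]
          exact Nat.mul_div_cancel_left _ hl
        have e2 : (k + 1) % l = 0 := by
          conv_lhs => rw [e3]
          exact Nat.mul_mod_right _ _
        have e4 : γ * γ ^ (k % l) = γ ^ l := by
          conv_rhs => rw [← e0]
          rw [pow_succ, mul_comm]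
        have hγl : 0 ≤ γ ^ l := by positivity
        have hC0 : 0 ≤ C := by linarith
        -- A quarter of C comes from γ^l ≤ 1/4, another from F + b/2 ≤ C/4. The b/2 is the drop from
        -- 2^(-i) to 2^(-(i+1)) at the end of the epoch.
        have h5 : γ ^ l * C + (1 - γ ^ l) * F + b / 2 ≤ C / 2 := by
          nlinarith [mul_le_mul_of_nonneg_right hpow hC0, mul_nonneg hγl hF]
        have h6 := mul_le_mul_of_nonneg_left h5 hu.le
        rw [e1, e2, pow_succ, pow_zero]
        rw [e1, pow_succ] at hs
        have h7 : γ * ((1 / 2) ^ (k / l) * (γ ^ (k % l) * C + (1 - γ ^ (k % l)) * F))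
            = (1 / 2) ^ (k / l) * (γ ^ l * C + (γ - γ ^ l) * F) := by
          rw [← e4]
          ring
        rw [h7] at ih'
        linarith
  refine (key k).trans (mul_le_mul_of_nonneg_left ?_ (by positivity))
  have h1 : 0 ≤ γ ^ (k % l) := by positivity
  have h2 : γ ^ (k % l) ≤ 1 := pow_le_one₀ hγ.le hγ1.le
  have h3 : F ≤ C := by nlinarith
  nlinarith

theorem sapmdTau_mul_log {γ : ℝ} {n : ℕ} (hγ : 0 < γ) (hn : 2 ≤ n) (k : ℕ) :
    sapmdTau γ n k * Real.log n
      = (1 / 2) ^ (k / epochLen γ) * (Real.sqrt (Real.log n) / Real.sqrt γ / 2) := by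
  have hlog : 0 < Real.log n := Real.log_pos (by exact_mod_cast hn)
  have hs := Real.sqrt_pos.2 hlog
  have hg := Real.sqrt_pos.2 hγ
  have h1 : Real.log n = Real.sqrt (Real.log n) ^ 2 := (Real.sq_sqrt hlog.le).symm
  rw [sapmdTau, Real.sqrt_mul hγ.le, pow_succ]
  nth_rewrite 2 [h1]
  field_simp

theorem sapmdTau_succ_le {γ : ℝ} {n : ℕ} (k : ℕ) : sapmdTau γ n (k + 1) ≤ sapmdTau γ n k := by
  unfold sapmdTau
  refine mul_le_mul_of_nonneg_left ?_ (by positivity)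
  exact pow_le_pow_of_le_one (by norm_num) (by norm_num)
    (Nat.add_le_add_right (Nat.div_le_div_right k.le_succ) 1)

end Epochs

/-! ### Changing the temperature, and comparison with the unperturbed objective. -/

section Comparison

variable {S A : Type*} [Fintype S] [Fintype A] {M : MDP S A} {h : S → (A → ℝ) → ℝ}
  {πs : S → A → ℝ} {ν : S → ℝ} {π v : S → A → ℝ}

theorem IsStationaryDist.sum_le (hν : IsStationaryDist M πs ν) {f g : S → ℝ} {C : ℝ}
    (hfg : ∀ s, f s ≤ g s + C) : ∑ s, ν s * f s ≤ ∑ s, ν s * g s + C := by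
  calc ∑ s, ν s * f s ≤ ∑ s, ν s * (g s + C) :=
        Finset.sum_le_sum fun s _ => mul_le_mul_of_nonneg_left (hfg s) (hν.1.1 s)
    _ = _ := by simp only [mul_add, Finset.sum_add_distrib, ← Finset.sum_mul, hν.1.2, one_mul]

theorem objective_sub_eq : objective M h ν π - objective M h ν πs
    = ∑ s, ν s * (perturbedValue M h 0 π s - perturbedValue M h 0 πs s) := by
  simp only [objective, Vval_eq_perturbedValue, mul_sub, Finset.sum_sub_distrib]

variable [Nonempty A]

/-- Lowering the temperature decreases the value of π and the weight of the divergence. The only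
loss is the decrease of the value of π*. -/
theorem lyapunov_change_perturbation (hπs : IsPolicy πs) (hν : IsStationaryDist M πs ν)
    (hπ : IsPolicy π) (hv : IsPolicy v) (hv0 : ∀ s a, 0 < v s a) {τ τ' : ℝ} (hτ : τ' ≤ τ) :
    lyapunov M h ν πs τ' π v
      ≤ lyapunov M h ν πs τ π v + (τ - τ') * Real.log (Fintype.card A) / (1 - M.γ) := by
  have hγ1 := sub_pos.2 M.γ_lt_one
  have h1 := hν.sum_le (f := fun s => perturbedValue M h τ' π s - perturbedValue M h τ' πs s)
    (g := fun s => perturbedValue M h τ π s - perturbedValue M h τ πs s)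
    (C := (τ - τ') * Real.log (Fintype.card A) / (1 - M.γ)) (fun s => by
      have := perturbedValue_mono_perturbation M h hπ hτ s
      have := perturbedValue_sub_perturbation_le M h hπs hτ s
      linarith)
  have h2 : 0 ≤ ∑ s, ν s * klDist (πs s) (v s) := Finset.sum_nonneg fun s _ =>
    mul_nonneg (hν.1.1 s) (klDist_nonneg (hπs s) (hv s) (hv0 s))
  have h3 := mul_le_mul_of_nonneg_right (div_le_div_of_nonneg_right hτ hγ1.le) h2
  unfold lyapunov
  linarith

/-- The perturbation of the value and the initial divergence each cost at most τ log n / (1-γ),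
whence the factor 2. -/
theorem lyapunov_uniform_le (hπs : IsPolicy πs) (hν : IsStationaryDist M πs ν) {τ : ℝ}
    (hτ : 0 ≤ τ) :
    lyapunov M h ν πs τ (uniformPolicy S A) (uniformPolicy S A)
      ≤ objective M h ν (uniformPolicy S A) - objective M h ν πs
        + 2 * (τ * Real.log (Fintype.card A)) / (1 - M.γ) := by
  have hγ1 := sub_pos.2 M.γ_lt_one
  have hu : IsPolicy (uniformPolicy S A) := fun _ => uniformDist_mem
  have h1 := hν.sum_le
    (f := fun s => perturbedValue M h τ (uniformPolicy S A) s - perturbedValue M h τ πs s)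
    (g := fun s => perturbedValue M h 0 (uniformPolicy S A) s - perturbedValue M h 0 πs s)
    (C := τ * Real.log (Fintype.card A) / (1 - M.γ)) (fun s => by
      have := perturbedValue_mono_perturbation M h hπs hτ s
      have h2 := perturbedValue_sub_perturbation_le M h hu hτ s
      rw [sub_zero] at h2
      linarith)
  have h2 := hν.sum_le (f := fun s => klDist (πs s) (uniformPolicy S A s)) (g := fun _ => 0)
    (C := Real.log (Fintype.card A)) (fun s => by
      rw [zero_add]
      exact klDist_uniformDist_le (hπs s))
  simp only [mul_zero, Finset.sum_const_zero, zero_add] at h2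
  have h3 := mul_le_mul_of_nonneg_left h2 (div_nonneg hτ hγ1.le)
  rw [objective_sub_eq, lyapunov]
  have e1 : τ / (1 - M.γ) * Real.log (Fintype.card A)
      = τ * Real.log (Fintype.card A) / (1 - M.γ) := by ring
  have e2 : 2 * (τ * Real.log (Fintype.card A)) / (1 - M.γ)
      = τ * Real.log (Fintype.card A) / (1 - M.γ) + τ * Real.log (Fintype.card A) / (1 - M.γ) := by
    ring
  linarith

/-- The case τ' = 0, where the Lyapunov function is the objective gap. -/
theorem objective_sub_le_lyapunov (hπs : IsPolicy πs) (hν : IsStationaryDist M πs ν)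
    (hπ : IsPolicy π) (hv : IsPolicy v) (hv0 : ∀ s a, 0 < v s a) {τ : ℝ} (hτ : 0 ≤ τ) :
    objective M h ν π - objective M h ν πs
      ≤ lyapunov M h ν πs τ π v + τ * Real.log (Fintype.card A) / (1 - M.γ) := by
  have := lyapunov_change_perturbation (h := h) hπs hν hπ hv hv0 hτ
  rw [objective_sub_eq]
  rw [sub_zero] at this
  simpa [lyapunov] using this

end Comparison

/-! ### The convergence rate in expectation. -/

section Rate

/-- The value to which the recursion is applied is dominated by the constant of the rate. -/
theorem rate_constant_le {γ x : ℝ} (hγ : 0 < γ) (hγ1 : γ < 1) (hx : 0 ≤ x) :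
    4 * (x * ((1 - γ) / (4 * γ * (1 + γ)) + 5 / 16 + γ / 4) + 1 / 2) + x + x / 2
      ≤ 3 * x + 5 * (2 - γ) / 2 + max 1 ((1 - γ) / γ) * (5 * x / 4) := by
  have key : (1 - γ) / (γ * (1 + γ)) + γ ≤ 1 / 4 + max 1 ((1 - γ) / γ) * (5 / 4) := by
    -- The maximum changes branch at γ = 1/2.
    rcases le_total γ (1 / 2) with h | h
    · have h1 : (1 - γ) / (γ * (1 + γ)) ≤ (1 - γ) / γ := by
        apply div_le_div_of_nonneg_left (by linarith) hγ
        nlinarith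
      have h2 : γ ≤ 1 / 4 + (1 - γ) / γ * (1 / 4) := by
        have : (1 - γ) / γ = 1 / γ - 1 := by field_simp
        have h3 : 2 ≤ 1 / γ := by
          rw [le_div_iff₀ hγ]
          linarith
        linarith
      have h4 := le_max_right 1 ((1 - γ) / γ)
      linarith
    · have h1 : (1 - γ) / (γ * (1 + γ)) ≤ 4 / 3 * (1 - γ) := by
        rw [div_le_iff₀ (by positivity)]
        nlinarith [mul_nonneg (sub_nonneg.2 hγ1.le) (sub_nonneg.2 h),
          mul_nonneg (mul_nonneg (sub_nonneg.2 hγ1.le) (sub_nonneg.2 h)) hγ.le]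
      have h4 := le_max_left 1 ((1 - γ) / γ)
      linarith
  have e1 : (1 - γ) / (4 * γ * (1 + γ)) = (1 - γ) / (γ * (1 + γ)) / 4 := by
    field_simp
  rw [e1]
  nlinarith [mul_le_mul_of_nonneg_left key hx]

variable {S A : Type*} [Fintype S] [Fintype A] {M : MDP S A} {h : S → (A → ℝ) → ℝ}
  {dh : S → (A → ℝ) → (A → ℝ)} {L : ℝ} {πs : S → A → ℝ} {ν : S → ℝ} {T : ℕ → ℕ}
  {Ω : Type*} {mΩ : MeasurableSpace Ω} {ℙ : MeasureTheory.Measure Ω}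
  [MeasureTheory.IsProbabilityMeasure ℙ] {ℱ : MeasureTheory.Filtration ℕ mΩ}
  {G : ℕ → Ω → S → A → ℝ}

theorem IsOptimalPolicy.objective_sub_nonneg (hπs : IsOptimalPolicy M h πs)
    (hν : IsStationaryDist M πs ν) {π : S → A → ℝ} (hπ : IsPolicy π) :
    0 ≤ objective M h ν π - objective M h ν πs := by
  rw [objective, objective, ← Finset.sum_sub_distrib]
  refine Finset.sum_nonneg fun s _ => ?_
  rw [← mul_sub]
  exact mul_nonneg (hν.1.1 s) (sub_nonneg.2 (hπs.2 π hπ s))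

/-- Convergence in expectation. -/
theorem sapmdRun_rate (hA : 2 ≤ Fintype.card A) (hL : 0 < L)
    (hreg : IsSmoothConvexRegularizer h dh L) (hπs : IsOptimalPolicy M h πs)
    (hν : IsStationaryDist M πs ν) (hT : ∀ k, 1 ≤ T k)
    (hTacc : ∀ k, agdAccuracy (sapmdSmooth M.γ (Fintype.card A) L k)
      (sapmdMu M.γ (Fintype.card A) k) (T k) ≤ sapmdAccuracy M.γ)
    (hGmeas : ∀ k s a, Measurable[ℱ (k + 1)] fun ω => G k ω s a)
    (hGL2 : ∀ k s a, MeasureTheory.MemLp (fun ω => G k ω s a) 2 ℙ)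
    (hbias : ∀ k, ∀ᵐ ω ∂ℙ, ∀ s a,
      |(ℙ[fun ω' => G k ω' s a|ℱ k]) ω
          - Qval M h (sapmdTau M.γ (Fintype.card A) k)
            (sapmdRun M.γ dh L T (fun j => G j ω) k).pol s a|
        ≤ (1 / 2 : ℝ) ^ (k / epochLen M.γ + 2))
    (hvar : ∀ k, ∀ᵐ ω ∂ℙ, (ℙ[fun ω' =>
          ‖G k ω' - Qval M h (sapmdTau M.γ (Fintype.card A) k)
            (sapmdRun M.γ dh L T (fun j => G j ω') k).pol‖ ^ 2|ℱ k]) ω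
        ≤ (1 / 4 : ℝ) ^ (k / epochLen M.γ + 2)) (k : ℕ) :
    MeasureTheory.Integrable (fun ω => objective M h ν
        (sapmdRun M.γ dh L T (fun j => G j ω) k).pol - objective M h ν πs) ℙ ∧
      ∫ ω, (objective M h ν (sapmdRun M.γ dh L T (fun j => G j ω) k).pol - objective M h ν πs) ∂ℙ
        ≤ (1 / 2 : ℝ) ^ (k / epochLen M.γ) * sapmdRateConst M.γ (Fintype.card A)
          (objective M h ν (uniformPolicy S A) - objective M h ν πs) := by
  have : Nonempty A := Fintype.card_pos_iff.1 (by omega)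
  have hγ := M.γ_pos
  have hγ1 := M.γ_lt_one
  have hγ1' := sub_pos.2 hγ1
  have hi := fun k ω => sapmdRun_interior (dh := dh) (T := T) (G := fun j => G j ω)
    hA hγ hγ1 hL k
  set Δ := objective M h ν (uniformPolicy S A) - objective M h ν πs with hΔ
  have hΔ0 : 0 ≤ Δ := hπs.objective_sub_nonneg hν fun _ => uniformDist_mem
  set x := Real.sqrt (Real.log (Fintype.card A)) / Real.sqrt M.γ with hx
  have hx0 : 0 ≤ x := by positivity
  set E := x * ((1 - M.γ) / (4 * M.γ * (1 + M.γ)) + 5 / 16 + M.γ / 4) + 1 / 2 with hE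
  have hE0 : 0 ≤ E := by positivity
  have hlyap := fun τ k => integrable_lyapunov (ν := ν) hA hL hreg hGmeas hGL2 hT hTacc hπs.1 τ k
  set τ := sapmdTau M.γ (Fintype.card A) with hτ
  have hτ0 : ∀ k, 0 < τ k := sapmdTau_pos hγ hA
  have hτlog : ∀ k, τ k * Real.log (Fintype.card A) = (1 / 2) ^ (k / epochLen M.γ) * (x / 2) :=
    sapmdTau_mul_log hγ hA
  set w : ℕ → ℝ := fun k => ∫ ω, lyapunov M h ν πs (τ k)
    (sapmdRun M.γ dh L T (fun j => G j ω) k).pol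
    (sapmdRun M.γ dh L T (fun j => G j ω) k).center ∂ℙ with hw
  -- F is the equilibrium for the one-step error E, and b is the cost of lowering τ, because τ_k log
  -- n = 2^(-i) x/2. C is Δ plus the least amount allowed by F + b/2 ≤ C/4; it also covers the
  -- initial value, at most Δ + x/(1-γ).
  have hrec := epoch_recursion (w := w) (γ := M.γ) (F := E / (1 - M.γ)) (b := x / 2 / (1 - M.γ))
    (C := Δ + (4 * E + x) / (1 - M.γ)) (epochLen_pos hγ hγ1) hγ hγ1 (pow_epochLen_le hγ hγ1) (by
      have h1 := lyapunov_uniform_le (h := h) hπs.1 hν (hτ0 0).le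
      have h2 : w 0 = lyapunov M h ν πs (τ 0) (uniformPolicy S A) (uniformPolicy S A) := by
        simp only [hw, sapmdRun]
        simp
      rw [h2]
      refine h1.trans ?_
      have h3 : 2 * (τ 0 * Real.log (Fintype.card A)) / (1 - M.γ) ≤ (4 * E + x) / (1 - M.γ) := by
        refine div_le_div_of_nonneg_right ?_ hγ1'.le
        rw [hτlog 0, Nat.zero_div, pow_zero]
        linarith
      linarith) (by positivity) (by positivity) (by
      have : E / (1 - M.γ) + x / 2 / (1 - M.γ) / 2 = (4 * E + x) / (1 - M.γ) / 4 := by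
        field_simp
        ring
      linarith) (fun k => by
      have h1 : ∫ ω, lyapunov M h ν πs (τ k) (sapmdRun M.γ dh L T (fun j => G j ω) (k + 1)).pol
          (sapmdRun M.γ dh L T (fun j => G j ω) (k + 1)).center ∂ℙ
          ≤ M.γ * w k + (1 / 2) ^ (k / epochLen M.γ) * E :=
        integral_lyapunov_step hA hL hreg hGmeas hGL2 hT hTacc hπs.1 hν k (hbias k) (hvar k)
      have h2 : w (k + 1) ≤ ∫ ω, (lyapunov M h ν πs (τ k)
          (sapmdRun M.γ dh L T (fun j => G j ω) (k + 1)).pol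
          (sapmdRun M.γ dh L T (fun j => G j ω) (k + 1)).center
          + (τ k - τ (k + 1)) * Real.log (Fintype.card A) / (1 - M.γ)) ∂ℙ :=
        MeasureTheory.integral_mono (hlyap _ _)
          ((hlyap _ _).add (MeasureTheory.integrable_const _)) fun ω =>
          lyapunov_change_perturbation hπs.1 hν (hi (k + 1) ω).1 (hi (k + 1) ω).2.1
            (hi (k + 1) ω).2.2 (sapmdTau_succ_le k)
      rw [MeasureTheory.integral_add (hlyap _ _) (MeasureTheory.integrable_const _), sub_mul,
        hτlog, hτlog] at h2
      simp only [MeasureTheory.integral_const, MeasureTheory.probReal_univ, smul_eq_mul,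
        one_mul] at h2
      have e1 : (1 - M.γ) * (E / (1 - M.γ)) = E := by field_simp
      rw [e1]
      have e2 : ((1 / 2) ^ (k / epochLen M.γ) * (x / 2)
          - (1 / 2) ^ ((k + 1) / epochLen M.γ) * (x / 2)) / (1 - M.γ)
          = ((1 / 2) ^ (k / epochLen M.γ) - (1 / 2) ^ ((k + 1) / epochLen M.γ))
            * (x / 2 / (1 - M.γ)) := by ring
      rw [e2] at h2
      linarith) k
  have hint : MeasureTheory.Integrable (fun ω => objective M h ν
      (sapmdRun M.γ dh L T (fun j => G j ω) k).pol - objective M h ν πs) ℙ := by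
    simp only [objective_sub_eq]
    exact MeasureTheory.integrable_finsetSum _ fun s _ =>
      ((integrable_perturbedValue hA hL hreg hGmeas 0 k s).sub
        (MeasureTheory.integrable_const _)).const_mul _
  refine ⟨hint, ?_⟩
  have h3 : ∫ ω, (objective M h ν (sapmdRun M.γ dh L T (fun j => G j ω) k).pol
      - objective M h ν πs) ∂ℙ ≤ w k + τ k * Real.log (Fintype.card A) / (1 - M.γ) := by
    have := MeasureTheory.integral_mono hint
      ((hlyap (τ k) k).add (MeasureTheory.integrable_const
        (τ k * Real.log (Fintype.card A) / (1 - M.γ)))) fun ω =>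
      objective_sub_le_lyapunov hπs.1 hν (hi k ω).1 (hi k ω).2.1 (hi k ω).2.2 (hτ0 k).le
    refine this.trans (le_of_eq ?_)
    rw [MeasureTheory.integral_add' (hlyap _ _) (MeasureTheory.integrable_const _)]
    simp [hw]
  rw [hτlog] at h3
  have h4 := rate_constant_le hγ hγ1 hx0
  rw [← hE] at h4
  have h5 : Δ + (4 * E + x) / (1 - M.γ) + x / 2 / (1 - M.γ)
      ≤ sapmdRateConst M.γ (Fintype.card A) Δ := by
    have e3 : sapmdRateConst M.γ (Fintype.card A) Δ = Δ + (3 * x + 5 * (2 - M.γ) / 2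
        + max 1 ((1 - M.γ) / M.γ) * (5 * x / 4)) / (1 - M.γ) := by
      rw [sapmdRateConst, hx]
      ring
    rw [e3, add_assoc, ← add_div]
    have := div_le_div_of_nonneg_right h4 hγ1'.le
    linarith
  have h6 := mul_le_mul_of_nonneg_left h5
    (show (0 : ℝ) ≤ (1 / 2) ^ (k / epochLen M.γ) by positivity)
  have e4 : (1 / 2) ^ (k / epochLen M.γ) * (x / 2) / (1 - M.γ)
      = (1 / 2) ^ (k / epochLen M.γ) * (x / 2 / (1 - M.γ)) := by ring
  rw [e4] at h3
  linarith

end Rate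

/-! ### Inner iterations per step. -/

section Complexity

theorem agdRun_gradCalls {S A : Type*} [Fintype A] (dh : S → (A → ℝ) → (A → ℝ)) (η τ : ℝ)
    (G v : S → A → ℝ) (l μ : ℝ) (t : ℕ) : (agdRun dh η τ G v l μ t).gradCalls = t := by
  induction t with
  | zero => rfl
  | succ t ih =>
    rw [agdRun, agdStep]
    simp only [ih]

theorem sapmdRun_gradCalls {S A : Type*} [Fintype A] (γ : ℝ) (dh : S → (A → ℝ) → (A → ℝ)) (L : ℝ)
    (T : ℕ → ℕ) (G : ℕ → S → A → ℝ) (K : ℕ) :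
    (sapmdRun γ dh L T G K).gradCalls = ∑ k ∈ Finset.range K, T k := by
  induction K with
  | zero => rfl
  | succ K ih =>
    rw [Finset.sum_range_succ, ← ih, sapmdRun]
    simp only [agdRun_gradCalls]

theorem sum_range_mul_div (f : ℕ → ℝ) {l : ℕ} (hl : 0 < l) (I : ℕ) :
    ∑ k ∈ Finset.range (l * I), f (k / l) = l * ∑ i ∈ Finset.range I, f i := by
  induction I with
  | zero => simp
  | succ I ih =>
    rw [mul_add, mul_one, Finset.sum_range_add, ih, Finset.sum_range_succ, mul_add]
    congr 1
    rw [Finset.sum_congr rfl (g := fun _ => f I)]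
    · simp
    · intro j hj
      rw [Nat.mul_add_div hl, Nat.div_eq_of_lt (Finset.mem_range.1 hj), add_zero]

/-- A geometric sum: the constant is √2/(√2 - 1) = 2 + √2. -/
theorem sum_sqrt_two_pow_le (I : ℕ) :
    ∑ i ∈ Finset.range I, Real.sqrt 2 ^ (i + 1) ≤ (2 + Real.sqrt 2) * Real.sqrt 2 ^ I := by
  have h2 : Real.sqrt 2 * Real.sqrt 2 = 2 := Real.mul_self_sqrt zero_le_two
  induction I with
  | zero =>
    simp
    positivity
  | succ I ih =>
    rw [Finset.sum_range_succ]
    refine (add_le_add_left ih _).trans (le_of_eq ?_)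
    rw [pow_succ]
    linear_combination (-Real.sqrt 2 ^ I) * h2

theorem sqrt_one_add_mul_two_pow_le {c : ℝ} (hc : 0 ≤ c) (i : ℕ) :
    Real.sqrt (1 + c * 2 ^ i) ≤ 1 + Real.sqrt c * Real.sqrt 2 ^ i := by
  have h2 : (Real.sqrt 2 ^ i) ^ 2 = 2 ^ i := by
    rw [← pow_mul, mul_comm, pow_mul, Real.sq_sqrt zero_le_two]
  rw [Real.sqrt_le_iff]
  refine ⟨by positivity, ?_⟩
  have h3 : (Real.sqrt c * Real.sqrt 2 ^ i) ^ 2 = c * 2 ^ i := by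
    rw [mul_pow, Real.sq_sqrt hc, h2]
  have h4 : 0 ≤ Real.sqrt c * Real.sqrt 2 ^ i := by positivity
  nlinarith

section InnerIterations

variable {l μ a : ℝ} {T : ℕ} (hμ : 0 < μ) (hl : μ < l) (ha : 0 < a)
  (hT : IsLeast {t : ℕ | 1 ≤ t ∧ agdAccuracy l μ t ≤ a} T)
include hμ hl ha hT

/-- The linear regime of the accelerated gradient method. -/
theorem agd_iterations_le_log {X : ℝ} (hX : 2 * l / a ≤ X) (hX1 : 1 ≤ X) :
    (T : ℝ) ≤ 2 + Real.sqrt (l / μ) * Real.log X := by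
  have hl0 := hμ.trans hl
  have hlog := Real.log_nonneg hX1
  have hX0 : 0 < X := by linarith
  set y := Real.sqrt (l / μ) * Real.log X with hy
  have hy0 : 0 ≤ y := by positivity
  -- By minimality of T one admissible number suffices. The exponent in the accuracy is t - 1 = ⌈y⌉,
  -- and 1 - w ≤ exp(-w).
  have hmem : 1 + ⌈y⌉₊ ∈ {t : ℕ | 1 ≤ t ∧ agdAccuracy l μ t ≤ a} := by
    refine ⟨Nat.le_add_right 1 _, ?_⟩
    have hw1 := sqrt_ratio_lt_one hμ hl
    have h1 : (1 - Real.sqrt (μ / l)) ^ ⌈y⌉₊ ≤ 1 / X := by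
      calc (1 - Real.sqrt (μ / l)) ^ ⌈y⌉₊ ≤ Real.exp (-Real.sqrt (μ / l)) ^ ⌈y⌉₊ := by
            refine pow_le_pow_left₀ (sub_nonneg.2 hw1.le) ?_ _
            have := Real.add_one_le_exp (-Real.sqrt (μ / l))
            linarith
        _ = Real.exp (-(Real.sqrt (μ / l) * ⌈y⌉₊)) := by
            rw [← Real.exp_nat_mul]
            congr 1
            ring
        _ ≤ Real.exp (-Real.log X) := by
            refine Real.exp_le_exp.2 (neg_le_neg ?_)
            calc Real.log X = Real.sqrt (μ / l) * y := by
                  rw [hy, ← mul_assoc, ← Real.sqrt_mul (by positivity)]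
                  rw [div_mul_div_cancel₀ hl0.ne', div_self hμ.ne', Real.sqrt_one, one_mul]
              _ ≤ _ := mul_le_mul_of_nonneg_left (Nat.le_ceil y) (Real.sqrt_nonneg _)
        _ = 1 / X := by rw [Real.exp_neg, Real.exp_log hX0, one_div]
    rw [agdAccuracy, Nat.add_sub_cancel_left]
    calc 2 * l * min ((1 - Real.sqrt (μ / l)) ^ ⌈y⌉₊) _ ≤ 2 * l * (1 / X) :=
          mul_le_mul_of_nonneg_left ((min_le_left _ _).trans h1) (by positivity)
      _ ≤ a := by
          rw [mul_one_div, div_le_iff₀ hX0]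
          rw [div_le_iff₀ ha] at hX
          linarith
  have h1 : (T : ℝ) ≤ ((1 + ⌈y⌉₊ : ℕ) : ℝ) := by exact_mod_cast hT.2 hmem
  push_cast at h1
  linarith [Nat.ceil_lt_add_one hy0]

/-- The sublinear regime of the accelerated gradient method. -/
theorem agd_iterations_le_sqrt : (T : ℝ) ≤ 1 + Real.sqrt (4 * l / a) := by
  have hl0 := hμ.trans hl
  set y := Real.sqrt (4 * l / a) with hy
  have hy0 : 0 < y := Real.sqrt_pos.2 (by positivity)
  have hy2 : y ^ 2 = 4 * l / a := Real.sq_sqrt (by positivity)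
  have hmem : ⌈y⌉₊ ∈ {t : ℕ | 1 ≤ t ∧ agdAccuracy l μ t ≤ a} := by
    refine ⟨Nat.ceil_pos.2 hy0, ?_⟩
    have hc := Nat.le_ceil y
    have hc0 : (0 : ℝ) < ⌈y⌉₊ := hy0.trans_le hc
    rw [agdAccuracy]
    calc 2 * l * min _ (2 / ((⌈y⌉₊ : ℝ) * ((⌈y⌉₊ : ℝ) + 1)))
        ≤ 2 * l * (2 / ((⌈y⌉₊ : ℝ) * ((⌈y⌉₊ : ℝ) + 1))) :=
          mul_le_mul_of_nonneg_left (min_le_right _ _) (by positivity)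
      _ ≤ 2 * l * (2 / y ^ 2) := by
          refine mul_le_mul_of_nonneg_left ?_ (by positivity)
          refine div_le_div_of_nonneg_left zero_le_two (by positivity) ?_
          nlinarith
      _ = a := by
          rw [hy2]
          field_simp
          norm_num
  have h1 : (T : ℝ) ≤ (⌈y⌉₊ : ℝ) := by exact_mod_cast hT.2 hmem
  linarith [Nat.ceil_lt_add_one hy0.le]

end InnerIterations

section SapmdIterations

variable {γ : ℝ} {n : ℕ} {L : ℝ} (hγ : 0 < γ) (hγ1 : γ < 1) (hn : 2 ≤ n) (hL : 0 < L)
include hγ hn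

/-- Since μ_k = 1/γ for all k, the condition number is the numerator, which grows like 2^i. -/
theorem sapmdSmooth_eq (k : ℕ) : sapmdSmooth γ n L k
    = (1 + (1 - γ) * L * Real.sqrt (γ * Real.log n) * 2 ^ (k / epochLen γ + 1)) / γ := by
  have hlog : 0 < Real.log n := Real.log_pos (by exact_mod_cast hn)
  have ha : 0 < Real.sqrt (γ * Real.log n) := Real.sqrt_pos.2 (mul_pos hγ hlog)
  rw [sapmdSmooth, sapmdMu_eq hγ hn, sapmdEta, sapmdTau, one_div_pow]
  field_simp
  ring

include hγ1 hL

theorem sapmdMu_lt_sapmdSmooth (k : ℕ) : sapmdMu γ n k < sapmdSmooth γ n L k := by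
  unfold sapmdSmooth
  linarith [mul_pos (sapmdEta_pos hγ hn hγ1 k) hL]

theorem sapmd_iterations_le_log {k T : ℕ} {X : ℝ}
    (hT : IsLeast {t : ℕ | 1 ≤ t ∧ agdAccuracy (sapmdSmooth γ n L k) (sapmdMu γ n k) t
      ≤ sapmdAccuracy γ} T) (hX1 : 1 ≤ X)
    (hX : 8 / (1 - γ) ^ 2
      + 8 / (1 - γ) * (L * Real.sqrt (Real.log n)) * 2 ^ (k / epochLen γ + 1) ≤ X) :
    (T : ℝ) ≤ (2 + Real.log X) * (1 + Real.sqrt ((1 - γ) * L * Real.sqrt (γ * Real.log n))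
      * Real.sqrt 2 ^ (k / epochLen γ + 1)) := by
  have hγ1' := sub_pos.2 hγ1
  have hlog : 0 < Real.log n := Real.log_pos (by exact_mod_cast hn)
  have hμ : 0 < sapmdMu γ n k := by
    rw [sapmdMu_eq hγ hn]
    positivity
  set c := (1 - γ) * L * Real.sqrt (γ * Real.log n) with hc
  have hc0 : 0 ≤ c := by positivity
  have ha : Real.sqrt (γ * Real.log n) ≤ Real.sqrt (Real.log n) :=
    Real.sqrt_le_sqrt (mul_le_of_le_one_left hlog.le hγ1.le)
  have h1 := agd_iterations_le_log hμ (sapmdMu_lt_sapmdSmooth hγ hγ1 hn hL k)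
    (sapmdAccuracy_pos hγ hγ1) hT (X := X) (by
      refine le_trans ?_ hX
      have e : 2 * sapmdSmooth γ n L k / sapmdAccuracy γ
          = 4 * γ * (1 + γ) * (1 / (1 - γ) ^ 2 + 1 / (1 - γ)
            * (L * Real.sqrt (γ * Real.log n)) * 2 ^ (k / epochLen γ + 1)) := by
        rw [sapmdSmooth_eq hγ hn, sapmdAccuracy]
        field_simp
        ring
      rw [e]
      have h8 : 4 * γ * (1 + γ) ≤ 8 := by nlinarith
      calc 4 * γ * (1 + γ) * (1 / (1 - γ) ^ 2 + 1 / (1 - γ)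
            * (L * Real.sqrt (γ * Real.log n)) * 2 ^ (k / epochLen γ + 1))
          ≤ 8 * (1 / (1 - γ) ^ 2 + 1 / (1 - γ)
            * (L * Real.sqrt (Real.log n)) * 2 ^ (k / epochLen γ + 1)) := by gcongr
        _ = _ := by ring) hX1
  have e2 : sapmdSmooth γ n L k / sapmdMu γ n k = 1 + c * 2 ^ (k / epochLen γ + 1) := by
    rw [sapmdSmooth_eq hγ hn, sapmdMu_eq hγ hn, hc]
    field_simp
  rw [e2] at h1
  have h2 := sqrt_one_add_mul_two_pow_le hc0 (k / epochLen γ + 1)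
  have h3 := Real.log_nonneg hX1
  have h4 : 0 ≤ Real.sqrt c * Real.sqrt 2 ^ (k / epochLen γ + 1) := by positivity
  have h5 := mul_le_mul_of_nonneg_right h2 h3
  nlinarith

theorem sapmd_iterations_le_sqrt {k T : ℕ}
    (hT : IsLeast {t : ℕ | 1 ≤ t ∧ agdAccuracy (sapmdSmooth γ n L k) (sapmdMu γ n k) t
      ≤ sapmdAccuracy γ} T) :
    (T : ℝ) ≤ 4 / (1 - γ) * (1 + Real.sqrt ((1 - γ) * L * Real.sqrt (γ * Real.log n))
      * Real.sqrt 2 ^ (k / epochLen γ + 1)) := by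
  have hγ1' := sub_pos.2 hγ1
  have hlog : 0 < Real.log n := Real.log_pos (by exact_mod_cast hn)
  have hμ : 0 < sapmdMu γ n k := by
    rw [sapmdMu_eq hγ hn]
    positivity
  set c := (1 - γ) * L * Real.sqrt (γ * Real.log n) with hc
  have hc0 : 0 ≤ c := by positivity
  have h1 := agd_iterations_le_sqrt hμ (sapmdMu_lt_sapmdSmooth hγ hγ1 hn hL k)
    (sapmdAccuracy_pos hγ hγ1) hT
  have e : 4 * sapmdSmooth γ n L k / sapmdAccuracy γ
      = (8 * γ * (1 + γ)) / (1 - γ) ^ 2 * (1 + c * 2 ^ (k / epochLen γ + 1)) := by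
    rw [sapmdSmooth_eq hγ hn, sapmdAccuracy]
    field_simp
    ring
  rw [e, Real.sqrt_mul (by positivity), Real.sqrt_div (by positivity),
    Real.sqrt_sq hγ1'.le] at h1
  have h2 := sqrt_one_add_mul_two_pow_le hc0 (k / epochLen γ + 1)
  set z := Real.sqrt c * Real.sqrt 2 ^ (k / epochLen γ + 1)
  have hz : 0 ≤ z := by positivity
  -- Here (3+γ)² - 8γ(1+γ) = (1-γ)(9+7γ). The bound 3+γ is convenient because 1 + (3+γ)/(1-γ) =
  -- 4/(1-γ).
  have h3 : Real.sqrt (8 * γ * (1 + γ)) ≤ 3 + γ := by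
    rw [Real.sqrt_le_iff]
    constructor
    · linarith
    · nlinarith [mul_nonneg hγ1'.le hγ.le]
  have h4 : Real.sqrt (8 * γ * (1 + γ)) / (1 - γ) * Real.sqrt (1 + c * 2 ^ (k / epochLen γ + 1))
      ≤ (3 + γ) / (1 - γ) * (1 + z) := by gcongr
  have h5 : 1 + (3 + γ) / (1 - γ) * (1 + z) ≤ 4 / (1 - γ) * (1 + z) := by
    have : 4 / (1 - γ) = 1 + (3 + γ) / (1 - γ) := by
      field_simp
      ring
    rw [this]
    linarith
  linarith

end SapmdIterations

end Complexity

/-! ### Total number of gradient evaluations. -/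

section TotalComplexity

/-- The number of epochs after which the accuracy `ε` is reached. -/
theorem exists_epochs {B ε : ℝ} (hε : 0 < ε) (hBε : ε ≤ B) : ∃ I : ℕ,
    B / ε ≤ 2 ^ I ∧ (2 : ℝ) ^ I ≤ 2 * B / ε ∧ (I : ℝ) ≤ Real.logb 2 (2 * B / ε) := by
  have h1 : 1 ≤ B / ε := (one_le_div hε).2 hBε
  have h0 : 0 < B / ε := by linarith
  have hl : 0 ≤ Real.logb 2 (B / ε) := Real.logb_nonneg one_lt_two h1
  have e1 : Real.logb 2 (2 * B / ε) = 1 + Real.logb 2 (B / ε) := by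
    rw [mul_div_assoc, Real.logb_mul two_ne_zero h0.ne', Real.logb_self_eq_one one_lt_two]
  have hle : (⌈Real.logb 2 (B / ε)⌉₊ : ℝ) ≤ Real.logb 2 (2 * B / ε) := by
    rw [e1]
    linarith [Nat.ceil_lt_add_one hl]
  refine ⟨⌈Real.logb 2 (B / ε)⌉₊, ?_, ?_, hle⟩
  · rw [← Real.rpow_natCast]
    exact (Real.logb_le_iff_le_rpow one_lt_two h0).1 (Nat.le_ceil _)
  · rw [← Real.rpow_natCast]
    refine (Real.le_logb_iff_rpow_le one_lt_two ?_).1 hle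
    rw [mul_div_assoc]
    positivity

/-- Summation of the iteration counts over the epochs. -/
theorem sum_iterations_le {T : ℕ → ℕ} {l I : ℕ} (hl : 0 < l) {C c B ε : ℝ} (hC : 0 ≤ C)
    (hc : 0 ≤ c)
    (hT : ∀ k < l * I, (T k : ℝ) ≤ C * (1 + Real.sqrt c * Real.sqrt 2 ^ (k / l + 1)))
    (hI : (2 : ℝ) ^ I ≤ 2 * B / ε) (hI' : (I : ℝ) ≤ Real.logb 2 (2 * B / ε)) :
    ((∑ k ∈ Finset.range (l * I), T k : ℕ) : ℝ)
      ≤ l * C * (Real.logb 2 (2 * B / ε) + 5 * Real.sqrt (c * B / ε)) := by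
  push_cast
  calc ∑ k ∈ Finset.range (l * I), (T k : ℝ)
      ≤ ∑ k ∈ Finset.range (l * I), C * (1 + Real.sqrt c * Real.sqrt 2 ^ (k / l + 1)) :=
        Finset.sum_le_sum fun k hk => hT k (Finset.mem_range.1 hk)
    _ = l * C * (I + Real.sqrt c * ∑ i ∈ Finset.range I, Real.sqrt 2 ^ (i + 1)) := by
        rw [sum_range_mul_div (fun i => C * (1 + Real.sqrt c * Real.sqrt 2 ^ (i + 1))) hl,
          ← Finset.mul_sum, Finset.sum_add_distrib, ← Finset.mul_sum]
        simp
        ring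
    _ ≤ _ := by
        have h2 : Real.sqrt 2 ^ I ≤ Real.sqrt 2 * Real.sqrt (B / ε) := by
          rw [← Real.sqrt_mul zero_le_two, ← mul_div_assoc]
          refine Real.le_sqrt_of_sq_le ?_
          rw [← pow_mul, mul_comm, pow_mul, Real.sq_sqrt zero_le_two]
          exact hI
        have h3 := mul_le_mul_of_nonneg_left h2 (show 0 ≤ 2 + Real.sqrt 2 by positivity)
        have h4 : (2 + Real.sqrt 2) * Real.sqrt 2 ≤ 5 := by
          have h5 : Real.sqrt 2 ≤ 3 / 2 := by
            rw [Real.sqrt_le_iff]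
            norm_num
          have h6 : Real.sqrt 2 * Real.sqrt 2 = 2 := Real.mul_self_sqrt zero_le_two
          linarith
        have h7 : ∑ i ∈ Finset.range I, Real.sqrt 2 ^ (i + 1) ≤ 5 * Real.sqrt (B / ε) := by
          refine (sum_sqrt_two_pow_le I).trans (h3.trans ?_)
          rw [← mul_assoc]
          exact mul_le_mul_of_nonneg_right h4 (Real.sqrt_nonneg _)
        have h8 : Real.sqrt (c * B / ε) = Real.sqrt c * Real.sqrt (B / ε) := by
          rw [mul_div_assoc, Real.sqrt_mul hc]
        rw [h8]
        refine mul_le_mul_of_nonneg_left ?_ (by positivity)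
        have h9 := mul_le_mul_of_nonneg_left h7 (Real.sqrt_nonneg c)
        linarith

theorem sqrt_log_ge {n : ℕ} (hn : 2 ≤ n) : 4 / 5 ≤ Real.sqrt (Real.log n) := by
  refine Real.le_sqrt_of_sq_le ?_
  have h1 : Real.log 2 ≤ Real.log n := Real.log_le_log two_pos (by exact_mod_cast hn)
  have := Real.log_two_gt_d9
  norm_num
  linarith

/-- From log y ≤ y/e at y = √(2B). The bound 4/5 for √(log n) gives y ≤ 1.8 √(Bs), and 3.6/(2.7 log
2) < 2. -/
theorem logb_two_mul_le {B s : ℝ} (hB : 0 < B) (hs : 4 / 5 ≤ s) :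
    Real.logb 2 (2 * B) ≤ 2 * Real.sqrt (B * s) := by
  have hs0 : 0 < s := by linarith
  have h2 := Real.log_two_gt_d9
  set y := Real.sqrt (2 * B) with hy
  have hy0 : 0 < y := Real.sqrt_pos.2 (by positivity)
  have e1 : Real.log (2 * B) = 2 * Real.log y := by
    rw [hy, Real.log_sqrt (by positivity)]
    ring
  have h3 : Real.log y ≤ y / Real.exp 1 := by
    have := Real.log_le_sub_one_of_pos (div_pos hy0 (Real.exp_pos 1))
    rw [Real.log_div hy0.ne' (Real.exp_pos 1).ne', Real.log_exp] at this
    linarith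
  have h4 : y / Real.exp 1 ≤ y / 2.7 := by
    refine div_le_div_of_nonneg_left hy0.le (by norm_num) ?_
    have := Real.exp_one_gt_d9
    linarith
  have h5 : y ≤ 1.8 * Real.sqrt (B * s) := by
    rw [hy, Real.sqrt_le_iff]
    refine ⟨by positivity, ?_⟩
    rw [mul_pow, Real.sq_sqrt (by positivity)]
    nlinarith
  have hz : 0 ≤ Real.sqrt (B * s) := Real.sqrt_nonneg _
  rw [Real.logb, div_le_iff₀ (by linarith), e1]
  have h6 : Real.log y ≤ 1.8 * Real.sqrt (B * s) / 2.7 :=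
    h3.trans (h4.trans (div_le_div_of_nonneg_right h5 (by norm_num)))
  have h7 := mul_le_mul_of_nonneg_left h2.le hz
  norm_num at h6 h7
  linarith

/-- A change of base: 2 comes from log₂ 4, and log₂(1/γ) pays for the rounding in the epoch length.
-/
theorem epochLen_mul_logb_le {γ ε : ℝ} (hγ : 0 < γ) (hγ1 : γ < 1) (hε : 0 < ε) (hε1 : ε ≤ 1) :
    epochLen γ * Real.logb 2 (1 / ε) ≤ (2 + Real.logb 2 (1 / γ)) * Real.logb γ ε := by
  have hlγ : 0 < -Real.log γ := neg_pos.2 (Real.log_neg hγ hγ1)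
  have h2 := Real.log_pos one_lt_two
  have h4 : Real.log (1 / 4) = -(2 * Real.log 2) := by
    rw [one_div, Real.log_inv, show (4 : ℝ) = 2 ^ 2 by norm_num, Real.log_pow]
    norm_num
  have h1 : (epochLen γ : ℝ) ≤ (2 * Real.log 2 + -Real.log γ) / -Real.log γ := by
    have hc := Nat.ceil_lt_add_one
      (Real.logb_pos_of_base_lt_one hγ hγ1 (show (0 : ℝ) < 1 / 4 by norm_num) (by norm_num)).le
    have e : Real.logb γ (1 / 4) = 2 * Real.log 2 / -Real.log γ := by
      rw [Real.logb, h4, neg_div, div_neg]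
    rw [add_div, div_self hlγ.ne', ← e]
    exact hc.le
  have h3 : 0 ≤ Real.logb 2 (1 / ε) := Real.logb_nonneg one_lt_two (by
    rw [le_div_iff₀ hε]
    linarith)
  refine (mul_le_mul_of_nonneg_right h1 h3).trans (le_of_eq ?_)
  have hne : Real.log γ ≠ 0 := by linarith
  rw [Real.logb, Real.logb, Real.logb, one_div, one_div, Real.log_inv, Real.log_inv]
  field_simp

variable {γ : ℝ} {n : ℕ} {L B ε : ℝ} {T : ℕ → ℕ}

/-- Guarantees ε ≤ B for ε ≤ 1/2, as needed to choose the number of epochs. -/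
theorem le_sapmdRateConst (hγ1 : γ < 1) {Δ : ℝ} (hΔ : 0 ≤ Δ) (n : ℕ) :
    5 / 2 ≤ sapmdRateConst γ n Δ := by
  have hγ1' := sub_pos.2 hγ1
  have h1 : 5 / 2 ≤ 1 / (1 - γ) * (5 * (2 - γ) / 2) := by
    rw [one_div, ← div_eq_inv_mul, le_div_iff₀ hγ1']
    linarith
  have h2 : 0 ≤ 1 / (1 - γ) * (3 * Real.sqrt (Real.log n) / Real.sqrt γ
      + max 1 ((1 - γ) / γ) * (5 * Real.sqrt (Real.log n) / (4 * Real.sqrt γ))) := by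
    have : 0 ≤ max 1 ((1 - γ) / γ) := zero_le_one.trans (le_max_left _ _)
    positivity
  unfold sapmdRateConst
  linarith

/-- The bound on the number of gradient evaluations from the linear regime. -/
theorem sum_iterations_le_log (hγ : 0 < γ) (hγ1 : γ < 1) (hn : 2 ≤ n) (hL : 0 < L)
    (hT : ∀ k, IsLeast {t : ℕ | 1 ≤ t ∧ agdAccuracy (sapmdSmooth γ n L k) (sapmdMu γ n k) t
      ≤ sapmdAccuracy γ} (T k)) (hε : 0 < ε) (hB : 0 < B) {I : ℕ}
    (hI : (2 : ℝ) ^ I ≤ 2 * B / ε) (hI' : (I : ℝ) ≤ Real.logb 2 (2 * B / ε)) :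
    ((∑ k ∈ Finset.range (epochLen γ * I), T k : ℕ) : ℝ)
      ≤ epochLen γ * (2 + Real.log (16 * L * Real.sqrt (Real.log n) * B / ((1 - γ) * ε)
          + 8 / (1 - γ) ^ 2))
        * (Real.logb 2 (2 * B / ε)
          + 5 * Real.sqrt ((1 - γ) * L * B * Real.sqrt (γ * Real.log n) / ε)) := by
  have hγ1' := sub_pos.2 hγ1
  have hX1 : 1 ≤ 16 * L * Real.sqrt (Real.log n) * B / ((1 - γ) * ε) + 8 / (1 - γ) ^ 2 := by
    have h1 : 0 ≤ 16 * L * Real.sqrt (Real.log n) * B / ((1 - γ) * ε) := by positivity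
    have h2 : 8 ≤ 8 / (1 - γ) ^ 2 := by
      rw [le_div_iff₀ (by positivity)]
      nlinarith
    linarith
  set X := 16 * L * Real.sqrt (Real.log n) * B / ((1 - γ) * ε) + 8 / (1 - γ) ^ 2 with hX
  have hlX := Real.log_nonneg hX1
  have h := sum_iterations_le (c := (1 - γ) * L * Real.sqrt (γ * Real.log n)) (T := T)
    (epochLen_pos hγ hγ1) (C := 2 + Real.log X) (by positivity) (by positivity)
    (fun k hk => sapmd_iterations_le_log hγ hγ1 hn hL (hT k) hX1 (by
      -- Epoch indices stay below I, so 2^(i+1) ≤ 2B/ε and a single X serves all steps.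
      have hk' : k / epochLen γ + 1 ≤ I := (Nat.div_lt_iff_lt_mul (epochLen_pos hγ hγ1)).2
        (by rwa [mul_comm])
      have h1 : (2 : ℝ) ^ (k / epochLen γ + 1) ≤ 2 * B / ε :=
        (pow_le_pow_right₀ one_le_two hk').trans hI
      have h2 : 8 / (1 - γ) * (L * Real.sqrt (Real.log n)) * 2 ^ (k / epochLen γ + 1)
          ≤ 8 / (1 - γ) * (L * Real.sqrt (Real.log n)) * (2 * B / ε) := by gcongr
      have e : 8 / (1 - γ) * (L * Real.sqrt (Real.log n)) * (2 * B / ε)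
          = 16 * L * Real.sqrt (Real.log n) * B / ((1 - γ) * ε) := by
        field_simp
        ring
      rw [hX]
      linarith)) hI hI'
  have e : (1 - γ) * L * Real.sqrt (γ * Real.log n) * B / ε
      = (1 - γ) * L * B * Real.sqrt (γ * Real.log n) / ε := by ring
  rwa [e] at h

/-- The bound on the number of gradient evaluations from the sublinear regime. -/
theorem sum_iterations_le_sqrt (hγ : 0 < γ) (hγ1 : γ < 1) (hn : 2 ≤ n) (hL : 0 < L)
    (hT : ∀ k, IsLeast {t : ℕ | 1 ≤ t ∧ agdAccuracy (sapmdSmooth γ n L k) (sapmdMu γ n k) t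
      ≤ sapmdAccuracy γ} (T k)) (hε : 0 < ε) (hε2 : ε ≤ 1 / 2) (hεL : ε ≤ L) (hB : 0 < B) {I : ℕ}
    (hI : (2 : ℝ) ^ I ≤ 2 * B / ε) (hI' : (I : ℝ) ≤ Real.logb 2 (2 * B / ε)) :
    ((∑ k ∈ Finset.range (epochLen γ * I), T k : ℕ) : ℝ)
      ≤ 30 * (2 + Real.logb 2 (1 / γ)) / (1 - γ) * (1 + Real.sqrt (B * Real.sqrt (Real.log n)))
        * Real.logb γ ε * Real.sqrt (L / ε) := by
  have hγ1' := sub_pos.2 hγ1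
  have hlog : 0 < Real.log n := Real.log_pos (by exact_mod_cast hn)
  have h := sum_iterations_le (c := (1 - γ) * L * Real.sqrt (γ * Real.log n)) (T := T)
    (epochLen_pos hγ hγ1) (C := 4 / (1 - γ)) (by positivity) (by positivity)
    (fun k _ => sapmd_iterations_le_sqrt hγ hγ1 hn hL (hT k)) hI hI'
  set x := Real.sqrt (B * Real.sqrt (Real.log n)) with hx
  set Y := Real.sqrt (L / ε) with hY
  set lam := Real.logb 2 (1 / ε) with hlam
  have hx0 : 0 ≤ x := Real.sqrt_nonneg _
  have hY1 : 1 ≤ Y := Real.one_le_sqrt.2 ((one_le_div hε).2 hεL)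
  have hlam1 : 1 ≤ lam := by
    rw [hlam, Real.le_logb_iff_rpow_le one_lt_two (by positivity), Real.rpow_one,
      le_div_iff₀ hε]
    linarith
  have h1 : Real.logb 2 (2 * B / ε) ≤ 2 * x + lam := by
    have e : 2 * B / ε = (2 * B) * (1 / ε) := by ring
    rw [e, Real.logb_mul (by positivity) (by positivity)]
    linarith [logb_two_mul_le hB (sqrt_log_ge hn)]
  have h2 : Real.sqrt ((1 - γ) * L * Real.sqrt (γ * Real.log n) * B / ε) ≤ x * Y := by
    rw [hx, hY, ← Real.sqrt_mul (by positivity)]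
    refine Real.sqrt_le_sqrt ?_
    have ha : Real.sqrt (γ * Real.log n) ≤ Real.sqrt (Real.log n) :=
      Real.sqrt_le_sqrt (mul_le_of_le_one_left hlog.le hγ1.le)
    calc (1 - γ) * L * Real.sqrt (γ * Real.log n) * B / ε
        ≤ 1 * L * Real.sqrt (Real.log n) * B / ε := by
          gcongr
          linarith
      _ = _ := by ring
  -- The sum is at most 2x + lam + 5xY. Both lam ≥ 1 (from ε ≤ 1/2) and Y ≥ 1 (from ε ≤ L) are
  -- needed to bring it under the product; 15/2 times the 4 of the per-step bound is 30.
  have h3 : Real.logb 2 (2 * B / ε)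
      + 5 * Real.sqrt ((1 - γ) * L * Real.sqrt (γ * Real.log n) * B / ε)
      ≤ 15 / 2 * ((1 + x) * (lam * Y)) := by
    have hlY : 1 ≤ lam * Y := by nlinarith
    have g1 : lam ≤ lam * Y := by nlinarith
    have g2 : Y ≤ lam * Y := by nlinarith
    have g3 := mul_le_mul_of_nonneg_left g2 hx0
    have g4 := mul_le_mul_of_nonneg_left hlY hx0
    nlinarith
  have hl0 : (0 : ℝ) ≤ epochLen γ := Nat.cast_nonneg _
  have h4 := epochLen_mul_logb_le hγ hγ1 hε (by linarith)
  rw [← hlam] at h4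
  calc ((∑ k ∈ Finset.range (epochLen γ * I), T k : ℕ) : ℝ)
      ≤ epochLen γ * (4 / (1 - γ)) * (15 / 2 * ((1 + x) * (lam * Y))) :=
        h.trans (mul_le_mul_of_nonneg_left h3 (by positivity))
    _ = 30 / (1 - γ) * (1 + x) * Y * (epochLen γ * lam) := by ring
    _ ≤ 30 / (1 - γ) * (1 + x) * Y * ((2 + Real.logb 2 (1 / γ)) * Real.logb γ ε) := by
        have : 0 ≤ 30 / (1 - γ) * (1 + x) * Y := by positivity
        exact mul_le_mul_of_nonneg_left h4 this
    _ = _ := by ring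

end TotalComplexity

theorem mainTheorem12 {S A : Type*} [Fintype S] [Fintype A] (hA : 2 ≤ Fintype.card A)
    (M : MDP S A) (h : S → (A → ℝ) → ℝ) (dh : S → (A → ℝ) → (A → ℝ)) (L : ℝ) (hL : 0 < L)
    (hreg : IsSmoothConvexRegularizer h dh L)
    (πs : S → A → ℝ) (hπs : IsOptimalPolicy M h πs)
    (ν : S → ℝ) (hν : IsStationaryDist M πs ν)
    -- numbers of inner iterations that guarantee the prescribed accuracy
    (T : ℕ → ℕ) (hT : ∀ k, 1 ≤ T k)
    (hTacc : ∀ k, agdAccuracy (sapmdSmooth M.γ (Fintype.card A) L k)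
      (sapmdMu M.γ (Fintype.card A) k) (T k) ≤ sapmdAccuracy M.γ)
    -- the stochastic estimates `G k` of the action-value function; `ℱ k` is the information
    -- that is available before `G k` is drawn
    {Ω : Type*} {mΩ : MeasurableSpace Ω} (ℙ : MeasureTheory.Measure Ω)
    [MeasureTheory.IsProbabilityMeasure ℙ] (ℱ : MeasureTheory.Filtration ℕ mΩ)
    (G : ℕ → Ω → S → A → ℝ)
    (hGmeas : ∀ k s a, Measurable[ℱ (k + 1)] fun ω => G k ω s a)
    (hGL2 : ∀ k s a, MeasureTheory.MemLp (fun ω => G k ω s a) 2 ℙ)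
    -- the policy `π_k` that the method produces
    (π : ℕ → Ω → S → A → ℝ)
    (hπ : ∀ k ω, π k ω = (sapmdRun M.γ dh L T (fun j => G j ω) k).pol)
    -- conditional bias at most `ς_k`
    (hbias : ∀ k, ∀ᵐ ω ∂ℙ, ∀ s a,
      |MeasureTheory.condExp (ℱ k) ℙ (fun ω' => G k ω' s a) ω
          - Qval M h (sapmdTau M.γ (Fintype.card A) k) (π k ω) s a|
        ≤ (1 / 2 : ℝ) ^ (k / epochLen M.γ + 2))
    -- conditional expected squared error at most `σ_k ^ 2`
    (hvar : ∀ k, ∀ᵐ ω ∂ℙ,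
      MeasureTheory.condExp (ℱ k) ℙ (fun ω' =>
          ‖G k ω' - Qval M h (sapmdTau M.γ (Fintype.card A) k) (π k ω')‖ ^ 2) ω
        ≤ (1 / 4 : ℝ) ^ (k / epochLen M.γ + 2))
    (B : ℝ)
    (hB : B = sapmdRateConst M.γ (Fintype.card A)
      (objective M h ν (uniformPolicy S A) - objective M h ν πs)) :
    -- convergence
    (∀ k, MeasureTheory.Integrable (fun ω => objective M h ν (π k ω) - objective M h ν πs) ℙ ∧
      ∫ ω, (objective M h ν (π k ω) - objective M h ν πs) ∂ℙ
        ≤ (1 / 2 : ℝ) ^ (k / epochLen M.γ) * B) ∧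
    -- gradient complexity, if the inner method stops as soon as the accuracy is guaranteed
    ((∀ k, IsLeast {t : ℕ | 1 ≤ t ∧ agdAccuracy (sapmdSmooth M.γ (Fintype.card A) L k)
        (sapmdMu M.γ (Fintype.card A) k) t ≤ sapmdAccuracy M.γ} (T k)) →
      ∀ ε : ℝ, 0 < ε → ε ≤ 1 / 2 → ∃ K : ℕ,
        (∀ k, K ≤ k →
          ∫ ω, (objective M h ν (π k ω) - objective M h ν πs) ∂ℙ ≤ ε) ∧
        (∀ ω, ((sapmdRun M.γ dh L T (fun j => G j ω) K).gradCalls : ℝ) ≤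
          epochLen M.γ *
            (2 + Real.log (16 * L * Real.sqrt (Real.log (Fintype.card A)) * B / ((1 - M.γ) * ε)
              + 8 / (1 - M.γ) ^ 2)) *
            (Real.logb 2 (2 * B / ε)
              + 5 * Real.sqrt
                ((1 - M.γ) * L * B * Real.sqrt (M.γ * Real.log (Fintype.card A)) / ε))) ∧
        (ε ≤ L → ∀ ω, ((sapmdRun M.γ dh L T (fun j => G j ω) K).gradCalls : ℝ) ≤
          30 * (2 + Real.logb 2 (1 / M.γ)) / (1 - M.γ) *
            (1 + Real.sqrt (B * Real.sqrt (Real.log (Fintype.card A)))) *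
            Real.logb M.γ ε * Real.sqrt (L / ε))) := by
  have hγ := M.γ_pos
  have hγ1 := M.γ_lt_one
  simp only [hπ] at hbias hvar ⊢
  have hrate := sapmdRun_rate hA hL hreg hπs hν hT hTacc hGmeas hGL2 hbias hvar
  have : Nonempty A := Fintype.card_pos_iff.1 (by omega)
  have hΔ : 0 ≤ objective M h ν (uniformPolicy S A) - objective M h ν πs :=
    hπs.objective_sub_nonneg hν fun _ => uniformDist_mem
  have hB1 : 5 / 2 ≤ B := by
    rw [hB]
    exact le_sapmdRateConst hγ1 hΔ _
  rw [← hB] at hrate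
  refine ⟨hrate, fun hleast ε hε hε2 => ?_⟩
  -- K consists of I full epochs: 2^I ≥ B/ε gives the accuracy, 2^I ≤ 2B/ε the cost.
  obtain ⟨I, hI1, hI2, hI3⟩ := exists_epochs hε (show ε ≤ B by linarith)
  refine ⟨epochLen M.γ * I, fun k hk => (hrate k).2.trans ?_, fun ω => ?_, fun hεL ω => ?_⟩
  · have hle : I ≤ k / epochLen M.γ :=
      (Nat.le_div_iff_mul_le (epochLen_pos hγ hγ1)).2 (by rwa [mul_comm])
    calc (1 / 2 : ℝ) ^ (k / epochLen M.γ) * B ≤ (1 / 2) ^ I * B :=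
          mul_le_mul_of_nonneg_right (pow_le_pow_of_le_one (by norm_num) (by norm_num) hle)
            (by linarith)
      _ ≤ ε := by
          rw [one_div_pow, one_div_mul_eq_div, div_le_iff₀ (by positivity), mul_comm]
          exact (div_le_iff₀ hε).1 hI1
  · rw [sapmdRun_gradCalls]
    exact sum_iterations_le_log hγ hγ1 hA hL hleast hε (by linarith) hI2 hI3
  · rw [sapmdRun_gradCalls]
    exact sum_iterations_le_sqrt hγ hγ1 hA hL hleast hε hε2 hεL (by linarith) hI2 hI3
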